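/- Let $m\ge 1$, $n\ge 0$. Let $\mathfrak G_{2n}$ be the real Grassmann algebra generated by $x\grave{}_1,\dots,x\grave{}_{2n}$, with even part $\mathfrak G_{2n}^{(ev)}$, and let $\mathcal C_{m,2n}$ be the real algebra generated by $e_1,\dots,e_m,e\grave{}_1,\dots,e\grave{}_{2n}$ with relations $e_je_k+e_ke_j=-2\delta_{j,k}$, $e_je\grave{}_k+e\grave{}_ke_j=0$, $e\grave{}_je\grave{}_k-e\grave{}_ke\grave{}_j=g_{j,k}$, where $g_{2j,2k}=g_{2j-1,2k-1}=0$ and $g_{2j-1,2k}=-g_{2k,2j-1}=\delta_{j,k}$. Superfunctions on an open set $\Omega\subset\mathbb R^m$ are elements of $C^\infty(\Omega)\otimes\mathfrak G_{2n}\otimes\mathcal C_{m,2n}$, and superdistributions are elements of $\mathcal D'(\Omega)\otimes\mathfrak G_{2n}\otimes\mathcal C_{m,2n}$ ($\mathcal E'$ in place of $\mathcal D'$ for compact support); the three tensor factors commute with each other. The left and right super Dirac operators are $$\partial_{\bf x}\,\cdot=2\sum_{j=1}^n\big(e\grave{}_{2j}\,\partial_{x\grave{}_{2j-1}}\cdot-e\grave{}_{2j-1}\,\partial_{x\grave{}_{2j}}\cdot\big)-\sum_{j=1}^m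 e_j\,\partial_{x_j}\cdot,\qquad \cdot\,\partial_{\bf x}=-2\sum_{j=1}^n\big(\cdot\,\partial_{x\grave{}_{2j-1}}\,e\grave{}_{2j}-\cdot\,\partial_{x\grave{}_{2j}}\,e\grave{}_{2j-1}\big)-\sum_{j=1}^m \partial_{x_j}\cdot\, e_j,$$ with left, respectively right, fermionic derivatives. The integral is $\int_{\mathbb R^{m|2n}}=\int_{\mathbb R^m}dV_{\underline x}\int_B$ with the Berezin integral $\int_B=\pi^{-n}\partial_{x\grave{}_{2n}}\cdots\partial_{x\grave{}_1}$, where the integral over $\mathbb R^m$ of a compactly supported distribution is its value on the constant function $1$. Let $g=g_0+{\bf g}\in C^\infty(\mathbb R^m)\otimes\mathfrak G_{2n}^{(ev)}$, with body $g_0\in C^\infty(\mathbb R^m)$ and nilpotent part ${\bf g}$, be such that $\{g_0\le 0\}$ is compact and the gradient of $g_0$ does not vanish at any point of $g_0^{-1}(0)$. For $k\ge -1$ and $h=\pm g$ put $$\delta^{(k)}(h)=\sum_{j=0}^n\frac{{\bf h}^j}{j!}\,\delta^{(k+j)}(h_0),\qquad \delta^{(-1)}=H,$$ where $H$ is the Heaviside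 function ($H(t)=1$ for $t\ge 0$ and $H(t)=0$ for $t<0$) and $\delta^{(k)}(h_0)$, $k\ge0$, is the composition of the derivative $\delta^{(k)}$ of the Dirac distribution on $\mathbb R$ with $h_0$. Then the following hold. 1. $\partial_{\bf x}[H(-g)]=-\partial_{\bf x}[g]\,\delta(g)$ in $\mathcal D'(\mathbb R^m)\otimes\mathfrak G_{2n}\otimes\mathcal C_{m,2n}$. 2. For every open $\Omega\supset\{g_0\le 0\}$ and all $F,G\in C^\infty(\Omega)\otimes\mathfrak G_{2n}\otimes\mathcal C_{m,2n}$, $$\int_{\mathbb R^{m|2n}}H(-g)\big[(F\partial_{\bf x})G+F(\partial_{\bf x}G)\big]=\int_{\mathbb R^{m|2n}}F\,\delta(g)\,\partial_{\bf x}[g]\,G,$$ where both integrands are superdistributions with compact support in $\Omega$. 3. Let $\beta\in\mathcal E'(\mathbb R^m)\otimes\mathfrak G_{2n}\otimes\mathcal C_{m,2n}$ have singular support disjoint from $g_0^{-1}(0)$. Then the products $H(-g)(\beta\partial_{\bf x})$, $H(-g)\beta$ and $\beta\,\delta(g)$ are defined as products of superdistributions with disjoint singular supports, that is, by $$\langle\alpha\gamma,\phi\rangle=\langle\alpha,(\chi\gamma)\phi\rangle+\langle\gamma,((1-\chi)\alpha)\phi\rangle$$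 on coefficients, for any $\chi\in C^\infty(\mathbb R^m)$ equal to $1$ near the singular support of $\alpha$ and to $0$ near that of $\gamma$. Moreover, for every open $\Omega\supset\{g_0\le 0\}$ and every $G\in C^\infty(\Omega)\otimes\mathfrak G_{2n}\otimes\mathcal C_{m,2n}$, $$\int_{\mathbb R^{m|2n}}H(-g)\big[(\beta\partial_{\bf x})G+\beta(\partial_{\bf x}G)\big]=\int_{\mathbb R^{m|2n}}\beta\,\delta(g)\,\partial_{\bf x}[g]\,G,$$ where again both integrands have compact support in $\Omega$. -/

import Mathlib

open TopologicalSpace MeasureTheory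
open scoped Distributions ContDiff TensorProduct Topology

noncomputable section

namespace SuperStokes

/-- Bosonic space `ℝ^m`. -/
abbrev E (m : ℕ) : Type := EuclideanSpace ℝ (Fin m)

/-! ### Smooth functions on an open set -/

section Smooth

variable {m : ℕ} {Ω : Opens (E m)}

/-- Extension by zero of a function on `Ω`. -/
def ext0 (f : Ω → ℝ) (x : E m) : ℝ :=
  open scoped Classical in if h : x ∈ Ω then f ⟨x, h⟩ else 0

theorem ext0_of_mem (f : Ω → ℝ) {x : E m} (h : x ∈ Ω) : ext0 f x = f ⟨x, h⟩ := by
  simp [ext0, h]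

variable (Ω) in
/-- The algebra `C^∞(Ω)` of smooth real functions on the open set `Ω`. -/
def Smooth : Subalgebra ℝ (Ω → ℝ) where
  carrier := {f | ContDiffOn ℝ ∞ (ext0 f) Ω}
  mul_mem' {f g} hf hg := (ContDiffOn.mul hf hg).congr fun x hx => by
    simp [ext0_of_mem _ (show x ∈ Ω from hx)]
  add_mem' {f g} hf hg := (ContDiffOn.add hf hg).congr fun x hx => by
    simp [ext0_of_mem _ (show x ∈ Ω from hx)]
  algebraMap_mem' r := (contDiffOn_const (c := r)).congr fun x hx => by
    simp [ext0_of_mem _ (show x ∈ Ω from hx)]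

theorem Smooth.contDiffAt (f : Smooth Ω) {x : E m} (hx : x ∈ Ω) :
    ContDiffAt ℝ ∞ (ext0 f.1) x :=
  (f.2 : ContDiffOn ℝ ∞ (ext0 f.1) Ω).contDiffAt (Ω.isOpen.mem_nhds hx)

theorem ext0_add_of_mem (f g : Smooth Ω) {x : E m} (hx : x ∈ Ω) :
    ext0 (f + g).1 =ᶠ[𝓝 x] ext0 f.1 + ext0 g.1 := by
  filter_upwards [Ω.isOpen.mem_nhds hx] with y hy
  simp [ext0_of_mem _ (show y ∈ Ω from hy)]

theorem ext0_smul_of_mem (c : ℝ) (f : Smooth Ω) {x : E m} (hx : x ∈ Ω) :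
    ext0 (c • f).1 =ᶠ[𝓝 x] c • ext0 f.1 := by
  filter_upwards [Ω.isOpen.mem_nhds hx] with y hy
  simp [ext0_of_mem _ (show y ∈ Ω from hy)]

/-- The partial derivative `∂_{x_j}` on `C^∞(Ω)`. -/
def pderiv (j : Fin m) : Smooth Ω →ₗ[ℝ] Smooth Ω where
  toFun f := ⟨fun x => fderiv ℝ (ext0 f.1) x (EuclideanSpace.single j 1), by
    have h : ContDiffOn ℝ ∞ (fun x => fderiv ℝ (ext0 f.1) x (EuclideanSpace.single j 1)) Ω :=
      ((f.2 : ContDiffOn ℝ ∞ (ext0 f.1) Ω).fderiv_of_isOpen Ω.isOpen (by simp)).clm_apply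
        contDiffOn_const
    exact h.congr fun x hx => by simp [ext0_of_mem _ (show x ∈ Ω from hx)]⟩
  map_add' f g := by
    ext x
    have h1 := (Smooth.contDiffAt f x.2).differentiableAt (by simp)
    have h2 := (Smooth.contDiffAt g x.2).differentiableAt (by simp)
    change fderiv ℝ (ext0 (f + g).1) x _ = fderiv ℝ (ext0 f.1) x _ + fderiv ℝ (ext0 g.1) x _
    rw [(ext0_add_of_mem f g x.2).fderiv_eq, fderiv_add h1 h2]
    rfl
  map_smul' c f := by
    ext x
    have h1 := (Smooth.contDiffAt f x.2).differentiableAt (by simp)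
    change fderiv ℝ (ext0 (c • f).1) x _ = c • fderiv ℝ (ext0 f.1) x _
    rw [(ext0_smul_of_mem c f x.2).fderiv_eq, fderiv_const_smul h1 c]
    rfl

/-- Restriction `C^∞(Ω₁) → C^∞(Ω)` for `Ω ⊆ Ω₁`. -/
def Smooth.restrict {Ω₁ : Opens (E m)} (h : Ω ≤ Ω₁) : Smooth Ω₁ →ₐ[ℝ] Smooth Ω where
  toFun f := ⟨fun x => f.1 ⟨x.1, h x.2⟩,
    ((f.2 : ContDiffOn ℝ ∞ (ext0 f.1) Ω₁).mono h).congr fun x hx => by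
      rw [ext0_of_mem _ (show x ∈ Ω from hx), ext0_of_mem _ (h hx)]⟩
  map_one' := rfl
  map_mul' _ _ := rfl
  map_zero' := rfl
  map_add' _ _ := rfl
  commutes' _ := rfl

end Smooth

/-! ### Operations on scalar distributions -/

section Dist

variable {m : ℕ} {Ω : Opens (E m)}

/-- Product of a smooth function on `Ω` and a test function on `Ω`. -/
def testMulFun (f : Smooth Ω) (φ : 𝓓(Ω, ℝ)) : 𝓓(Ω, ℝ) where
  toFun x := ext0 f.1 x * φ x
  contDiff' := contDiff_iff_contDiffAt.2 fun x => by
    by_cases hx : x ∈ tsupport φ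
    · exact (Smooth.contDiffAt f (φ.tsupport_subset hx)).mul φ.contDiff.contDiffAt
    · have : (fun y => ext0 f.1 y * φ y) =ᶠ[𝓝 x] fun _ => 0 := by
        filter_upwards [notMem_tsupport_iff_eventuallyEq.1 hx] with y hy
        simp [hy]
      exact contDiffAt_const.congr_of_eventuallyEq this
  hasCompactSupport' := φ.hasCompactSupport.mul_left
  tsupport_subset' := (tsupport_mul_subset_right).trans φ.tsupport_subset

@[simp] theorem testMulFun_apply (f : Smooth Ω) (φ : 𝓓(Ω, ℝ)) (x : E m) :
    testMulFun f φ x = ext0 f.1 x * φ x := rfl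

theorem exists_cutoff (f : Smooth Ω) (K : Compacts (E m)) (hK : (K : Set (E m)) ⊆ Ω) :
    ∃ g : E m → ℝ, ContDiff ℝ ∞ g ∧ ∀ x ∈ K, g x = ext0 f.1 x := by
  obtain ⟨χ, h0, h1, -⟩ := exists_contMDiffMap_zero_one_nhds_of_isClosed
    (modelWithCornersSelf ℝ (E m)) (n := ⊤)
    (s := (Ω : Set (E m))ᶜ) (t := K) Ω.isOpen.isClosed_compl K.isCompact.isClosed
    (Set.disjoint_left.2 fun x hx hk => hx (hK hk))
  have hχ : ContDiff ℝ ∞ χ := χ.contMDiff.contDiff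
  refine ⟨fun x => χ x * ext0 f.1 x, contDiff_iff_contDiffAt.2 fun x => ?_, fun x hx => ?_⟩
  · by_cases hx : x ∈ Ω
    · exact hχ.contDiffAt.mul (Smooth.contDiffAt f hx)
    · have h0' := Filter.eventually_of_mem h0 (fun y hy => hy)
      have : (fun y => χ y * ext0 f.1 y) =ᶠ[𝓝 x] fun _ => 0 := by
        filter_upwards [h0.filter_mono (nhds_le_nhdsSet (show x ∈ (Ω : Set (E m))ᶜ from hx))]
          with y hy
        simp [hy]
      exact contDiffAt_const.congr_of_eventuallyEq this
  · have := (h1.filter_mono (nhds_le_nhdsSet hx)).self_of_nhds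
    simp [this]

/-- Multiplication by a smooth function, as a continuous operator on test functions. -/
def testMul (f : Smooth Ω) : 𝓓(Ω, ℝ) →L[ℝ] 𝓓(Ω, ℝ) :=
  TestFunction.limitCLM ℝ (testMulFun f)
    (fun K hK => TestFunction.ofSupportedInCLM ℝ hK ∘L
      ContDiffMapSupportedIn.bilinLeftCLM (ContinuousLinearMap.mul ℝ ℝ)
        (exists_cutoff f K hK).choose_spec.1)
    (fun K hK φ => by
      ext x
      have h := (exists_cutoff f K hK).choose_spec.2
      by_cases hx : x ∈ K
      · simp [← h x hx, mul_comm]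
      · simp [φ.zero_on_compl hx])

@[simp] theorem testMul_apply (f : Smooth Ω) (φ : 𝓓(Ω, ℝ)) (x : E m) :
    testMul f φ x = ext0 f.1 x * φ x := rfl

/-- The product `f T` of a smooth function and a distribution: `⟨f T, φ⟩ = ⟨T, f φ⟩`. -/
def smulDist : Smooth Ω →ₗ[ℝ] 𝓓'(Ω, ℝ) →ₗ[ℝ] 𝓓'(Ω, ℝ) :=
  LinearMap.mk₂ ℝ (fun f T => (testMul f).precompCompactConvergenceCLM ℝ T)
    (fun f g T => by
      ext φ
      have : testMul (f + g) φ = testMul f φ + testMul g φ := by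
        ext x
        by_cases hx : x ∈ Ω
        · simp [ext0_of_mem _ hx, add_mul]
        · simp [ext0, hx]
      change T (testMul (f + g) φ) = T (testMul f φ) + T (testMul g φ)
      rw [this, map_add])
    (fun c f T => by
      ext φ
      have : testMul (c • f) φ = c • testMul f φ := by
        ext x
        by_cases hx : x ∈ Ω
        · simp [ext0_of_mem _ hx, mul_assoc]
        · simp [ext0, hx]
      change T (testMul (c • f) φ) = c • T (testMul f φ)
      rw [this, map_smul])
    (fun _ _ _ => rfl)
    (fun _ _ _ => rfl)

@[simp] theorem smulDist_apply (f : Smooth Ω) (T : 𝓓'(Ω, ℝ)) (φ : 𝓓(Ω, ℝ)) :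
    smulDist f T φ = T (testMul f φ) := rfl

/-- The distributional partial derivative `∂_{x_j}`: `⟨∂_{x_j} T, φ⟩ = -⟨T, ∂_{x_j} φ⟩`. -/
def distDeriv (j : Fin m) : 𝓓'(Ω, ℝ) →ₗ[ℝ] 𝓓'(Ω, ℝ) :=
  (Distribution.lineDerivCLM (EuclideanSpace.single j 1)).toLinearMap

/-- Restriction of a distribution on `Ω₁` to `Ω ⊆ Ω₁`. -/
def distRestrict {Ω₁ : Opens (E m)} (_ : Ω ≤ Ω₁) : 𝓓'(Ω₁, ℝ) →ₗ[ℝ] 𝓓'(Ω, ℝ) :=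
  ((TestFunction.monoCLM ℝ :
    𝓓(Ω, ℝ) →L[ℝ] 𝓓(Ω₁, ℝ)).precompCompactConvergenceCLM ℝ).toLinearMap

variable (Ω) in
/-- The distribution `φ ↦ ∫ φ dV`. -/
def lebesgueDist : 𝓓'(Ω, ℝ) :=
  TestFunction.integralAgainstBilinCLM (ContinuousLinearMap.mul ℝ ℝ) volume (fun _ => (1 : ℝ))

theorem lebesgueDist_apply (φ : 𝓓(Ω, ℝ)) : lebesgueDist Ω φ = ∫ x, φ x := by
  have h : LocallyIntegrableOn (fun _ : E m => (1 : ℝ)) Ω volume :=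
    (locallyIntegrable_const 1).locallyIntegrableOn _
  refine (TestFunction.integralAgainstBilinCLM_eq_integral h).trans ?_
  simp

/-- A smooth function seen as a distribution: `φ ↦ ∫ f φ dV`. -/
def ofSmooth : Smooth Ω →ₗ[ℝ] 𝓓'(Ω, ℝ) := smulDist.flip (lebesgueDist Ω)

theorem ofSmooth_apply (f : Smooth Ω) (φ : 𝓓(Ω, ℝ)) :
    ofSmooth f φ = ∫ x, ext0 f.1 x * φ x :=
  lebesgueDist_apply _

/-- The distribution `H(g₀)`, i.e. `φ ↦ ∫_{g₀ ≥ 0} φ dV`. -/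
def heaviside₀ (g₀ : Smooth (⊤ : Opens (E m))) : 𝓓'((⊤ : Opens (E m)), ℝ) :=
  TestFunction.integralAgainstBilinCLM (ContinuousLinearMap.mul ℝ ℝ) volume
    (Set.indicator {x : E m | 0 ≤ ext0 g₀.1 x} fun _ => (1 : ℝ))

theorem heaviside₀_apply (g₀ : Smooth (⊤ : Opens (E m))) (φ : 𝓓((⊤ : Opens (E m)), ℝ)) :
    heaviside₀ g₀ φ = ∫ x in {x : E m | 0 ≤ ext0 g₀.1 x}, φ x := by
  have hc : Continuous (ext0 g₀.1) :=
    continuous_iff_continuousAt.2 fun x => (Smooth.contDiffAt g₀ (by simp)).continuousAt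
  have hs : MeasurableSet {x : E m | 0 ≤ ext0 g₀.1 x} :=
    (isClosed_le continuous_const hc).measurableSet
  have h : LocallyIntegrableOn (Set.indicator {x : E m | 0 ≤ ext0 g₀.1 x} fun _ => (1 : ℝ))
      (⊤ : Opens (E m)) volume :=
    ((locallyIntegrable_const 1).indicator hs).locallyIntegrableOn _
  refine (TestFunction.integralAgainstBilinCLM_eq_integral h).trans ?_
  rw [← integral_indicator hs]
  congr 1
  ext x
  by_cases hx : 0 ≤ ext0 g₀.1 x <;> simp [Set.indicator, hx]

/-- The integral of `φ` over the fibre `g₀⁻¹(t)`,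
`J_φ(t) = ∫_{g₀ = t} φ / |∇ g₀| dS = -d/dt ∫_{g₀ ≥ t} φ dV`.
It is the function with `∫ u(g₀(x)) φ(x) dV = ∫ u(t) J_φ(t) dt`. -/
def fibreIntegral (g₀ : Smooth (⊤ : Opens (E m))) (φ : 𝓓((⊤ : Opens (E m)), ℝ)) (t : ℝ) : ℝ :=
  -deriv (fun s : ℝ => ∫ x in {x : E m | s ≤ ext0 g₀.1 x}, φ x) t

open scoped Classical in
/-- The distribution `δ^{(k)}(g₀)`, the composition of `δ^{(k)}` with `g₀`:
`⟨δ^{(k)}(g₀), φ⟩ = ⟨δ^{(k)}(t), J_φ(t)⟩ = (-1)^k J_φ^{(k)}(0)`. It is used for `g₀` whose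
gradient does not vanish on `g₀⁻¹(0)`; then `J_φ` is smooth near `0` and this formula does
define a distribution. -/
def delta₀ (k : ℕ) (g₀ : Smooth (⊤ : Opens (E m))) : 𝓓'((⊤ : Opens (E m)), ℝ) :=
  if h : ∃ T : 𝓓'((⊤ : Opens (E m)), ℝ),
      ∀ φ, T φ = (-1) ^ k * iteratedDeriv k (fibreIntegral g₀ φ) 0
  then h.choose else 0

/-- `δ^{(k-1)}(g₀)`, where `δ^{(-1)} = H`. -/
def deltaPred₀ (k : ℕ) (g₀ : Smooth (⊤ : Opens (E m))) : 𝓓'((⊤ : Opens (E m)), ℝ) :=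
  match k with
  | 0 => heaviside₀ g₀
  | k + 1 => delta₀ k g₀

end Dist

/-! ### Grassmann algebra, Clifford algebra -/

/-- The Grassmann algebra `𝔊_{2n}`. -/
abbrev Gr (n : ℕ) : Type := ExteriorAlgebra ℝ (Fin (2 * n) → ℝ)

/-- The even subalgebra `𝔊_{2n}^{(ev)}`. -/
abbrev GrEv (n : ℕ) : Subalgebra ℝ (Gr n) :=
  CliffordAlgebra.even (0 : QuadraticForm ℝ (Fin (2 * n) → ℝ))

/-- The left fermionic derivative `∂_{x`_j} ·`, characterised by `∂_{x`_j} 1 = 0` and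
`∂_{x`_j} (x`_k a) = δ_{jk} a - x`_k ∂_{x`_j} a`. -/
def grL {n : ℕ} (j : Fin (2 * n)) : Gr n →ₗ[ℝ] Gr n :=
  CliffordAlgebra.contractLeft (Q := (0 : QuadraticForm ℝ (Fin (2 * n) → ℝ))) (LinearMap.proj j)

/-- The right fermionic derivative `· ∂_{x`_j}`, characterised by `1 ∂_{x`_j} = 0` and
`(a x`_k) ∂_{x`_j} = δ_{jk} a - (a ∂_{x`_j}) x`_k`. -/
def grR {n : ℕ} (j : Fin (2 * n)) : Gr n →ₗ[ℝ] Gr n :=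
  (CliffordAlgebra.contractRight (Q := (0 : QuadraticForm ℝ (Fin (2 * n) → ℝ)))).flip
    (LinearMap.proj j)

/-- The Berezin integral `π^{-n} ∂_{x`_{2n}} ⋯ ∂_{x`_1}`. -/
def grBerezin (n : ℕ) : Gr n →ₗ[ℝ] ℝ :=
  ((Real.pi ^ n)⁻¹ : ℝ) • ((ExteriorAlgebra.algebraMapInv).toLinearMap ∘ₗ
    (((List.ofFn fun j : Fin (2 * n) => (grL j : Module.End ℝ (Gr n))).reverse.prod :
      Module.End ℝ (Gr n))))

/-- The symplectic form `g_{j,k}` (indices shifted to start at `0`):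
`g_{2j-1,2k} = -g_{2k,2j-1} = δ_{j,k}` and `g_{2j,2k} = g_{2j-1,2k-1} = 0`. -/
def symp {n : ℕ} (a b : Fin (2 * n)) : ℝ :=
  if a.1 % 2 = 0 ∧ b.1 = a.1 + 1 then 1
  else if b.1 % 2 = 0 ∧ a.1 = b.1 + 1 then -1
  else 0

/-- Generators of `𝒞_{m,2n}` inside the free algebra: `inl j` is `e_j`, `inr k` is `e`_k`. -/
abbrev freeGen (m n : ℕ) (i : Fin m ⊕ Fin (2 * n)) : FreeAlgebra ℝ (Fin m ⊕ Fin (2 * n)) :=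
  FreeAlgebra.ι ℝ i

/-- The defining relations of `𝒞_{m,2n}`. -/
inductive ClRel (m n : ℕ) :
    FreeAlgebra ℝ (Fin m ⊕ Fin (2 * n)) → FreeAlgebra ℝ (Fin m ⊕ Fin (2 * n)) → Prop
  | orth (j k : Fin m) : ClRel m n
      (freeGen m n (.inl j) * freeGen m n (.inl k) + freeGen m n (.inl k) * freeGen m n (.inl j))
      (algebraMap ℝ _ (-2 * if j = k then 1 else 0))
  | mixed (j : Fin m) (k : Fin (2 * n)) : ClRel m n
      (freeGen m n (.inl j) * freeGen m n (.inr k) + freeGen m n (.inr k) * freeGen m n (.inl j))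
      0
  | sympl (j k : Fin (2 * n)) : ClRel m n
      (freeGen m n (.inr j) * freeGen m n (.inr k) - freeGen m n (.inr k) * freeGen m n (.inr j))
      (algebraMap ℝ _ (symp j k))

/-- The Clifford algebra `𝒞_{m,2n}` with `m` orthogonal and `2n` symplectic generators. -/
abbrev Cl (m n : ℕ) : Type := RingQuot (ClRel m n)

/-- The orthogonal Clifford generator `e_j`. -/
def e {m n : ℕ} (j : Fin m) : Cl m n := RingQuot.mkAlgHom ℝ (ClRel m n) (freeGen m n (.inl j))

/-- The symplectic Clifford generator `e`_k`. -/
def e' {m n : ℕ} (k : Fin (2 * n)) : Cl m n :=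
  RingQuot.mkAlgHom ℝ (ClRel m n) (freeGen m n (.inr k))

/-- The algebra of values `𝔊_{2n} ⊗ 𝒞_{m,2n}`; the two factors commute. -/
abbrev A (m n : ℕ) : Type := Gr n ⊗[ℝ] Cl m n

/-- The Berezin integral on `𝔊_{2n} ⊗ 𝒞_{m,2n}`. -/
def berezin (m n : ℕ) : A m n →ₗ[ℝ] Cl m n :=
  (TensorProduct.lid ℝ (Cl m n)).toLinearMap ∘ₗ TensorProduct.map (grBerezin n) LinearMap.id

/-! ### Superfunctions and superdistributions -/

/-- Superfunctions `C^∞(Ω) ⊗ 𝔊_{2n} ⊗ 𝒞_{m,2n}`. -/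
abbrev SFun {m : ℕ} (Ω : Opens (E m)) (n : ℕ) : Type := Smooth Ω ⊗[ℝ] A m n

/-- Superdistributions `𝓓'(Ω) ⊗ 𝔊_{2n} ⊗ 𝒞_{m,2n}`. -/
abbrev SDist {m : ℕ} (Ω : Opens (E m)) (n : ℕ) : Type := 𝓓'(Ω, ℝ) ⊗[ℝ] A m n

section Dirac

variable {m n : ℕ} {V : Type*} [AddCommGroup V] [Module ℝ V]

/-- The index `2j-1` of the fermionic variables (`j = 1, …, n`). -/
def oddIdx (j : Fin n) : Fin (2 * n) := ⟨2 * j.1, by omega⟩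

/-- The index `2j` of the fermionic variables (`j = 1, …, n`). -/
def evenIdx (j : Fin n) : Fin (2 * n) := ⟨2 * j.1 + 1, by omega⟩

/-- `b ∂_{x`_k} ·` on `V ⊗ 𝔊 ⊗ 𝒞`, with `b ∈ 𝒞` multiplying from the left. -/
def fermL (b : Cl m n) (k : Fin (2 * n)) : V ⊗[ℝ] A m n →ₗ[ℝ] V ⊗[ℝ] A m n :=
  TensorProduct.map LinearMap.id (TensorProduct.map (grL k) (LinearMap.mulLeft ℝ b))

/-- `· ∂_{x`_k} b` on `V ⊗ 𝔊 ⊗ 𝒞`, with `b ∈ 𝒞` multiplying from the right. -/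
def fermR (b : Cl m n) (k : Fin (2 * n)) : V ⊗[ℝ] A m n →ₗ[ℝ] V ⊗[ℝ] A m n :=
  TensorProduct.map LinearMap.id (TensorProduct.map (grR k) (LinearMap.mulRight ℝ b))

/-- The left super Dirac operator
`∂_x · = 2 ∑_j (e`_{2j} ∂_{x`_{2j-1}} · - e`_{2j-1} ∂_{x`_{2j}} ·) - ∑_j e_j ∂_{x_j} ·`
on `V ⊗ 𝔊_{2n} ⊗ 𝒞_{m,2n}`, where `d j` is the action of `∂_{x_j}` on `V`. -/
def diracL (d : Fin m → V →ₗ[ℝ] V) : V ⊗[ℝ] A m n →ₗ[ℝ] V ⊗[ℝ] A m n :=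
  (2 : ℝ) • (∑ j : Fin n,
    (fermL (e' (evenIdx j)) (oddIdx j) - fermL (e' (oddIdx j)) (evenIdx j)))
  - ∑ j : Fin m,
    TensorProduct.map (d j) (TensorProduct.map LinearMap.id (LinearMap.mulLeft ℝ (e j)))

/-- The right super Dirac operator
`· ∂_x = -2 ∑_j (· ∂_{x`_{2j-1}} e`_{2j} - · ∂_{x`_{2j}} e`_{2j-1}) - ∑_j · ∂_{x_j} e_j`. -/
def diracR (d : Fin m → V →ₗ[ℝ] V) : V ⊗[ℝ] A m n →ₗ[ℝ] V ⊗[ℝ] A m n :=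
  -((2 : ℝ) • (∑ j : Fin n,
    (fermR (e' (evenIdx j)) (oddIdx j) - fermR (e' (oddIdx j)) (evenIdx j))))
  - ∑ j : Fin m,
    TensorProduct.map (d j) (TensorProduct.map LinearMap.id (LinearMap.mulRight ℝ (e j)))

end Dirac

section Super

variable {m n : ℕ} {Ω : Opens (E m)}

/-- Product of a superfunction (left) and a superdistribution (right). -/
def funMulDist : SFun Ω n →ₗ[ℝ] SDist Ω n →ₗ[ℝ] SDist Ω n :=
  TensorProduct.map₂ smulDist (LinearMap.mul ℝ (A m n))

/-- Product of a superdistribution (left) and a superfunction (right). -/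
def distMulFun : SDist Ω n →ₗ[ℝ] SFun Ω n →ₗ[ℝ] SDist Ω n :=
  TensorProduct.map₂ smulDist.flip (LinearMap.mul ℝ (A m n))

/-- Restriction of a superfunction to a smaller open set. -/
def SFun.restrict {Ω₁ : Opens (E m)} (h : Ω ≤ Ω₁) : SFun Ω₁ n →ₗ[ℝ] SFun Ω n :=
  TensorProduct.map (Smooth.restrict h).toLinearMap LinearMap.id

/-- Restriction of a superdistribution to a smaller open set. -/
def SDist.restrict {Ω₁ : Opens (E m)} (h : Ω ≤ Ω₁) : SDist Ω₁ n →ₗ[ℝ] SDist Ω n :=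
  TensorProduct.map (distRestrict h) LinearMap.id

/-- A superfunction seen as a superdistribution. -/
def SFun.toDist : SFun Ω n →ₗ[ℝ] SDist Ω n := TensorProduct.map ofSmooth LinearMap.id

/-- Coefficientwise evaluation on a real test function. -/
def SDist.eval (γ : SDist Ω n) (φ : 𝓓(Ω, ℝ)) : A m n :=
  TensorProduct.lift
    (LinearMap.mk₂ ℝ (fun (T : 𝓓'(Ω, ℝ)) (a : A m n) => T φ • a)
      (fun T S a => add_smul (T φ) (S φ) a) (fun c T a => mul_smul c (T φ) a)
      (fun T a b => smul_add (T φ) a b) (fun c T a => smul_comm (T φ) c a)) γ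

/-- The support of a superdistribution. -/
def SDist.supp (γ : SDist Ω n) : Set (E m) := Distribution.dsupport γ.eval

/-- `γ` has compact support contained in `Ω`. -/
def SDist.HasCompactSupp (γ : SDist Ω n) : Prop := IsCompact γ.supp ∧ γ.supp ⊆ Ω

open scoped Classical in
/-- The integral `∫_{ℝ^{m|2n}} γ = ∫_{ℝ^m} dV ∫_B γ ∈ 𝒞_{m,2n}` of a superdistribution on `Ω`
with compact support in `Ω`. The bosonic integral of a compactly supported distribution is its
value on the constant `1`, that is, on any test function equal to `1` near the support. In
particular `∫ F α G`, for superfunctions `F`, `G` on `Ω`, is the action of `α` on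
superfunctions with arbitrary support. -/
def superIntegral (γ : SDist Ω n) : Cl m n :=
  if h : ∃ χ : 𝓓(Ω, ℝ), ∀ᶠ x in 𝓝ˢ γ.supp, χ x = 1 then berezin m n (γ.eval h.choose) else 0

/-- `∫ γ = ∫ γ'`, both integrals being defined (compact supports in `Ω`). -/
def SuperIntegralEq (γ γ' : SDist Ω n) : Prop :=
  γ.HasCompactSupp ∧ γ'.HasCompactSupp ∧ superIntegral γ = superIntegral γ'

/-- The singular support of a superdistribution. -/
def SDist.singSupp (γ : SDist Ω n) : Set (E m) :=
  {x | ¬ ∃ (U : Opens (E m)) (hU : U ≤ Ω) (f : SFun U n), x ∈ U ∧ γ.restrict hU = f.toDist}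

/-- The data used to multiply superdistributions `α`, `β` on `ℝ^m` with disjoint singular
supports: a smooth `χ` that equals `0` near the singular support of `β` and `1` near that of
`α`, and the smooth superfunctions `p = χ β` and `q = (1 - χ) α`. -/
def IsMulData (α β : SDist (⊤ : Opens (E m)) n)
    (D : Smooth (⊤ : Opens (E m)) × SFun (⊤ : Opens (E m)) n × SFun (⊤ : Opens (E m)) n) :
    Prop :=
  (∀ᶠ x in 𝓝ˢ β.singSupp, ext0 D.1.1 x = 0) ∧
  (∀ᶠ x in 𝓝ˢ α.singSupp, ext0 D.1.1 x = 1) ∧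
  D.2.1.toDist = funMulDist (D.1 ⊗ₜ 1) β ∧
  D.2.2.toDist = funMulDist ((1 - D.1) ⊗ₜ 1) α

/-- The product `α β` is defined. -/
def MulDefined (α β : SDist (⊤ : Opens (E m)) n) : Prop := ∃ D, IsMulData α β D

open scoped Classical in
/-- The product of superdistributions on `ℝ^m` with disjoint singular supports,
`⟨α β, φ⟩ = ⟨α, (β χ) φ⟩ + ⟨(α (1 - χ)) β, φ⟩`. Since `χ` can be chosen the same for all
components, this is `∑_{A,B} α_A β_B x`_A x`_B` with the scalar products
`⟨α_A β_B, φ⟩ = ⟨α_A, β_B χ φ⟩ + ⟨β_B, α_A (1 - χ) φ⟩`. -/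
def distMulDist (α β : SDist (⊤ : Opens (E m)) n) : SDist (⊤ : Opens (E m)) n :=
  if h : MulDefined α β then
    distMulFun α h.choose.2.1 + funMulDist h.choose.2.2 β
  else 0

/-- Even superfunctions `C^∞(ℝ^m) ⊗ 𝔊_{2n}^{(ev)}`. -/
abbrev EvFun (m n : ℕ) : Type := Smooth (⊤ : Opens (E m)) ⊗[ℝ] GrEv n

instance : CommRing (Smooth Ω) := (Smooth Ω).toCommRing

instance : Ring (GrEv n) := (GrEv n).toRing

instance : Ring (EvFun m n) := Algebra.TensorProduct.instRing

instance : AddCommGroup (EvFun m n) := Ring.toAddCommGroup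

instance : AddGroup (EvFun m n) := AddCommGroup.toAddGroup

/-- The body `g₀ ∈ C^∞(ℝ^m)` of an even superfunction. -/
def body : EvFun m n →ₐ[ℝ] Smooth (⊤ : Opens (E m)) :=
  (Algebra.TensorProduct.rid ℝ ℝ _).toAlgHom.comp (Algebra.TensorProduct.map (AlgHom.id ℝ _)
    ((ExteriorAlgebra.algebraMapInv (R := ℝ) (M := Fin (2 * n) → ℝ)).comp (GrEv n).val))

/-- The inclusion `C^∞(ℝ^m) ⊗ 𝔊_{2n}^{(ev)} → C^∞(ℝ^m) ⊗ 𝔊_{2n} ⊗ 𝒞_{m,2n}`. -/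
def EvFun.toSFun : EvFun m n →ₐ[ℝ] SFun (⊤ : Opens (E m)) n :=
  Algebra.TensorProduct.map (AlgHom.id ℝ _)
    ((Algebra.TensorProduct.includeLeft : Gr n →ₐ[ℝ] A m n).comp (GrEv n).val)

/-- The nilpotent part `𝐠 = g - g₀`. -/
def nilPart (g : EvFun m n) : EvFun m n := g - body g ⊗ₜ 1

/-- `δ^{(k-1)}(g) = ∑_{j=0}^n (𝐠^j / j!) δ^{(k-1+j)}(g₀)`, where `δ^{(-1)} = H`. -/
def superDeltaPred (k : ℕ) (g : EvFun m n) : SDist (⊤ : Opens (E m)) n :=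
  ∑ j ∈ Finset.range (n + 1), ((j.factorial : ℝ)⁻¹) •
    funMulDist (EvFun.toSFun (nilPart g ^ j)) (deltaPred₀ (k + j) (body g) ⊗ₜ 1)

/-- The Heaviside distribution `H(g)`. -/
def superHeaviside (g : EvFun m n) : SDist (⊤ : Opens (E m)) n := superDeltaPred 0 g

/-- The Dirac distribution `δ(g)`. -/
def superDelta (g : EvFun m n) : SDist (⊤ : Opens (E m)) n := superDeltaPred 1 g

end Super

end SuperStokes

end

/-!
The argument rests on four facts.

*Commutation.* Even elements of the Grassmann algebra are central, and the Dirac operators, although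
they are not derivations of `𝔊 ⊗ 𝒞`, satisfy the Leibniz rule as soon as one factor lies in
`V ⊗ 𝔊^{(ev)}` (`evScalar`): see `diracL_bmul`, `diracR_bmul`. On such elements the left and right
Dirac operators coincide (`diracR_eq_diracL_of_evScalar`). All products that occur (function times
function, function times distribution, distribution times function) are instances of one
construction `bmul`, so these rules are proved once.

*Composition with `g₀`.* Put `I_φ(t) = ∫_{g₀ ≥ t} φ dV`. The coarea formula is replaced by the
identity `d/dt I_{φ ∂_j g₀}(t) = I_{∂_j φ}(t)` (`hasDerivAt_superlevel_testMul_pderiv`), which is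
integration by parts against a smoothed indicator function of `{g₀ ≥ t}`. Near the zero set there
is a vector field `X` with `X g₀ = 1`, so every `t`-derivative of `I_φ` near `0` is again of the
form `I_ψ`. Therefore `δ^{(k)}(g₀)` exists, is an iterated derivative of `H(g₀)`, satisfies the
chain rule `∂_j δ^{(k-1)}(g₀) = (∂_j g₀) δ^{(k)}(g₀)`, and is supported in `{g₀ = 0}`.

*The derivative of `H(-g)`.* The nilpotent part satisfies `𝐠ⁿ⁺¹ = 0`, since it has degree at least
two in `2n` anticommuting variables; hence `∂_x[𝐠] 𝐠ⁿ = 0`, and the derivatives of the powers of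
`𝐠` telescope against those of the coefficients in the Taylor sum of `H(-g)`
(`diracL_superHeaviside_neg`).

*Integration.* The Berezin integral of `(P ∂_x) G + P (∂_x G)` is a sum of bosonic partial
derivatives (`berezin_diracR_bmul_add`), so it integrates to zero when `P` has compact support
(`superIntegralEq_of_eq_add`). For `P = F H(-g)` the Leibniz rule and the formula for `∂_x[H(-g)]`
turn this into the Stokes formula for superfunctions. For a superdistribution `β` one takes
`P = H(-g) β`: the Leibniz rule `(H(-g) β) ∂_x = H(-g) (β ∂_x) - β δ(g) ∂_x[g]` can be checked
locally, and near each point either `β` is smooth or `H(-g)` is constant and `δ(g) = 0`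
(`diracR_distMulDist`).
-/

open TopologicalSpace MeasureTheory
open scoped Distributions ContDiff TensorProduct Topology

noncomputable section

namespace SuperStokes

/-! ### Contractions on a Clifford algebra -/

section Contraction

open CliffordAlgebra

variable {R M : Type*} [CommRing R] [AddCommGroup M] [Module R M] {Q : QuadraticForm R M}
  (d : Module.Dual R M)

theorem contractLeft_mul (a b : CliffordAlgebra Q) :
    contractLeft d (a * b) = contractLeft d a * b + involute a * contractLeft d b := by
  induction a using left_induction with
  | algebraMap r => simp [contractLeft_algebraMap_mul]
  | add x y hx hy => simp only [add_mul, map_add, hx, hy]; abel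
  | ι_mul x m hx =>
    simp only [mul_assoc, contractLeft_ι_mul, hx, map_mul, involute_ι, sub_mul, mul_add,
      neg_mul, smul_mul_assoc]
    abel

theorem contractLeft_involute (a : CliffordAlgebra Q) :
    contractLeft d (involute a) = -involute (contractLeft d a) := by
  induction a using left_induction with
  | algebraMap r => simp
  | add x y hx hy => simp only [map_add, hx, hy, neg_add]
  | ι_mul x m hx =>
    simp only [map_mul, contractLeft_ι_mul, hx, map_sub, map_smul, involute_ι, neg_mul, map_neg,
      mul_neg]

theorem contractRight_eq_involute (a : CliffordAlgebra Q) :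
    contractRight a d = involute (contractLeft d a) := by
  induction a using right_induction with
  | algebraMap r => simp
  | add x y hx hy => simp only [map_add, LinearMap.add_apply, hx, hy]
  | mul_ι m x hx =>
    rw [contractRight_mul_ι, hx, contractLeft_mul, contractLeft_ι, map_add, map_mul, map_mul,
      involute_involute, involute_ι, AlgHom.commutes, ← Algebra.commutes, ← Algebra.smul_def,
      mul_neg]
    abel

/-- A product of contractions is annihilated from the right by each of its factors, since
contractions anticommute and square to zero. -/
theorem prod_contractLeft_mul {ι : Type*} (d : ι → Module.Dual R M) {l : List ι} {k : ι}
    (hk : k ∈ l) :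
    (l.map fun j => (contractLeft (d j) : Module.End R (CliffordAlgebra Q))).prod *
      contractLeft (d k) = 0 := by
  have hcomm (j : ι) : (contractLeft (d j) : Module.End R (CliffordAlgebra Q)) *
      contractLeft (d k) = (-1 : R) • (contractLeft (d k) * contractLeft (d j)) :=
    LinearMap.ext fun a => (contractLeft_comm (d j) (d k) a).trans (neg_one_smul R _).symm
  have key : ∀ l : List ι, ∃ c : R,
      (l.map fun j => (contractLeft (d j) : Module.End R (CliffordAlgebra Q))).prod *
        contractLeft (d k) = c • ((contractLeft (d k) : Module.End R (CliffordAlgebra Q)) *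
          (l.map fun j => (contractLeft (d j) : Module.End R (CliffordAlgebra Q))).prod) := by
    intro l
    induction l with
    | nil => exact ⟨1, by rw [List.map_nil, List.prod_nil, one_mul, mul_one, one_smul]⟩
    | cons a t ih =>
      obtain ⟨c, hc⟩ := ih
      refine ⟨-c, ?_⟩
      rw [List.map_cons, List.prod_cons, mul_assoc, hc, mul_smul_comm, ← mul_assoc, hcomm,
        smul_mul_assoc, smul_smul, mul_assoc, mul_neg_one]
  induction l with
  | nil => simp at hk
  | cons a t ih =>
    rw [List.map_cons, List.prod_cons, mul_assoc]
    rcases List.mem_cons.1 hk with rfl | h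
    · obtain ⟨c, hc⟩ := key t
      have h0 : (contractLeft (d k) : Module.End R (CliffordAlgebra Q)) *
          contractLeft (d k) = 0 := LinearMap.ext fun a => contractLeft_contractLeft (d k) a
      rw [hc, mul_smul_comm, ← mul_assoc, h0, zero_mul, smul_zero]
    · rw [ih h, mul_zero]

theorem ExteriorAlgebra.even_mul_comm {a : ExteriorAlgebra R M}
    (ha : a ∈ CliffordAlgebra.even (0 : QuadraticForm R M)) (b : ExteriorAlgebra R M) :
    a * b = b * a := by
  have key (m : M) : ∀ a ∈ CliffordAlgebra.even (0 : QuadraticForm R M),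
      a * CliffordAlgebra.ι 0 m = CliffordAlgebra.ι 0 m * a := by
    intro a ha
    induction a, ha using even_induction with
    | algebraMap r => exact Algebra.commutes r _
    | add x y hx hy h1 h2 => rw [add_mul, mul_add, h1, h2]
    | ι_mul_ι_mul m₁ m₂ x hx h =>
      have h1 (v w : M) : CliffordAlgebra.ι (0 : QuadraticForm R M) v * CliffordAlgebra.ι 0 w =
          -(CliffordAlgebra.ι 0 w * CliffordAlgebra.ι 0 v) :=
        eq_neg_of_add_eq_zero_left (ExteriorAlgebra.ι_add_mul_swap (R := R) v w)
      rw [mul_assoc, h, ← mul_assoc, mul_assoc (CliffordAlgebra.ι _ m₁), h1 m₂ m, mul_neg,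
        ← mul_assoc, h1 m₁ m]
      simp only [neg_mul, neg_neg, mul_assoc]
  induction b using CliffordAlgebra.induction with
  | algebraMap r => exact (Algebra.commutes r a).symm
  | ι m => exact key m a ha
  | mul x y hx hy => rw [← mul_assoc, hx, mul_assoc, hy, mul_assoc]
  | add x y hx hy => rw [mul_add, add_mul, hx, hy]

end Contraction

/-! ### Fermionic derivatives and the Berezin integral on the Grassmann algebra -/

section Grassmann

variable {n : ℕ}

/-- The left fermionic derivative is an antiderivation. -/
theorem grL_mul (j : Fin (2 * n)) (a b : Gr n) :
    grL j (a * b) = grL j a * b + CliffordAlgebra.involute a * grL j b :=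
  contractLeft_mul _ a b

theorem grL_involute (j : Fin (2 * n)) (a : Gr n) :
    grL j (CliffordAlgebra.involute a) = -CliffordAlgebra.involute (grL j a) :=
  contractLeft_involute _ a

/-- Left and right fermionic derivatives differ by the grade involution. -/
theorem grR_eq (j : Fin (2 * n)) (a : Gr n) :
    grR j a = CliffordAlgebra.involute (grL j a) :=
  contractRight_eq_involute _ a

theorem involute_of_even {a : Gr n} (ha : a ∈ GrEv n) : CliffordAlgebra.involute a = a :=
  CliffordAlgebra.involute_eq_of_mem_even ha

theorem grL_mul_of_even (j : Fin (2 * n)) {a : Gr n} (ha : a ∈ GrEv n) (b : Gr n) :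
    grL j (a * b) = grL j a * b + a * grL j b := by
  rw [grL_mul, involute_of_even ha]

theorem grR_mul_of_even (j : Fin (2 * n)) (b : Gr n) {a : Gr n} (ha : a ∈ GrEv n) :
    grR j (b * a) = grR j b * a + b * grR j a := by
  rw [grR_eq, grL_mul, map_add, map_mul, map_mul, involute_of_even ha,
    CliffordAlgebra.involute_involute, grR_eq, grR_eq]

theorem grR_of_even (j : Fin (2 * n)) {a : Gr n} (ha : a ∈ GrEv n) :
    grR j a = -grL j a := by
  have h := grL_involute j a
  rw [involute_of_even ha] at h
  rw [grR_eq]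
  exact (neg_eq_iff_eq_neg.2 h).symm

/-- Even elements of the Grassmann algebra are central. -/
theorem even_mul_comm {a : Gr n} (ha : a ∈ GrEv n) (b : Gr n) : a * b = b * a :=
  ExteriorAlgebra.even_mul_comm ha b

theorem grBerezin_grL (k : Fin (2 * n)) (a : Gr n) : grBerezin n (grL k a) = 0 := by
  have h : ((List.ofFn fun j : Fin (2 * n) => (grL j : Module.End ℝ (Gr n))).reverse.prod :
      Module.End ℝ (Gr n)) * grL k = 0 := by
    rw [List.ofFn_eq_map, ← List.map_reverse]
    have hk : k ∈ (List.finRange (2 * n)).reverse :=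
      List.mem_reverse.2 (List.mem_finRange k)
    exact prod_contractLeft_mul (Q := (0 : QuadraticForm ℝ (Fin (2 * n) → ℝ)))
      (fun j : Fin (2 * n) => LinearMap.proj j) hk
  have h2 : (List.ofFn fun j : Fin (2 * n) => (grL j : Module.End ℝ (Gr n))).reverse.prod
      (grL k a) = 0 := LinearMap.congr_fun h a
  rw [grBerezin, LinearMap.smul_apply, LinearMap.comp_apply, h2, map_zero, smul_zero]

/-- Integration by parts for the Berezin integral. -/
theorem grBerezin_grR_mul (k : Fin (2 * n)) (a b : Gr n) :
    grBerezin n (grR k a * b) = grBerezin n (a * grL k b) := by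
  have h1 : grL k (CliffordAlgebra.involute a * b) = a * grL k b - grR k a * b := by
    rw [grL_mul, CliffordAlgebra.involute_involute, grL_involute, ← grR_eq, neg_mul]
    abel
  have h := grBerezin_grL k (CliffordAlgebra.involute a * b)
  rw [h1, map_sub] at h
  linarith

/-! ### Nilpotency -/

/-- Products of `2 n + 1` vectors vanish, because the `2 n + 1` factors are linearly dependent. -/
theorem range_ι_pow_eq_bot :
    LinearMap.range (ExteriorAlgebra.ι ℝ : (Fin (2 * n) → ℝ) →ₗ[ℝ] Gr n) ^ (2 * n + 1) = ⊥ := by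
  have h := ExteriorAlgebra.ιMulti_span_fixedDegree (R := ℝ) (M := Fin (2 * n) → ℝ) (2 * n + 1)
  refine h.symm.trans (Submodule.span_eq_bot.2 ?_)
  rintro _ ⟨v, rfl⟩
  refine AlternatingMap.map_linearDependent _ _ fun hv => ?_
  have := hv.fintype_card_le_finrank
  simp at this

/-- The products of `2 k` vectors with an even element. -/
def evenDeg (n k : ℕ) : Set (Gr n) :=
  {a | ∃ y ∈ LinearMap.range (ExteriorAlgebra.ι ℝ : (Fin (2 * n) → ℝ) →ₗ[ℝ] Gr n) ^ (2 * k),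
    ∃ x ∈ GrEv n, a = y * x}

theorem evenDeg_mul {k l : ℕ} {a b : Gr n} (ha : a ∈ evenDeg n k) (hb : b ∈ evenDeg n l) :
    a * b ∈ evenDeg n (k + l) := by
  obtain ⟨y, hy, x, hx, rfl⟩ := ha
  obtain ⟨y', hy', x', hx', rfl⟩ := hb
  refine ⟨y * y', ?_, x * x', mul_mem hx hx', ?_⟩
  · rw [mul_add, pow_add]
    exact Submodule.mul_mem_mul hy hy'
  · rw [mul_assoc, ← mul_assoc x, even_mul_comm hx, mul_assoc, mul_assoc]

theorem evenDeg_eq_zero {a : Gr n} (ha : a ∈ evenDeg n (n + 1)) : a = 0 := by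
  obtain ⟨y, hy, x, hx, rfl⟩ := ha
  rw [show 2 * (n + 1) = 2 * n + 1 + 1 by ring, pow_succ, range_ι_pow_eq_bot,
    Submodule.bot_mul, Submodule.mem_bot] at hy
  rw [hy, zero_mul]

/-- An even element of the Grassmann algebra minus its scalar part has degree at least `2`. -/
theorem sub_algebraMapInv_mem {a : Gr n} (ha : a ∈ GrEv n) :
    a - algebraMap ℝ _ (ExteriorAlgebra.algebraMapInv a) ∈ Submodule.span ℝ (evenDeg n 1) := by
  induction a, ha using CliffordAlgebra.even_induction with
  | algebraMap r =>
    rw [show ExteriorAlgebra.algebraMapInv (algebraMap ℝ (Gr n) r) = r from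
      ExteriorAlgebra.algebraMap_leftInverse _ r, sub_self]
    exact zero_mem _
  | add x y hx hy h1 h2 =>
    rw [map_add, map_add, add_sub_add_comm]
    exact add_mem h1 h2
  | ι_mul_ι_mul m₁ m₂ x hx h =>
    have h0 (m : Fin (2 * n) → ℝ) : ExteriorAlgebra.algebraMapInv
        (CliffordAlgebra.ι (0 : QuadraticForm ℝ (Fin (2 * n) → ℝ)) m) = (0 : ℝ) := by
      change ExteriorAlgebra.algebraMapInv (ExteriorAlgebra.ι ℝ m) = (0 : ℝ)
      simp [ExteriorAlgebra.algebraMapInv]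
    have h1 : ExteriorAlgebra.algebraMapInv (CliffordAlgebra.ι (0 : QuadraticForm ℝ _) m₁ *
        CliffordAlgebra.ι (0 : QuadraticForm ℝ _) m₂ * x) = (0 : ℝ) := by
      rw [map_mul, map_mul, h0, zero_mul, zero_mul]
    rw [h1, map_zero, sub_zero]
    refine Submodule.subset_span ⟨_, ?_, x, hx, rfl⟩
    rw [mul_one, pow_two]
    exact Submodule.mul_mem_mul ⟨m₁, rfl⟩ ⟨m₂, rfl⟩

end Grassmann

/-! ### Products and Dirac operators on `V ⊗ 𝔊 ⊗ 𝒞` -/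

section Bilinear

variable {B U V W X Y Z : Type*} [Ring B] [Algebra ℝ B]
  [AddCommMonoid U] [Module ℝ U] [AddCommMonoid V] [Module ℝ V] [AddCommMonoid W] [Module ℝ W]
  [AddCommMonoid X] [Module ℝ X] [AddCommMonoid Y] [Module ℝ Y] [AddCommMonoid Z] [Module ℝ Z]

/-- The product `U ⊗ B × V ⊗ B → W ⊗ B` extending a bilinear map `U × V → W`. -/
abbrev bmul (B : Type*) [Ring B] [Algebra ℝ B] (μ : U →ₗ[ℝ] V →ₗ[ℝ] W) :
    U ⊗[ℝ] B →ₗ[ℝ] V ⊗[ℝ] B →ₗ[ℝ] W ⊗[ℝ] B :=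
  TensorProduct.map₂ μ (LinearMap.mul ℝ B)

theorem bmul_assoc {μ₁ : W →ₗ[ℝ] X →ₗ[ℝ] Z} {μ₂ : U →ₗ[ℝ] V →ₗ[ℝ] W}
    {μ₃ : U →ₗ[ℝ] Y →ₗ[ℝ] Z} {μ₄ : V →ₗ[ℝ] X →ₗ[ℝ] Y}
    (h : ∀ u v x, μ₁ (μ₂ u v) x = μ₃ u (μ₄ v x)) (u : U ⊗[ℝ] B) (v : V ⊗[ℝ] B)
    (x : X ⊗[ℝ] B) : bmul B μ₁ (bmul B μ₂ u v) x = bmul B μ₃ u (bmul B μ₄ v x) := by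
  induction u using TensorProduct.induction_on with
  | zero => simp only [map_zero, LinearMap.zero_apply]
  | add u u' h1 h2 => simp only [map_add, LinearMap.add_apply, h1, h2]
  | tmul u a =>
    induction v using TensorProduct.induction_on with
    | zero => simp only [map_zero, LinearMap.zero_apply]
    | add v v' h1 h2 => simp only [map_add, LinearMap.add_apply, h1, h2]
    | tmul v b =>
      induction x using TensorProduct.induction_on with
      | zero => simp only [map_zero]
      | add x x' h1 h2 => simp only [map_add, h1, h2]
      | tmul x c => simp only [TensorProduct.map₂_apply_tmul, TensorProduct.map_tmul, h,
          LinearMap.mul_apply', mul_assoc]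

theorem map_bmul {μ : U →ₗ[ℝ] V →ₗ[ℝ] W} {μ' : X →ₗ[ℝ] Y →ₗ[ℝ] Z} {r : W →ₗ[ℝ] Z}
    {r₁ : U →ₗ[ℝ] X} {r₂ : V →ₗ[ℝ] Y} (h : ∀ u v, r (μ u v) = μ' (r₁ u) (r₂ v))
    (u : U ⊗[ℝ] B) (v : V ⊗[ℝ] B) :
    TensorProduct.map r LinearMap.id (bmul B μ u v) =
      bmul B μ' (TensorProduct.map r₁ LinearMap.id u) (TensorProduct.map r₂ LinearMap.id v) := by
  induction u using TensorProduct.induction_on with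
  | zero => simp only [map_zero, LinearMap.zero_apply]
  | add u u' h1 h2 => simp only [map_add, LinearMap.add_apply, h1, h2]
  | tmul u a =>
    induction v using TensorProduct.induction_on with
    | zero => simp only [map_zero]
    | add v v' h1 h2 => simp only [map_add, h1, h2]
    | tmul v b => simp only [TensorProduct.map₂_apply_tmul, TensorProduct.map_tmul, h,
        LinearMap.id_apply]

theorem mul_eq_bmul {S : Type*} [CommRing S] [Algebra ℝ S] (F G : S ⊗[ℝ] B) :
    F * G = bmul B (LinearMap.mul ℝ S) F G := by
  induction F using TensorProduct.induction_on with
  | zero => simp only [map_zero, LinearMap.zero_apply, zero_mul]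
  | add u u' h1 h2 => simp only [map_add, LinearMap.add_apply, h1, h2, add_mul]
  | tmul u a =>
    induction G using TensorProduct.induction_on with
    | zero => simp only [map_zero, mul_zero]
    | add v v' h1 h2 => simp only [map_add, h1, h2, mul_add]
    | tmul v b => rw [TensorProduct.map₂_apply_tmul, Algebra.TensorProduct.tmul_mul_tmul]; rfl

theorem one_bmul {S : Type*} [CommRing S] [Algebra ℝ S] {μ : S →ₗ[ℝ] V →ₗ[ℝ] V}
    (h : ∀ v, μ 1 v = v) (x : V ⊗[ℝ] B) : bmul B μ (1 ⊗ₜ 1) x = x := by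
  induction x using TensorProduct.induction_on with
  | zero => exact map_zero _
  | add u u' h1 h2 => rw [map_add, h1, h2]
  | tmul u a => rw [TensorProduct.map₂_apply_tmul, TensorProduct.map_tmul, h, LinearMap.mul_apply', one_mul]

end Bilinear

section EvScalar

variable {m n : ℕ} {U V W : Type*} [AddCommMonoid U] [Module ℝ U] [AddCommMonoid V] [Module ℝ V]
  [AddCommMonoid W] [Module ℝ W]

variable (m n V) in
/-- The subspace `V ⊗ 𝔊^{(ev)}` of `V ⊗ 𝔊 ⊗ 𝒞`. -/
def evScalar : Submodule ℝ (V ⊗[ℝ] A m n) :=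
  Submodule.span ℝ {x | ∃ (v : V) (a : Gr n), a ∈ GrEv n ∧ x = v ⊗ₜ (a ⊗ₜ 1)}

theorem tmul_mem_evScalar (v : V) {a : Gr n} (ha : a ∈ GrEv n) :
    v ⊗ₜ[ℝ] (a ⊗ₜ[ℝ] (1 : Cl m n)) ∈ evScalar m n V :=
  Submodule.subset_span ⟨v, a, ha, rfl⟩

theorem tmul_one_mem_evScalar (v : V) : v ⊗ₜ[ℝ] (1 : A m n) ∈ evScalar m n V :=
  tmul_mem_evScalar v (one_mem _)

theorem bmul_mem_evScalar {μ : U →ₗ[ℝ] V →ₗ[ℝ] W} {x : U ⊗[ℝ] A m n} {y : V ⊗[ℝ] A m n}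
    (hx : x ∈ evScalar m n U) (hy : y ∈ evScalar m n V) :
    bmul (A m n) μ x y ∈ evScalar m n W := by
  induction hx using Submodule.span_induction with
  | zero => rw [map_zero]; exact zero_mem _
  | add x x' _ _ h h' => rw [map_add]; exact add_mem h h'
  | smul c x _ h => rw [map_smul]; exact Submodule.smul_mem _ c h
  | mem x hx =>
    obtain ⟨u, a, ha, rfl⟩ := hx
    induction hy using Submodule.span_induction with
    | zero => rw [map_zero]; exact zero_mem _
    | add x x' _ _ h h' => rw [map_add]; exact add_mem h h'
    | smul c x _ h => rw [map_smul]; exact Submodule.smul_mem _ c h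
    | mem y hy =>
      obtain ⟨v, b, hb, rfl⟩ := hy
      rw [TensorProduct.map₂_apply_tmul, TensorProduct.map_tmul, LinearMap.mul_apply',
        Algebra.TensorProduct.tmul_mul_tmul, one_mul]
      exact tmul_mem_evScalar _ (mul_mem ha hb)

theorem map_mem_evScalar (r : V →ₗ[ℝ] W) {x : V ⊗[ℝ] A m n} (hx : x ∈ evScalar m n V) :
    TensorProduct.map r LinearMap.id x ∈ evScalar m n W := by
  induction hx using Submodule.span_induction with
  | zero => rw [map_zero]; exact zero_mem _
  | add x x' _ _ h h' => rw [map_add]; exact add_mem h h'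
  | smul c x _ h => rw [map_smul]; exact Submodule.smul_mem _ c h
  | mem x hx =>
    obtain ⟨u, a, ha, rfl⟩ := hx
    exact tmul_mem_evScalar _ ha

/-- Two linear maps agreeing on `v ⊗ a ⊗ 1`, `a` even, agree on `V ⊗ 𝔊^{(ev)}`. -/
theorem eqOn_evScalar {P : Type*} [AddCommMonoid P] [Module ℝ P] {f g : V ⊗[ℝ] A m n →ₗ[ℝ] P}
    (h : ∀ (v : V) (a : Gr n), a ∈ GrEv n → f (v ⊗ₜ (a ⊗ₜ 1)) = g (v ⊗ₜ (a ⊗ₜ 1)))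
    {x : V ⊗[ℝ] A m n} (hx : x ∈ evScalar m n V) : f x = g x := by
  refine LinearMap.eqOn_span (f := f) (g := g) ?_ hx
  rintro _ ⟨v, a, ha, rfl⟩
  exact h v a ha

/-- Two linear maps agreeing on elementary tensors `v ⊗ a ⊗ c` are equal. -/
theorem ext_superTensor {P : Type*} [AddCommMonoid P] [Module ℝ P] {f g : V ⊗[ℝ] A m n →ₗ[ℝ] P}
    (h : ∀ (v : V) (a : Gr n) (c : Cl m n), f (v ⊗ₜ (a ⊗ₜ c)) = g (v ⊗ₜ (a ⊗ₜ c)))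
    (x : V ⊗[ℝ] A m n) : f x = g x := by
  refine LinearMap.congr_fun (TensorProduct.ext (LinearMap.ext fun v => ?_)) x
  exact TensorProduct.ext (LinearMap.ext fun a => LinearMap.ext fun c => h v a c)

/-- Elements of `V ⊗ 𝔊^{(ev)}` commute with everything. -/
theorem bmul_comm_of_evScalar (μ : U →ₗ[ℝ] V →ₗ[ℝ] W) (F : U ⊗[ℝ] A m n) {γ : V ⊗[ℝ] A m n}
    (hγ : γ ∈ evScalar m n V) :
    bmul (A m n) μ F γ = bmul (A m n) μ.flip γ F := by
  refine eqOn_evScalar (f := bmul (A m n) μ F) (g := (bmul (A m n) μ.flip).flip F)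
    (fun v a ha => ?_) hγ
  refine ext_superTensor (f := (bmul (A m n) μ).flip (v ⊗ₜ (a ⊗ₜ 1)))
    (g := bmul (A m n) μ.flip (v ⊗ₜ (a ⊗ₜ 1)))
    (fun u b c => ?_) F
  simp only [LinearMap.flip_apply, TensorProduct.map₂_apply_tmul, TensorProduct.map_tmul,
    LinearMap.mul_apply',
    Algebra.TensorProduct.tmul_mul_tmul, mul_one, one_mul, even_mul_comm ha b]

end EvScalar

section DiracCalculus

variable {m n : ℕ} {U V W : Type*} [AddCommGroup U] [Module ℝ U] [AddCommGroup V] [Module ℝ V]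
  [AddCommGroup W] [Module ℝ W]

theorem fermR_bmul (μ : U →ₗ[ℝ] V →ₗ[ℝ] W) (b : Cl m n) (k : Fin (2 * n)) (F : U ⊗[ℝ] A m n)
    {γ : V ⊗[ℝ] A m n} (hγ : γ ∈ evScalar m n V) :
    fermR b k (bmul (A m n) μ F γ) =
      bmul (A m n) μ (fermR b k F) γ + bmul (A m n) μ F (fermR b k γ) := by
  refine eqOn_evScalar (f := fermR b k ∘ₗ bmul (A m n) μ F)
    (g := bmul (A m n) μ (fermR b k F) + bmul (A m n) μ F ∘ₗ fermR b k) (fun v a ha => ?_) hγ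
  refine ext_superTensor (f := fermR b k ∘ₗ (bmul (A m n) μ).flip _)
    (g := (bmul (A m n) μ).flip _ ∘ₗ fermR b k + (bmul (A m n) μ).flip (fermR b k _))
    (fun u a' c => ?_) F
  simp only [LinearMap.comp_apply, LinearMap.add_apply, LinearMap.flip_apply, fermR,
    TensorProduct.map₂_apply_tmul, LinearMap.mul_apply', TensorProduct.map_tmul,
    Algebra.TensorProduct.tmul_mul_tmul, mul_one, one_mul, LinearMap.id_apply,
    LinearMap.mulRight_apply, grR_mul_of_even k a' ha, TensorProduct.add_tmul,
    TensorProduct.tmul_add]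

theorem fermL_bmul (μ : V →ₗ[ℝ] U →ₗ[ℝ] W) (b : Cl m n) (k : Fin (2 * n))
    {γ : V ⊗[ℝ] A m n} (hγ : γ ∈ evScalar m n V) (F : U ⊗[ℝ] A m n) :
    fermL b k (bmul (A m n) μ γ F) =
      bmul (A m n) μ (fermL b k γ) F + bmul (A m n) μ γ (fermL b k F) := by
  refine eqOn_evScalar (f := fermL b k ∘ₗ (bmul (A m n) μ).flip F)
    (g := (bmul (A m n) μ).flip F ∘ₗ fermL b k + (bmul (A m n) μ).flip (fermL b k F))
    (fun v a ha => ?_) hγ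
  refine ext_superTensor (f := fermL b k ∘ₗ bmul (A m n) μ (v ⊗ₜ (a ⊗ₜ 1)))
    (g := bmul (A m n) μ (fermL b k (v ⊗ₜ (a ⊗ₜ 1))) +
      bmul (A m n) μ (v ⊗ₜ (a ⊗ₜ 1)) ∘ₗ fermL b k)
    (fun u a' c => ?_) F
  simp only [LinearMap.comp_apply, LinearMap.add_apply, fermL,
    TensorProduct.map₂_apply_tmul, LinearMap.mul_apply', TensorProduct.map_tmul,
    Algebra.TensorProduct.tmul_mul_tmul, mul_one, one_mul, LinearMap.id_apply,
    LinearMap.mulLeft_apply, grL_mul_of_even k ha, TensorProduct.add_tmul,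
    TensorProduct.tmul_add]

theorem bosR_bmul {μ : U →ₗ[ℝ] V →ₗ[ℝ] W} {dU : U →ₗ[ℝ] U} {dV : V →ₗ[ℝ] V} {dW : W →ₗ[ℝ] W}
    (h : ∀ u v, dW (μ u v) = μ (dU u) v + μ u (dV v)) (b : Cl m n)
    (F : U ⊗[ℝ] A m n) {γ : V ⊗[ℝ] A m n} (hγ : γ ∈ evScalar m n V) :
    TensorProduct.map dW (TensorProduct.map LinearMap.id (LinearMap.mulRight ℝ b))
        (bmul (A m n) μ F γ) =
      bmul (A m n) μ
        (TensorProduct.map dU (TensorProduct.map LinearMap.id (LinearMap.mulRight ℝ b)) F) γ +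
      bmul (A m n) μ F
        (TensorProduct.map dV (TensorProduct.map LinearMap.id (LinearMap.mulRight ℝ b)) γ) := by
  refine eqOn_evScalar (f := TensorProduct.map dW
      (TensorProduct.map LinearMap.id (LinearMap.mulRight ℝ b)) ∘ₗ bmul (A m n) μ F)
    (g := bmul (A m n) μ _ + bmul (A m n) μ F ∘ₗ TensorProduct.map dV
      (TensorProduct.map LinearMap.id (LinearMap.mulRight ℝ b))) (fun v a ha => ?_) hγ
  refine ext_superTensor (f := TensorProduct.map dW
      (TensorProduct.map LinearMap.id (LinearMap.mulRight ℝ b)) ∘ₗ (bmul (A m n) μ).flip _)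
    (g := (bmul (A m n) μ).flip _ ∘ₗ TensorProduct.map dU
      (TensorProduct.map LinearMap.id (LinearMap.mulRight ℝ b)) + (bmul (A m n) μ).flip
        (TensorProduct.map dV (TensorProduct.map LinearMap.id (LinearMap.mulRight ℝ b)) _))
    (fun u a' c => ?_) F
  simp only [LinearMap.comp_apply, LinearMap.add_apply, LinearMap.flip_apply,
    TensorProduct.map₂_apply_tmul, LinearMap.mul_apply', TensorProduct.map_tmul,
    Algebra.TensorProduct.tmul_mul_tmul, mul_one, one_mul, LinearMap.id_apply,
    LinearMap.mulRight_apply, h, TensorProduct.add_tmul]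

theorem bosL_bmul {μ : V →ₗ[ℝ] U →ₗ[ℝ] W} {dU : U →ₗ[ℝ] U} {dV : V →ₗ[ℝ] V} {dW : W →ₗ[ℝ] W}
    (h : ∀ v u, dW (μ v u) = μ (dV v) u + μ v (dU u)) (b : Cl m n)
    {γ : V ⊗[ℝ] A m n} (hγ : γ ∈ evScalar m n V) (F : U ⊗[ℝ] A m n) :
    TensorProduct.map dW (TensorProduct.map LinearMap.id (LinearMap.mulLeft ℝ b))
        (bmul (A m n) μ γ F) =
      bmul (A m n) μ
        (TensorProduct.map dV (TensorProduct.map LinearMap.id (LinearMap.mulLeft ℝ b)) γ) F +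
      bmul (A m n) μ γ
        (TensorProduct.map dU (TensorProduct.map LinearMap.id (LinearMap.mulLeft ℝ b)) F) := by
  refine eqOn_evScalar (f := TensorProduct.map dW
      (TensorProduct.map LinearMap.id (LinearMap.mulLeft ℝ b)) ∘ₗ (bmul (A m n) μ).flip F)
    (g := (bmul (A m n) μ).flip F ∘ₗ TensorProduct.map dV
      (TensorProduct.map LinearMap.id (LinearMap.mulLeft ℝ b)) + (bmul (A m n) μ).flip _)
    (fun v a ha => ?_) hγ
  refine ext_superTensor (f := TensorProduct.map dW
      (TensorProduct.map LinearMap.id (LinearMap.mulLeft ℝ b)) ∘ₗ bmul (A m n) μ (v ⊗ₜ (a ⊗ₜ 1)))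
    (g := bmul (A m n) μ (TensorProduct.map dV
      (TensorProduct.map LinearMap.id (LinearMap.mulLeft ℝ b)) (v ⊗ₜ (a ⊗ₜ 1))) +
      bmul (A m n) μ (v ⊗ₜ (a ⊗ₜ 1)) ∘ₗ
        TensorProduct.map dU (TensorProduct.map LinearMap.id (LinearMap.mulLeft ℝ b)))
    (fun u a' c => ?_) F
  simp only [LinearMap.comp_apply, LinearMap.add_apply,
    TensorProduct.map₂_apply_tmul, LinearMap.mul_apply', TensorProduct.map_tmul,
    Algebra.TensorProduct.tmul_mul_tmul, mul_one, one_mul, LinearMap.id_apply,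
    LinearMap.mulLeft_apply, h, TensorProduct.add_tmul]

/-- The right Dirac operator satisfies the Leibniz rule if the right factor is an even scalar. -/
theorem diracR_bmul {μ : U →ₗ[ℝ] V →ₗ[ℝ] W} {dU : Fin m → U →ₗ[ℝ] U} {dV : Fin m → V →ₗ[ℝ] V}
    {dW : Fin m → W →ₗ[ℝ] W} (h : ∀ j u v, dW j (μ u v) = μ (dU j u) v + μ u (dV j v))
    (F : U ⊗[ℝ] A m n) {γ : V ⊗[ℝ] A m n} (hγ : γ ∈ evScalar m n V) :
    diracR dW (bmul (A m n) μ F γ) =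
      bmul (A m n) μ (diracR dU F) γ + bmul (A m n) μ F (diracR dV γ) := by
  simp only [diracR, LinearMap.sub_apply, LinearMap.neg_apply, LinearMap.smul_apply,
    LinearMap.sum_apply, fermR_bmul μ _ _ F hγ, bosR_bmul (h _) _ F hγ, map_sub, map_neg,
    map_smul, map_sum, Finset.sum_add_distrib, Finset.sum_sub_distrib, smul_add, smul_sub]
  abel

/-- The left Dirac operator satisfies the Leibniz rule if the left factor is an even scalar. -/
theorem diracL_bmul {μ : V →ₗ[ℝ] U →ₗ[ℝ] W} {dU : Fin m → U →ₗ[ℝ] U} {dV : Fin m → V →ₗ[ℝ] V}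
    {dW : Fin m → W →ₗ[ℝ] W} (h : ∀ j v u, dW j (μ v u) = μ (dV j v) u + μ v (dU j u))
    {γ : V ⊗[ℝ] A m n} (hγ : γ ∈ evScalar m n V) (F : U ⊗[ℝ] A m n) :
    diracL dW (bmul (A m n) μ γ F) =
      bmul (A m n) μ (diracL dV γ) F + bmul (A m n) μ γ (diracL dU F) := by
  simp only [diracL, LinearMap.sub_apply, LinearMap.smul_apply,
    LinearMap.sum_apply, fermL_bmul μ _ _ hγ F, bosL_bmul (h _) _ hγ F, map_sub,
    map_smul, map_sum, Finset.sum_add_distrib, Finset.sum_sub_distrib, smul_add, smul_sub]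
  abel

/-- On even scalars the left and right Dirac operators coincide. -/
theorem diracR_eq_diracL_of_evScalar (d : Fin m → V →ₗ[ℝ] V) {γ : V ⊗[ℝ] A m n}
    (hγ : γ ∈ evScalar m n V) : diracR d γ = diracL d γ := by
  have h1 (b : Cl m n) (k : Fin (2 * n)) : fermR b k γ = -fermL b k γ := by
    refine eqOn_evScalar (f := fermR b k) (g := -fermL b k) (fun v a ha => ?_) hγ
    simp only [fermR, fermL, LinearMap.neg_apply, TensorProduct.map_tmul, LinearMap.id_apply,
      LinearMap.mulRight_apply, LinearMap.mulLeft_apply, mul_one, one_mul, grR_of_even k ha,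
      TensorProduct.neg_tmul, TensorProduct.tmul_neg]
  have h2 (b : Cl m n) (d : V →ₗ[ℝ] V) :
      TensorProduct.map d (TensorProduct.map LinearMap.id (LinearMap.mulRight ℝ b)) γ =
      TensorProduct.map d (TensorProduct.map LinearMap.id (LinearMap.mulLeft ℝ b)) γ := by
    refine eqOn_evScalar (fun v a ha => ?_) hγ
    simp only [TensorProduct.map_tmul, LinearMap.id_apply,
      LinearMap.mulRight_apply, LinearMap.mulLeft_apply, mul_one, one_mul]
  simp only [diracR, diracL, LinearMap.sub_apply, LinearMap.neg_apply, LinearMap.smul_apply,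
    LinearMap.sum_apply, h1, h2, Finset.sum_sub_distrib, Finset.sum_neg_distrib, smul_sub,
    smul_neg]
  abel

theorem map_diracR {r : V →ₗ[ℝ] W} {dV : Fin m → V →ₗ[ℝ] V} {dW : Fin m → W →ₗ[ℝ] W}
    (h : ∀ j v, r (dV j v) = dW j (r v)) (x : V ⊗[ℝ] A m n) :
    TensorProduct.map r LinearMap.id (diracR dV x) =
      diracR dW (TensorProduct.map r LinearMap.id x) := by
  refine ext_superTensor (f := TensorProduct.map r LinearMap.id ∘ₗ diracR dV)
    (g := diracR dW ∘ₗ TensorProduct.map r LinearMap.id) (fun v a c => ?_) x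
  simp only [LinearMap.comp_apply, diracR, fermR, LinearMap.sub_apply, LinearMap.neg_apply,
    LinearMap.smul_apply, LinearMap.sum_apply, map_sub, map_neg, map_smul, map_sum,
    TensorProduct.map_tmul, LinearMap.id_apply, h]

theorem berezin_tmul (a : Gr n) (c : Cl m n) : berezin m n (a ⊗ₜ c) = grBerezin n a • c := rfl

theorem berezin_fermR_bmul (μ : U →ₗ[ℝ] V →ₗ[ℝ] W) (b : Cl m n) (k : Fin (2 * n))
    (F : U ⊗[ℝ] A m n) (G : V ⊗[ℝ] A m n) :
    TensorProduct.map LinearMap.id (berezin m n) (bmul (A m n) μ (fermR b k F) G) =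
      TensorProduct.map LinearMap.id (berezin m n) (bmul (A m n) μ F (fermL b k G)) := by
  refine ext_superTensor
    (f := TensorProduct.map LinearMap.id (berezin m n) ∘ₗ bmul (A m n) μ (fermR b k F))
    (g := TensorProduct.map LinearMap.id (berezin m n) ∘ₗ bmul (A m n) μ F ∘ₗ fermL b k)
    (fun v a c => ?_) G
  refine ext_superTensor
    (f := TensorProduct.map LinearMap.id (berezin m n) ∘ₗ (bmul (A m n) μ).flip _ ∘ₗ fermR b k)
    (g := TensorProduct.map LinearMap.id (berezin m n) ∘ₗ
      (bmul (A m n) μ).flip (fermL b k (v ⊗ₜ (a ⊗ₜ c)))) (fun u a' c' => ?_) F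
  simp only [LinearMap.comp_apply, LinearMap.flip_apply, fermR, fermL,
    TensorProduct.map₂_apply_tmul, LinearMap.mul_apply', TensorProduct.map_tmul,
    Algebra.TensorProduct.tmul_mul_tmul, LinearMap.id_apply, LinearMap.mulRight_apply,
    LinearMap.mulLeft_apply, berezin_tmul, grBerezin_grR_mul, mul_assoc]

theorem bosR_bmul_add_bosL {μ : U →ₗ[ℝ] V →ₗ[ℝ] W} {dU : U →ₗ[ℝ] U} {dV : V →ₗ[ℝ] V}
    {dW : W →ₗ[ℝ] W} (h : ∀ u v, dW (μ u v) = μ (dU u) v + μ u (dV v)) (b : Cl m n)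
    (F : U ⊗[ℝ] A m n) (G : V ⊗[ℝ] A m n) :
    bmul (A m n) μ
        (TensorProduct.map dU (TensorProduct.map LinearMap.id (LinearMap.mulRight ℝ b)) F) G +
      bmul (A m n) μ F
        (TensorProduct.map dV (TensorProduct.map LinearMap.id (LinearMap.mulLeft ℝ b)) G) =
      TensorProduct.map dW LinearMap.id (bmul (A m n) μ
        (TensorProduct.map LinearMap.id
          (TensorProduct.map LinearMap.id (LinearMap.mulRight ℝ b)) F) G) := by
  refine ext_superTensor
    (f := bmul (A m n) μ _ + bmul (A m n) μ F ∘ₗ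
      (TensorProduct.map dV (TensorProduct.map LinearMap.id (LinearMap.mulLeft ℝ b))))
    (g := TensorProduct.map dW LinearMap.id ∘ₗ bmul (A m n) μ _) (fun v a c => ?_) G
  refine ext_superTensor
    (f := (bmul (A m n) μ).flip (v ⊗ₜ (a ⊗ₜ c)) ∘ₗ
      (TensorProduct.map dU (TensorProduct.map LinearMap.id (LinearMap.mulRight ℝ b))) +
      (bmul (A m n) μ).flip
        (TensorProduct.map dV (TensorProduct.map LinearMap.id (LinearMap.mulLeft ℝ b)) _))
    (g := TensorProduct.map dW LinearMap.id ∘ₗ (bmul (A m n) μ).flip _ ∘ₗ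
      (TensorProduct.map LinearMap.id
          (TensorProduct.map LinearMap.id (LinearMap.mulRight ℝ b)))) (fun u a' c' => ?_) F
  simp only [LinearMap.comp_apply, LinearMap.flip_apply, LinearMap.add_apply,
    TensorProduct.map₂_apply_tmul, LinearMap.mul_apply', TensorProduct.map_tmul,
    Algebra.TensorProduct.tmul_mul_tmul, LinearMap.id_apply, LinearMap.mulRight_apply,
    LinearMap.mulLeft_apply, h, TensorProduct.add_tmul, mul_assoc]

/-- Integration by parts: after Berezin integration, `(F ∂_x) G + F (∂_x G)` is a sum of bosonic
derivatives, because the Berezin integral of a fermionic derivative vanishes. -/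
theorem berezin_diracR_bmul_add {μ : U →ₗ[ℝ] V →ₗ[ℝ] W} {dU : Fin m → U →ₗ[ℝ] U}
    {dV : Fin m → V →ₗ[ℝ] V} {dW : Fin m → W →ₗ[ℝ] W}
    (h : ∀ j u v, dW j (μ u v) = μ (dU j u) v + μ u (dV j v))
    (F : U ⊗[ℝ] A m n) (G : V ⊗[ℝ] A m n) :
    TensorProduct.map LinearMap.id (berezin m n)
        (bmul (A m n) μ (diracR dU F) G + bmul (A m n) μ F (diracL dV G)) =
      -∑ j, TensorProduct.map LinearMap.id (berezin m n)
        (TensorProduct.map (dW j) LinearMap.id (bmul (A m n) μ (TensorProduct.map LinearMap.id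
          (TensorProduct.map LinearMap.id (LinearMap.mulRight ℝ (e j))) F) G)) := by
  simp only [← bosR_bmul_add_bosL (h _)]
  simp only [diracR, diracL, LinearMap.sub_apply, LinearMap.neg_apply, LinearMap.smul_apply,
    LinearMap.sum_apply, map_sub, map_neg, map_smul, map_sum, map_add,
    Finset.sum_add_distrib, berezin_fermR_bmul]
  abel

end DiracCalculus

/-! ### Calculus of smooth functions and scalar distributions -/

section Scalar

variable {m : ℕ} {Ω : Opens (E m)}

theorem Smooth.ext_of_ext0 {f g : Smooth Ω} (h : ∀ x ∈ Ω, ext0 f.1 x = ext0 g.1 x) : f = g := by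
  ext x
  have := h x x.2
  rwa [ext0_of_mem _ x.2, ext0_of_mem _ x.2] at this

theorem ext0_mul (f g : Smooth Ω) (x : E m) : ext0 (f * g).1 x = ext0 f.1 x * ext0 g.1 x := by
  by_cases hx : x ∈ Ω <;> simp [ext0, hx]

theorem ext0_add (f g : Smooth Ω) (x : E m) : ext0 (f + g).1 x = ext0 f.1 x + ext0 g.1 x := by
  by_cases hx : x ∈ Ω <;> simp [ext0, hx]

theorem ext0_neg (f : Smooth Ω) (x : E m) : ext0 (-f).1 x = -ext0 f.1 x := by
  by_cases hx : x ∈ Ω <;> simp [ext0, hx]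

theorem ext0_sub (f g : Smooth Ω) (x : E m) : ext0 (f - g).1 x = ext0 f.1 x - ext0 g.1 x := by
  by_cases hx : x ∈ Ω <;> simp [ext0, hx]

theorem ext0_one {x : E m} (hx : x ∈ Ω) : ext0 (1 : Smooth Ω).1 x = 1 := by
  simp [ext0, hx]

theorem ext0_pderiv (j : Fin m) (f : Smooth Ω) {x : E m} (hx : x ∈ Ω) :
    ext0 (pderiv j f).1 x = fderiv ℝ (ext0 f.1) x (EuclideanSpace.single j 1) :=
  ext0_of_mem _ hx

theorem ext0_restrict {Ω₁ : Opens (E m)} (h : Ω ≤ Ω₁) (f : Smooth Ω₁) {x : E m} (hx : x ∈ Ω) :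
    ext0 (Smooth.restrict h f).1 x = ext0 f.1 x := by
  rw [ext0_of_mem _ hx, ext0_of_mem _ (h hx)]
  rfl

theorem Smooth.contDiff (f : Smooth (⊤ : Opens (E m))) : ContDiff ℝ ∞ (ext0 f.1) :=
  contDiff_iff_contDiffAt.2 fun _ => Smooth.contDiffAt f trivial

/-- A smooth function on `ℝ^m`, as an element of `C^∞(Ω)`. -/
def Smooth.ofContDiff (Ω : Opens (E m)) (f : E m → ℝ) (hf : ContDiff ℝ ∞ f) : Smooth Ω :=
  ⟨fun x => f x, hf.contDiffOn.congr fun _ hx => ext0_of_mem _ hx⟩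

theorem ext0_ofContDiff {f : E m → ℝ} (hf : ContDiff ℝ ∞ f) {x : E m} (hx : x ∈ Ω) :
    ext0 (Smooth.ofContDiff Ω f hf).1 x = f x := ext0_of_mem _ hx

theorem pderiv_mul (j : Fin m) (f g : Smooth Ω) :
    pderiv j (f * g) = pderiv j f * g + f * pderiv j g := by
  refine Smooth.ext_of_ext0 fun x hx => ?_
  have h1 := (Smooth.contDiffAt f hx).differentiableAt (by simp)
  have h2 := (Smooth.contDiffAt g hx).differentiableAt (by simp)
  rw [ext0_add, ext0_mul, ext0_mul, ext0_pderiv _ _ hx, ext0_pderiv _ _ hx, ext0_pderiv _ _ hx,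
    show ext0 (f * g).1 = fun y => ext0 f.1 y * ext0 g.1 y from funext (ext0_mul f g),
    fderiv_fun_mul h1 h2]
  simp [mul_comm]
  ring

/-- The partial derivative `∂_{x_j}` of test functions. -/
def tderiv (j : Fin m) : 𝓓(Ω, ℝ) →L[ℝ] 𝓓(Ω, ℝ) :=
  TestFunction.lineDerivCLM ℝ (EuclideanSpace.single j 1)

theorem tderiv_apply (j : Fin m) (φ : 𝓓(Ω, ℝ)) (x : E m) :
    tderiv j φ x = fderiv ℝ φ x (EuclideanSpace.single j 1) := by
  rw [tderiv, TestFunction.lineDerivCLM_apply, if_pos (by simp),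
    (φ.contDiff.differentiable (by simp) x).lineDeriv_eq_fderiv]

theorem distDeriv_apply (j : Fin m) (T : 𝓓'(Ω, ℝ)) (φ : 𝓓(Ω, ℝ)) :
    distDeriv j T φ = -T (tderiv j φ) := rfl

theorem tderiv_testMul (j : Fin m) (f : Smooth Ω) (φ : 𝓓(Ω, ℝ)) :
    tderiv j (testMul f φ) = testMul (pderiv j f) φ + testMul f (tderiv j φ) := by
  ext x
  rw [tderiv_apply, add_apply, testMul_apply, testMul_apply, tderiv_apply]
  by_cases hx : x ∈ Ω
  · have h1 := (Smooth.contDiffAt f hx).differentiableAt (by simp)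
    have h2 := φ.contDiff.differentiable (by simp) x
    rw [ext0_pderiv _ _ hx, show (testMul f φ : E m → ℝ) = fun y => ext0 f.1 y * φ y from rfl,
      fderiv_fun_mul h1 h2]
    simp [mul_comm]
    ring
  · have h1 : x ∉ tsupport (testMul f φ) := fun h => hx ((testMul f φ).tsupport_subset h)
    have h2 : fderiv ℝ (testMul f φ) x = 0 := by
      rw [(notMem_tsupport_iff_eventuallyEq.1 h1).fderiv_eq]; simp
    rw [h2]
    simp [ext0, hx]

theorem smulDist_mul (f g : Smooth Ω) (T : 𝓓'(Ω, ℝ)) :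
    smulDist (f * g) T = smulDist f (smulDist g T) := by
  ext φ
  rw [smulDist_apply, smulDist_apply, smulDist_apply]
  congr 1
  ext x
  simp only [testMul_apply, ext0_mul]
  ring

theorem testMul_one (φ : 𝓓(Ω, ℝ)) : testMul 1 φ = φ := by
  ext x
  rw [testMul_apply]
  by_cases hx : x ∈ Ω
  · rw [ext0_one hx, one_mul]
  · rw [image_eq_zero_of_notMem_tsupport fun h => hx (φ.tsupport_subset h), mul_zero]

theorem smulDist_one (T : 𝓓'(Ω, ℝ)) : smulDist 1 T = T := by
  ext φ
  rw [smulDist_apply, testMul_one]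

theorem smulDist_comm (f g : Smooth Ω) (T : 𝓓'(Ω, ℝ)) :
    smulDist f (smulDist g T) = smulDist g (smulDist f T) := by
  rw [← smulDist_mul, mul_comm, smulDist_mul]

theorem distDeriv_smulDist (j : Fin m) (f : Smooth Ω) (T : 𝓓'(Ω, ℝ)) :
    distDeriv j (smulDist f T) = smulDist (pderiv j f) T + smulDist f (distDeriv j T) := by
  ext φ
  change -T (testMul f (tderiv j φ)) = T (testMul (pderiv j f) φ) + -T (tderiv j (testMul f φ))
  rw [tderiv_testMul, map_add]
  ring

/-! ### Restriction of distributions -/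

/-- Extension by zero of test functions. -/
def tmono {Ω₁ : Opens (E m)} (_ : Ω ≤ Ω₁) : 𝓓(Ω, ℝ) →L[ℝ] 𝓓(Ω₁, ℝ) := TestFunction.monoCLM ℝ

theorem tmono_apply {Ω₁ : Opens (E m)} (h : Ω ≤ Ω₁) (φ : 𝓓(Ω, ℝ)) (x : E m) :
    tmono h φ x = φ x := by
  rw [tmono, TestFunction.monoCLM_apply, if_pos ⟨le_rfl, h⟩]

theorem coe_tmono {Ω₁ : Opens (E m)} (h : Ω ≤ Ω₁) (φ : 𝓓(Ω, ℝ)) :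
    (tmono h φ : E m → ℝ) = φ := funext (tmono_apply h φ)

theorem distRestrict_apply {Ω₁ : Opens (E m)} (h : Ω ≤ Ω₁) (T : 𝓓'(Ω₁, ℝ)) (φ : 𝓓(Ω, ℝ)) :
    distRestrict h T φ = T (tmono h φ) := rfl

theorem distRestrict_distRestrict {Ω₁ Ω₂ : Opens (E m)} (h : Ω ≤ Ω₁) (h' : Ω₁ ≤ Ω₂)
    (T : 𝓓'(Ω₂, ℝ)) : distRestrict h (distRestrict h' T) = distRestrict (h.trans h') T := by
  ext φ
  simp only [distRestrict_apply]
  congr 1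
  ext x
  simp only [tmono_apply]

theorem distRestrict_smulDist {Ω₁ : Opens (E m)} (h : Ω ≤ Ω₁) (f : Smooth Ω₁) (T : 𝓓'(Ω₁, ℝ)) :
    distRestrict h (smulDist f T) = smulDist (Smooth.restrict h f) (distRestrict h T) := by
  ext φ
  simp only [distRestrict_apply, smulDist_apply]
  congr 1
  ext x
  simp only [tmono_apply, testMul_apply]
  by_cases hx : x ∈ Ω
  · rw [ext0_restrict h f hx]
  · rw [image_eq_zero_of_notMem_tsupport fun h => hx (φ.tsupport_subset h), mul_zero, mul_zero]

theorem distRestrict_distDeriv {Ω₁ : Opens (E m)} (h : Ω ≤ Ω₁) (j : Fin m) (T : 𝓓'(Ω₁, ℝ)) :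
    distRestrict h (distDeriv j T) = distDeriv j (distRestrict h T) := by
  ext φ
  simp only [distRestrict_apply, distDeriv_apply]
  congr 2
  ext x
  simp only [tmono_apply, tderiv_apply, coe_tmono]

theorem distRestrict_lebesgueDist {Ω₁ : Opens (E m)} (h : Ω ≤ Ω₁) :
    distRestrict h (lebesgueDist Ω₁) = lebesgueDist Ω := by
  ext φ
  simp only [distRestrict_apply, lebesgueDist_apply, tmono_apply]

theorem ofSmooth_eq (f : Smooth Ω) : ofSmooth f = smulDist f (lebesgueDist Ω) := rfl

theorem smulDist_ofSmooth (f g : Smooth Ω) : smulDist f (ofSmooth g) = ofSmooth (f * g) := by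
  rw [ofSmooth_eq, ofSmooth_eq, smulDist_mul]

theorem distRestrict_ofSmooth {Ω₁ : Opens (E m)} (h : Ω ≤ Ω₁) (f : Smooth Ω₁) :
    distRestrict h (ofSmooth f) = ofSmooth (Smooth.restrict h f) := by
  rw [ofSmooth_eq, ofSmooth_eq, distRestrict_smulDist, distRestrict_lebesgueDist]

theorem integral_tderiv (j : Fin m) (φ : 𝓓(Ω, ℝ)) : ∫ x, tderiv j φ x = 0 := by
  have h := integral_mul_fderiv_eq_neg_fderiv_mul_of_integrable (μ := (volume : Measure (E m)))
    (f := fun _ : E m => (1 : ℝ)) (g := φ) (v := EuclideanSpace.single j 1) (by simp)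
    (by simpa [← tderiv_apply] using
      (tderiv j φ).continuous.integrable_of_hasCompactSupport (tderiv j φ).hasCompactSupport)
    (by simpa using φ.continuous.integrable_of_hasCompactSupport φ.hasCompactSupport)
    (fun x _ => by fun_prop) (fun x _ => φ.contDiff.differentiable (by simp) x)
  simpa [← tderiv_apply] using h

theorem distDeriv_lebesgueDist (j : Fin m) : distDeriv j (lebesgueDist Ω) = 0 := by
  ext φ
  rw [distDeriv_apply, lebesgueDist_apply, integral_tderiv, neg_zero]
  rfl

theorem distDeriv_ofSmooth (j : Fin m) (f : Smooth Ω) :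
    distDeriv j (ofSmooth f) = ofSmooth (pderiv j f) := by
  rw [ofSmooth_eq, ofSmooth_eq, distDeriv_smulDist, distDeriv_lebesgueDist, map_zero, add_zero]

/-- A smooth function is determined by the distribution it defines. -/
theorem ofSmooth_injective : Function.Injective (ofSmooth (Ω := Ω)) := by
  rw [← LinearMap.ker_eq_bot, LinearMap.ker_eq_bot']
  intro f hf
  have hc : ContinuousOn (ext0 f.1) Ω := (f.2 : ContDiffOn ℝ ∞ (ext0 f.1) Ω).continuousOn
  have h := Ω.isOpen.ae_eq_zero_of_integral_contDiff_smul_eq_zero (μ := volume)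
    (hc.locallyIntegrableOn Ω.isOpen.measurableSet) (fun φ h1 h2 h3 => by
      have := congrArg (fun T : 𝓓'(Ω, ℝ) => T ⟨φ, h1, h2, h3⟩) hf
      have h4 := (ofSmooth_apply f ⟨φ, h1, h2, h3⟩).symm.trans this
      simpa [mul_comm] using h4)
  have h0 := Measure.eqOn_open_of_ae_eq (f := ext0 f.1) (g := fun _ => 0) (μ := volume)
    ((ae_restrict_iff' Ω.isOpen.measurableSet).2 h) Ω.isOpen hc continuousOn_const
  refine Smooth.ext_of_ext0 fun x hx => ?_
  rw [h0 hx]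
  exact (ext0_of_mem (0 : Smooth Ω).1 hx).symm

/-! ### Distributions are determined locally -/

/-- A linear functional on test functions kills `φ` if it vanishes near each point of the support
of `φ`. -/
theorem apply_eq_zero_of_locally {P : Type*} [AddCommGroup P] [Module ℝ P]
    (T : 𝓓(Ω, ℝ) →ₗ[ℝ] P) (φ : 𝓓(Ω, ℝ))
    (h : ∀ x ∈ tsupport φ, ∃ s, IsOpen s ∧ x ∈ s ∧ Distribution.IsVanishingOn T s) : T φ = 0 := by
  choose! s hs hxs hv using h
  obtain ⟨t, ht⟩ := φ.hasCompactSupport.elim_finite_subcover (fun x : tsupport φ => s x)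
    (fun x => hs x x.2) (fun x hx => Set.mem_iUnion.2 ⟨⟨x, hx⟩, hxs x hx⟩)
  obtain ⟨ρ, hρ⟩ := SmoothPartitionOfUnity.exists_isSubordinate
    (modelWithCornersSelf ℝ (E m)) (s := tsupport φ) (isClosed_tsupport φ)
    (fun i : t => s i.1) (fun i => hs i.1 i.1.2)
    (fun x hx => by
      obtain ⟨i, hi, hxi⟩ := Set.mem_iUnion₂.1 (ht hx)
      exact Set.mem_iUnion.2 ⟨⟨i, hi⟩, hxi⟩)
  have hρs (i : t) : ContDiff ℝ ∞ (ρ i) := (ρ i).contMDiff.contDiff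
  have hsum : φ = ∑ i : t, testMul (Smooth.ofContDiff Ω (ρ i) (hρs i)) φ := by
    ext x
    rw [sum_apply]
    by_cases hx : x ∈ tsupport φ
    · have hxΩ := φ.tsupport_subset hx
      simp only [testMul_apply, ext0_ofContDiff _ hxΩ]
      rw [← Finset.sum_mul, ← finsum_eq_sum_of_fintype, ρ.sum_eq_one hx, one_mul]
    · simp [image_eq_zero_of_notMem_tsupport hx]
  rw [hsum, map_sum]
  refine Finset.sum_eq_zero fun i _ => hv i.1 i.1.2 _ ?_
  refine subset_trans ?_ (hρ i)
  refine closure_mono fun x hx => ?_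
  rw [Function.mem_support, testMul_apply] at hx
  have hxΩ : x ∈ Ω := by
    by_contra h
    simp [ext0, h] at hx
  rw [ext0_ofContDiff _ hxΩ] at hx
  exact left_ne_zero_of_mul hx

theorem isVanishingOn_of_distRestrict_eq_zero {U : Opens (E m)} (hU : U ≤ Ω) {T : 𝓓'(Ω, ℝ)}
    (h : distRestrict hU T = 0) : Distribution.IsVanishingOn T (U : Set (E m)) := fun φ hφ => by
  have := congrArg (fun S : 𝓓'(U, ℝ) => S ⟨φ, φ.contDiff, φ.hasCompactSupport, hφ⟩) h
  refine Eq.trans ?_ this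
  change T φ = T (tmono hU ⟨φ, φ.contDiff, φ.hasCompactSupport, hφ⟩)
  congr 1
  ext x
  rw [tmono_apply]
  rfl

theorem distRestrict_eq_zero {U : Opens (E m)} (hU : U ≤ Ω) {T : 𝓓'(Ω, ℝ)}
    (h : Distribution.IsVanishingOn T (U : Set (E m))) : distRestrict hU T = 0 := by
  ext φ
  rw [distRestrict_apply]
  refine h _ ?_
  rw [coe_tmono]
  exact φ.tsupport_subset

theorem dist_eq_of_locally {T S : 𝓓'(Ω, ℝ)} (h : ∀ x ∈ Ω, ∃ (U : Opens (E m)) (hU : U ≤ Ω),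
    x ∈ U ∧ distRestrict hU T = distRestrict hU S) : T = S := by
  rw [← sub_eq_zero]
  ext φ
  refine apply_eq_zero_of_locally ((T - S : 𝓓'(Ω, ℝ)) : 𝓓(Ω, ℝ) →L[ℝ] ℝ).toLinearMap φ
    fun x hx => ?_
  obtain ⟨U, hU, hxU, hTS⟩ := h x (φ.tsupport_subset hx)
  refine ⟨U, U.isOpen, hxU, ?_⟩
  have : distRestrict hU (T - S) = 0 := by rw [map_sub, hTS, sub_self]
  exact isVanishingOn_of_distRestrict_eq_zero hU this

/-- A distribution which is locally a smooth function is a smooth function. -/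
theorem exists_ofSmooth_of_locally {T : 𝓓'(Ω, ℝ)} (h : ∀ x ∈ Ω, ∃ (U : Opens (E m)) (hU : U ≤ Ω)
    (f : Smooth U), x ∈ U ∧ distRestrict hU T = ofSmooth f) : ∃ f : Smooth Ω, ofSmooth f = T := by
  choose U hU f hxU hf using h
  have key (x : E m) (hx : x ∈ Ω) (y : E m) (hy : y ∈ U x hx) :
      ext0 (f y (hU x hx hy)).1 y = ext0 (f x hx).1 y := by
    have hy' := hU x hx hy
    have h1 : U x hx ⊓ U y hy' ≤ U x hx := inf_le_left
    have h2 : U x hx ⊓ U y hy' ≤ U y hy' := inf_le_right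
    have h3 : Smooth.restrict h1 (f x hx) = Smooth.restrict h2 (f y hy') := by
      apply ofSmooth_injective
      rw [← distRestrict_ofSmooth, ← distRestrict_ofSmooth, ← hf, ← hf,
        distRestrict_distRestrict, distRestrict_distRestrict]
    have hyU : y ∈ U x hx ⊓ U y hy' := ⟨hy, hxU y hy'⟩
    rw [← ext0_restrict h1 (f x hx) hyU, h3, ext0_restrict h2 _ hyU]
  let F : Ω → ℝ := fun x => ext0 (f x.1 x.2).1 x.1
  have hF (x : E m) (hx : x ∈ Ω) (y : E m) (hy : y ∈ U x hx) : ext0 F y = ext0 (f x hx).1 y := by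
    rw [ext0_of_mem _ (hU x hx hy)]
    exact key x hx y hy
  have hFs : ContDiffOn ℝ ∞ (ext0 F) Ω := fun x hx => by
    refine ContDiffAt.contDiffWithinAt ?_
    refine (Smooth.contDiffAt (f x hx) (hxU x hx)).congr_of_eventuallyEq ?_
    filter_upwards [(U x hx).isOpen.mem_nhds (hxU x hx)] with y hy using hF x hx y hy
  refine ⟨⟨F, hFs⟩, dist_eq_of_locally fun x hx => ⟨U x hx, hU x hx, hxU x hx, ?_⟩⟩
  rw [hf, distRestrict_ofSmooth]
  congr 1
  refine Smooth.ext_of_ext0 fun y hy => ?_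
  rw [ext0_restrict _ _ hy]
  exact hF x hx y hy

end Scalar

/-! ### Integrals over superlevel sets -/

section Superlevel

open Filter

variable {m : ℕ}

/-- The function `s ↦ ∫_{g₀ ≥ s} φ dV`. -/
def superlevel (g₀ : Smooth (⊤ : Opens (E m))) (φ : 𝓓((⊤ : Opens (E m)), ℝ)) (s : ℝ) : ℝ :=
  ∫ x in {x : E m | s ≤ ext0 g₀.1 x}, φ x

variable (g₀ : Smooth (⊤ : Opens (E m))) (φ : 𝓓((⊤ : Opens (E m)), ℝ))

theorem TestFunction_integrable : Integrable (φ : E m → ℝ) :=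
  φ.continuous.integrable_of_hasCompactSupport φ.hasCompactSupport

theorem measurableSet_superlevel (s : ℝ) : MeasurableSet {x : E m | s ≤ ext0 g₀.1 x} :=
  (isClosed_le continuous_const (Smooth.contDiff g₀).continuous).measurableSet

theorem superlevel_eq_indicator (s : ℝ) :
    superlevel g₀ φ s = ∫ x, Set.indicator {x : E m | s ≤ ext0 g₀.1 x} φ x :=
  (integral_indicator (measurableSet_superlevel g₀ s)).symm

theorem superlevel_add (ψ : 𝓓((⊤ : Opens (E m)), ℝ)) (s : ℝ) :
    superlevel g₀ (φ + ψ) s = superlevel g₀ φ s + superlevel g₀ ψ s :=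
  integral_add (TestFunction_integrable φ).integrableOn (TestFunction_integrable ψ).integrableOn

theorem superlevel_sum {ι : Type*} (t : Finset ι) (ψ : ι → 𝓓((⊤ : Opens (E m)), ℝ)) (s : ℝ) :
    superlevel g₀ (∑ i ∈ t, ψ i) s = ∑ i ∈ t, superlevel g₀ (ψ i) s := by
  simp only [superlevel, sum_apply]
  exact integral_finsetSum t fun i _ => (TestFunction_integrable (ψ i)).integrableOn

theorem heaviside₀_eq_superlevel : heaviside₀ g₀ φ = superlevel g₀ φ 0 := heaviside₀_apply g₀ φ

theorem norm_superlevel_le (s : ℝ) : ‖superlevel g₀ φ s‖ ≤ ∫ x, ‖φ x‖ := by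
  refine (norm_integral_le_integral_norm _).trans ?_
  exact setIntegral_le_integral (TestFunction_integrable φ).norm
    (Eventually.of_forall fun x => norm_nonneg _)

theorem integrable_superlevel_prod (a b : ℝ) :
    Integrable (Function.uncurry fun (s : ℝ) (x : E m) =>
      Set.indicator {x : E m | s ≤ ext0 g₀.1 x} φ x)
      ((volume.restrict (Set.uIoc a b)).prod volume) := by
  have : IsFiniteMeasure (volume.restrict (Set.uIoc a b)) := ⟨by simp [Set.uIoc]⟩
  have h1 : Integrable (fun p : ℝ × E m => φ p.2)
      ((volume.restrict (Set.uIoc a b)).prod volume) := (TestFunction_integrable φ).comp_snd _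
  have h2 : MeasurableSet {p : ℝ × E m | p.1 ≤ ext0 g₀.1 p.2} :=
    (isClosed_le continuous_fst ((Smooth.contDiff g₀).continuous.comp continuous_snd)).measurableSet
  exact h1.indicator h2

theorem intervalIntegrable_superlevel (a b : ℝ) :
    IntervalIntegrable (superlevel g₀ φ) volume a b := by
  rw [intervalIntegrable_iff]
  have := (integrable_superlevel_prod g₀ φ a b).integral_prod_left
  refine this.congr (Eventually.of_forall fun s => ?_)
  exact (superlevel_eq_indicator g₀ φ s).symm

/-- Integration by parts against a function of `g₀`. -/
theorem integral_comp_mul_tderiv {u v : ℝ → ℝ} (hu : ∀ t, HasDerivAt u (v t) t)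
    (hv : Continuous v) (j : Fin m) :
    ∫ x, u (ext0 g₀.1 x) * tderiv j φ x =
      -∫ x, v (ext0 g₀.1 x) * testMul (pderiv j g₀) φ x := by
  have hg : Differentiable ℝ (ext0 g₀.1) := (Smooth.contDiff g₀).differentiable (by simp)
  have huc : Continuous u := continuous_iff_continuousAt.2 fun t => (hu t).continuousAt
  have hd (x : E m) : fderiv ℝ (fun y => u (ext0 g₀.1 y)) x (EuclideanSpace.single j 1) * φ x =
      v (ext0 g₀.1 x) * testMul (pderiv j g₀) φ x := by
    have h1 : HasFDerivAt (fun y => u (ext0 g₀.1 y)) (v (ext0 g₀.1 x) • fderiv ℝ (ext0 g₀.1) x) x :=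
      (hu _).comp_hasFDerivAt x (hg x).hasFDerivAt
    rw [h1.fderiv, testMul_apply, ext0_pderiv j g₀ trivial]
    simp [mul_assoc]
  have h := integral_mul_fderiv_eq_neg_fderiv_mul_of_integrable (μ := (volume : Measure (E m)))
    (f := fun y => u (ext0 g₀.1 y)) (g := φ) (v := EuclideanSpace.single j 1) ?_ ?_ ?_
    (fun x _ => ((hu _).comp_hasFDerivAt x (hg x).hasFDerivAt).differentiableAt)
    (fun x _ => φ.contDiff.differentiable (by simp) x)
  · simpa only [hd, ← tderiv_apply] using h
  · simp only [hd]
    exact ((hv.comp (Smooth.contDiff g₀).continuous).mul (testMul _ φ).continuous).integrable_of_hasCompactSupport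
      (testMul _ φ).hasCompactSupport.mul_left
  · simp only [← tderiv_apply]
    exact ((huc.comp (Smooth.contDiff g₀).continuous).mul (tderiv j φ).continuous).integrable_of_hasCompactSupport
      (tderiv j φ).hasCompactSupport.mul_left
  · exact ((huc.comp (Smooth.contDiff g₀).continuous).mul φ.continuous).integrable_of_hasCompactSupport
      φ.hasCompactSupport.mul_left

/-- Continuous approximations of the Heaviside function with the value `1` at `0`. -/
def ramp (k : ℕ) (t : ℝ) : ℝ := max 0 (min 1 (1 + k * t))

theorem continuous_ramp (k : ℕ) : Continuous (ramp k) := by unfold ramp; fun_prop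

theorem norm_ramp_le (k : ℕ) (t : ℝ) : ‖ramp k t‖ ≤ 1 := by
  rw [ramp, Real.norm_of_nonneg (le_max_left _ _)]
  exact max_le zero_le_one (min_le_left _ _)

theorem tendsto_ramp (t : ℝ) :
    Tendsto (fun k => ramp k t) atTop (𝓝 (Set.indicator (Set.Ici 0) 1 t)) := by
  refine tendsto_const_nhds.congr' ?_
  by_cases ht : 0 ≤ t
  · refine Eventually.of_forall fun k => ?_
    have : (0 : ℝ) ≤ k * t := by positivity
    rw [Set.indicator_of_mem (show t ∈ Set.Ici 0 from ht)]
    change 1 = max 0 (min 1 (1 + k * t))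
    rw [min_eq_left (by linarith), max_eq_right zero_le_one]
  · push Not at ht
    obtain ⟨N, hN⟩ := exists_nat_gt (1 / (-t))
    filter_upwards [eventually_ge_atTop N] with k hk
    have h1 : 1 < N * (-t) := (div_lt_iff₀ (by linarith)).1 hN
    have h2 : (N : ℝ) * (-t) ≤ k * (-t) :=
      mul_le_mul_of_nonneg_right (by exact_mod_cast hk) (by linarith)
    rw [Set.indicator_of_notMem (by simpa using ht)]
    exact (max_eq_left ((min_le_right _ _).trans (by linarith))).symm

/-- The fundamental identity `d/ds ∫_{g₀ ≥ s} (∂_j g₀) φ dV = ∫_{g₀ ≥ s} ∂_j φ dV`, in integrated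
form. It needs no regularity of the level sets of `g₀`. -/
theorem integral_superlevel_tderiv (j : Fin m) (a b : ℝ) :
    ∫ s in a..b, superlevel g₀ (tderiv j φ) s =
      superlevel g₀ (testMul (pderiv j g₀) φ) b - superlevel g₀ (testMul (pderiv j g₀) φ) a := by
  set G := ext0 g₀.1 with hG
  set ψ := testMul (pderiv j g₀) φ with hψ
  have hGc : Continuous G := (Smooth.contDiff g₀).continuous
  have hlim (x : E m) (s : ℝ) (χ : E m → ℝ) :
      Set.indicator (Set.Ici (0 : ℝ)) 1 (G x - s) * χ x = Set.indicator {x | s ≤ G x} χ x := by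
    by_cases h : s ≤ G x
    · rw [Set.indicator_of_mem (by simpa using h),
        Set.indicator_of_mem (show x ∈ {x | s ≤ G x} from h)]
      simp
    · rw [Set.indicator_of_notMem (by simpa using h),
        Set.indicator_of_notMem (show x ∉ {x | s ≤ G x} from h), zero_mul]
  -- the antiderivative `∫_{t-b}^{t-a}` of the difference of two ramps
  let u (k : ℕ) (t : ℝ) : ℝ := ∫ s in a..b, ramp k (t - s)
  have hu (k : ℕ) (t : ℝ) : HasDerivAt (u k) (ramp k (t - a) - ramp k (t - b)) t := by
    have hi (c d : ℝ) : IntervalIntegrable (ramp k) volume c d :=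
      (continuous_ramp k).intervalIntegrable c d
    have h1 (c : ℝ) : HasDerivAt (fun t => ∫ s in (0 : ℝ)..(t - c), ramp k s) (ramp k (t - c)) t := by
      have := intervalIntegral.integral_hasDerivAt_right (hi 0 (t - c))
        ((continuous_ramp k).stronglyMeasurableAtFilter _ _) (continuous_ramp k).continuousAt
      simpa using this.comp_sub_const t c
    have h2 : u k = fun t => (∫ s in (0 : ℝ)..(t - a), ramp k s) -
        ∫ s in (0 : ℝ)..(t - b), ramp k s := by
      funext t
      simp only [u]
      rw [intervalIntegral.integral_comp_sub_left (ramp k) t,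
        intervalIntegral.integral_interval_sub_left (hi _ _) (hi _ _)]
    rw [h2]
    exact (h1 a).sub (h1 b)
  have hub (k : ℕ) (t : ℝ) : ‖u k t‖ ≤ |b - a| := by
    refine (intervalIntegral.norm_integral_le_of_norm_le_const (C := 1)
      fun s _ => norm_ramp_le k _).trans_eq (one_mul _)
  have huc (k : ℕ) : Continuous (u k) :=
    continuous_iff_continuousAt.2 fun t => (hu k t).continuousAt
  have hparts (k : ℕ) : ∫ x, u k (G x) * tderiv j φ x =
      -∫ x, (ramp k (G x - a) - ramp k (G x - b)) * ψ x :=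
    integral_comp_mul_tderiv g₀ φ (hu k)
      (((continuous_ramp k).comp (continuous_id.sub continuous_const)).sub
        ((continuous_ramp k).comp (continuous_id.sub continuous_const))) j
  have hL : Tendsto (fun k => ∫ x, u k (G x) * tderiv j φ x) atTop
      (𝓝 (∫ x, (∫ s in a..b, Set.indicator (Set.Ici (0 : ℝ)) 1 (G x - s)) * tderiv j φ x)) := by
    refine tendsto_integral_of_dominated_convergence (fun x => |b - a| * ‖tderiv j φ x‖)
      (fun k => ((huc k).comp hGc |>.mul (tderiv j φ).continuous).aestronglyMeasurable)
      ((TestFunction_integrable _).norm.const_mul _)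
      (fun k => Eventually.of_forall fun x => ?_) (Eventually.of_forall fun x => ?_)
    · rw [norm_mul]
      exact mul_le_mul_of_nonneg_right (hub k _) (norm_nonneg _)
    · refine Tendsto.mul_const _ ?_
      refine intervalIntegral.tendsto_integral_filter_of_dominated_convergence (fun _ => 1)
        (Eventually.of_forall fun k => ((continuous_ramp k).comp
          (continuous_const.sub continuous_id)).aestronglyMeasurable)
        (Eventually.of_forall fun k => Eventually.of_forall fun s _ => norm_ramp_le k _)
        (continuous_const.intervalIntegrable _ _)
        (Eventually.of_forall fun s _ => tendsto_ramp _)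
  have hR1 (c : ℝ) : Tendsto (fun k => ∫ x, ramp k (G x - c) * ψ x) atTop
      (𝓝 (superlevel g₀ ψ c)) := by
    rw [superlevel_eq_indicator]
    refine tendsto_integral_of_dominated_convergence (fun x => ‖ψ x‖)
      (fun k => (((continuous_ramp k).comp (hGc.sub continuous_const)).mul
        ψ.continuous).aestronglyMeasurable)
      (TestFunction_integrable _).norm
      (fun k => Eventually.of_forall fun x => ?_) (Eventually.of_forall fun x => ?_)
    · rw [norm_mul]
      exact mul_le_of_le_one_left (norm_nonneg _) (norm_ramp_le k _)
    · rw [← hG, ← hlim]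
      exact (tendsto_ramp _).mul_const _
  have hR : Tendsto (fun k => -∫ x, (ramp k (G x - a) - ramp k (G x - b)) * ψ x) atTop
      (𝓝 (superlevel g₀ ψ b - superlevel g₀ ψ a)) := by
    rw [← neg_sub]
    refine (((hR1 a).sub (hR1 b)).neg).congr fun k => ?_
    have hi (c : ℝ) : Integrable fun x => ramp k (G x - c) * ψ x :=
      (((continuous_ramp k).comp (hGc.sub continuous_const)).mul
        ψ.continuous).integrable_of_hasCompactSupport ψ.hasCompactSupport.mul_left
    rw [← integral_sub (hi a) (hi b)]
    simp only [sub_mul]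
  have hfin := tendsto_nhds_unique (hL.congr hparts) hR
  rw [← hfin]
  simp only [superlevel_eq_indicator]
  rw [intervalIntegral_integral_swap (integrable_superlevel_prod g₀ (tderiv j φ) a b)]
  congr 1
  ext x
  rw [← intervalIntegral.integral_mul_const]
  congr 1
  ext s
  exact (hlim x s _).symm

/-- For test functions of the form `(∂_j g₀) φ` the integral over `{g₀ ≥ s}` is Lipschitz in `s`,
even at critical values of `g₀`. -/
theorem superlevel_testMul_pderiv_lipschitz (j : Fin m) :
    ∃ C : ℝ, ∀ a b, ‖superlevel g₀ (testMul (pderiv j g₀) φ) b -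
      superlevel g₀ (testMul (pderiv j g₀) φ) a‖ ≤ C * |b - a| := by
  refine ⟨∫ x, ‖tderiv j φ x‖, fun a b => ?_⟩
  rw [← integral_superlevel_tderiv]
  exact intervalIntegral.norm_integral_le_of_norm_le_const fun s _ => norm_superlevel_le _ _ _

theorem continuous_superlevel_testMul_pderiv (j : Fin m) :
    Continuous (superlevel g₀ (testMul (pderiv j g₀) φ)) := by
  obtain ⟨C, hC⟩ := superlevel_testMul_pderiv_lipschitz g₀ φ j
  refine LipschitzWith.continuous (K := C.toNNReal) (LipschitzWith.of_dist_le_mul fun a b => ?_)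
  rw [dist_eq_norm, Real.dist_eq]
  exact (hC b a).trans (mul_le_mul_of_nonneg_right (Real.le_coe_toNNReal C) (abs_nonneg _))

/-- The differential form of `integral_superlevel_tderiv`. The right-hand side is a derivative only
where it is continuous; near a regular value this is `IsTransverse.eventually_continuousAt`. -/
theorem hasDerivAt_superlevel_testMul_pderiv (j : Fin m) {t : ℝ}
    (ht : ∀ᶠ s in 𝓝 t, ContinuousAt (superlevel g₀ (tderiv j φ)) s) :
    HasDerivAt (superlevel g₀ (testMul (pderiv j g₀) φ)) (superlevel g₀ (tderiv j φ) t) t := by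
  have h1 : superlevel g₀ (testMul (pderiv j g₀) φ) = fun s =>
      superlevel g₀ (testMul (pderiv j g₀) φ) t + ∫ r in t..s, superlevel g₀ (tderiv j φ) r := by
    funext s
    rw [integral_superlevel_tderiv]
    ring
  obtain ⟨s, hs, hso, hts⟩ := eventually_nhds_iff.1 ht
  rw [h1]
  refine HasDerivAt.const_add _ ?_
  refine intervalIntegral.integral_hasDerivAt_right (intervalIntegrable_superlevel _ _ _ _) ?_
    ht.self_of_nhds
  exact ContinuousAt.stronglyMeasurableAtFilter hso hs t hts

/-- If `g₀` does not vanish on the support of `φ`, then `∫_{g₀ ≥ s} φ dV` does not depend on `s`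
near `0`. -/
theorem superlevel_eventually_const (h : ∀ x ∈ tsupport φ, ext0 g₀.1 x ≠ 0) :
    ∀ᶠ s in 𝓝 0, superlevel g₀ φ s = superlevel g₀ φ 0 := by
  have hc : Continuous fun x => |ext0 g₀.1 x| := (Smooth.contDiff g₀).continuous.abs
  obtain ⟨ε, hε, hle⟩ : ∃ ε > 0, ∀ x ∈ tsupport φ, ε ≤ |ext0 g₀.1 x| := by
    rcases (tsupport φ).eq_empty_or_nonempty with he | hne
    · exact ⟨1, one_pos, by simp [he]⟩
    · obtain ⟨x, hx, hmin⟩ := IsCompact.exists_isMinOn φ.hasCompactSupport hne hc.continuousOn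
      exact ⟨_, abs_pos.2 (h x hx), fun y hy => hmin hy⟩
  filter_upwards [Metric.ball_mem_nhds 0 hε] with s hs
  rw [superlevel_eq_indicator, superlevel_eq_indicator]
  congr 1
  ext x
  by_cases hx : x ∈ tsupport φ
  · have h1 := hle x hx
    rw [mem_ball_zero_iff, Real.norm_eq_abs, abs_lt] at hs
    have : s ≤ ext0 g₀.1 x ↔ 0 ≤ ext0 g₀.1 x := by
      rcases le_abs.1 h1 with h2 | h2
      · exact iff_of_true (by linarith) (by linarith)
      · exact iff_of_false (by linarith) (by linarith)
    simp only [Set.indicator, Set.mem_ofPred_eq, this]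
  · rw [Set.indicator_apply_eq_zero.2 fun _ => image_eq_zero_of_notMem_tsupport hx,
      Set.indicator_apply_eq_zero.2 fun _ => image_eq_zero_of_notMem_tsupport hx]

end Superlevel

/-! ### The distributions `δ^{(k)}(g₀)` -/

section Delta

open Filter

variable {m : ℕ} {g₀ : Smooth (⊤ : Opens (E m))}

/-- The gradient of `g₀` does not vanish on the zero set of `g₀`. -/
def IsRegular (g₀ : Smooth (⊤ : Opens (E m))) : Prop :=
  ∀ x : E m, ext0 g₀.1 x = 0 → ∃ j : Fin m, ext0 (pderiv j g₀).1 x ≠ 0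

/-- The vector field `X` satisfies `X g₀ = 1` near the zero set of `g₀`. -/
def IsTransverse (X : Fin m → Smooth (⊤ : Opens (E m))) (g₀ : Smooth (⊤ : Opens (E m))) : Prop :=
  ∀ x : E m, ext0 g₀.1 x = 0 →
    ∀ᶠ y in 𝓝 x, ∑ j, ext0 (pderiv j g₀).1 y * ext0 (X j).1 y = 1

theorem IsRegular.neg (h : IsRegular g₀) : IsRegular (-g₀) := fun x hx => by
  rw [ext0_neg, neg_eq_zero] at hx
  obtain ⟨j, hj⟩ := h x hx
  exact ⟨j, by rwa [map_neg, ext0_neg, neg_ne_zero]⟩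

theorem IsTransverse.neg {X : Fin m → Smooth (⊤ : Opens (E m))} (h : IsTransverse X g₀) :
    IsTransverse (fun j => -X j) (-g₀) := fun x hx => by
  rw [ext0_neg, neg_eq_zero] at hx
  filter_upwards [h x hx] with y hy
  simpa only [map_neg, ext0_neg, neg_mul_neg] using hy

/-- A transverse field is the gradient of `g₀` divided by its squared norm, modified away from the
zero set. -/
theorem IsRegular.exists_isTransverse (h : IsRegular g₀) : ∃ X, IsTransverse X g₀ := by
  let S : E m → ℝ := fun x => ∑ j, ext0 (pderiv j g₀).1 x ^ 2
  have hS : ContDiff ℝ ∞ S := ContDiff.sum fun j _ => (Smooth.contDiff (pderiv j g₀)).pow 2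
  have hS0 (x : E m) : 0 ≤ S x := Finset.sum_nonneg fun j _ => sq_nonneg _
  have hSpos (x : E m) (hx : ext0 g₀.1 x = 0) : 0 < S x := by
    obtain ⟨j, hj⟩ := h x hx
    exact Finset.sum_pos' (fun j _ => sq_nonneg _) ⟨j, Finset.mem_univ j, by positivity⟩
  -- `σ` vanishes near the zero set and keeps the denominator `S + σ` positive everywhere
  obtain ⟨σ, h0, h1, h01⟩ := exists_contMDiffMap_zero_one_nhds_of_isClosed
    (modelWithCornersSelf ℝ (E m)) (n := ⊤) (s := {x | ext0 g₀.1 x = 0}) (t := {x | S x = 0})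
    (isClosed_eq (Smooth.contDiff g₀).continuous continuous_const)
    (isClosed_eq hS.continuous continuous_const)
    (Set.disjoint_left.2 fun x hx hk => (hSpos x hx).ne' hk)
  have hσ : ContDiff ℝ ∞ σ := σ.contMDiff.contDiff
  have hden (x : E m) : S x + σ x ≠ 0 := by
    by_cases hx : S x = 0
    · have : σ x = 1 :=
        (h1.filter_mono (nhds_le_nhdsSet (show x ∈ {x | S x = 0} from hx))).self_of_nhds
      rw [hx, this]; norm_num
    · have h2 := (h01 x).1
      have h3 := (hS0 x).lt_of_ne' hx
      linarith
  refine ⟨fun j => Smooth.ofContDiff ⊤ (fun x => ext0 (pderiv j g₀).1 x / (S x + σ x))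
    ((Smooth.contDiff (pderiv j g₀)).div (hS.add hσ) hden), fun x hx => ?_⟩
  filter_upwards [
    h0.filter_mono (nhds_le_nhdsSet (show x ∈ {x | ext0 g₀.1 x = 0} from hx)),
    hS.continuous.continuousAt.eventually_ne (hSpos x hx).ne'] with y hy hSy
  simp only [ext0_ofContDiff _ (show y ∈ (⊤ : Opens (E m)) from trivial), hy, add_zero]
  simp only [← mul_div_assoc, ← pow_two]
  rw [← Finset.sum_div]
  exact div_self hSy

/-- The operator `φ ↦ div(φ X)` on test functions. -/
def divField (X : Fin m → Smooth (⊤ : Opens (E m))) (φ : 𝓓((⊤ : Opens (E m)), ℝ)) :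
    𝓓((⊤ : Opens (E m)), ℝ) := ∑ j, tderiv j (testMul (X j) φ)

/-- The derivation `T ↦ X T = ∑ X_j ∂_j T` of distributions along a vector field. -/
def fieldDeriv (X : Fin m → Smooth (⊤ : Opens (E m))) :
    Module.End ℝ 𝓓'((⊤ : Opens (E m)), ℝ) := ∑ j, smulDist (X j) ∘ₗ distDeriv j

theorem fieldDeriv_apply (X : Fin m → Smooth (⊤ : Opens (E m)))
    (T : 𝓓'((⊤ : Opens (E m)), ℝ)) (φ : 𝓓((⊤ : Opens (E m)), ℝ)) :
    fieldDeriv X T φ = -T (divField X φ) := by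
  simp only [fieldDeriv, divField, LinearMap.sum_apply, LinearMap.comp_apply, map_sum,
    ← Finset.sum_neg_distrib, sum_apply]
  rfl

theorem fieldDeriv_pow_apply (X : Fin m → Smooth (⊤ : Opens (E m))) (k : ℕ)
    (T : 𝓓'((⊤ : Opens (E m)), ℝ)) (φ : 𝓓((⊤ : Opens (E m)), ℝ)) :
    (fieldDeriv X ^ k) T φ = (-1) ^ k * T ((divField X)^[k] φ) := by
  induction k generalizing φ with
  | zero => simp
  | succ k ih =>
    rw [pow_succ', Module.End.mul_apply, fieldDeriv_apply, ih, ← Function.iterate_succ_apply]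
    ring

theorem fieldDeriv_neg (X : Fin m → Smooth (⊤ : Opens (E m))) :
    fieldDeriv (fun j => -X j) = -fieldDeriv X := by
  simp only [fieldDeriv, map_neg, LinearMap.neg_comp, Finset.sum_neg_distrib]

theorem fieldDeriv_lebesgueDist (X : Fin m → Smooth (⊤ : Opens (E m))) :
    fieldDeriv X (lebesgueDist ⊤) = 0 := by
  simp only [fieldDeriv, LinearMap.sum_apply, LinearMap.comp_apply, distDeriv_lebesgueDist,
    map_zero, Finset.sum_const_zero]

variable {X : Fin m → Smooth (⊤ : Opens (E m))}

/-- Near `0`, the function `∫_{g₀ ≥ s} φ dV` of `s` agrees, up to a constant, with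
`∑ ∫_{g₀ ≥ s} (∂_j g₀) X_j φ dV`. -/
theorem IsTransverse.superlevel_eventuallyEq (hX : IsTransverse X g₀)
    (φ : 𝓓((⊤ : Opens (E m)), ℝ)) : ∃ c : ℝ, superlevel g₀ φ =ᶠ[𝓝 0] fun s =>
      (∑ j, superlevel g₀ (testMul (pderiv j g₀) (testMul (X j) φ)) s) + c := by
  set r : 𝓓((⊤ : Opens (E m)), ℝ) := φ - ∑ j, testMul (pderiv j g₀) (testMul (X j) φ) with hr
  refine ⟨superlevel g₀ r 0, ?_⟩
  have hsupp : ∀ x ∈ tsupport r, ext0 g₀.1 x ≠ 0 := by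
    intro x hx h0
    refine (notMem_tsupport_iff_eventuallyEq.2 ?_) hx
    filter_upwards [hX x h0] with y hy
    rw [hr, sub_apply, sum_apply]
    simp only [testMul_apply, ← mul_assoc]
    rw [← Finset.sum_mul, hy, one_mul, sub_self]
    rfl
  filter_upwards [superlevel_eventually_const g₀ r hsupp] with s hs
  rw [← hs, ← superlevel_sum, ← superlevel_add, hr, add_sub_cancel]

theorem IsTransverse.eventually_continuousAt (hX : IsTransverse X g₀)
    (φ : 𝓓((⊤ : Opens (E m)), ℝ)) : ∀ᶠ s in 𝓝 0, ContinuousAt (superlevel g₀ φ) s := by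
  obtain ⟨c, hc⟩ := hX.superlevel_eventuallyEq φ
  filter_upwards [hc.eventuallyEq_nhds] with s hs
  refine ContinuousAt.congr ?_ hs.symm
  refine ((continuous_finsetSum _ fun j _ => ?_).add continuous_const).continuousAt
  exact continuous_superlevel_testMul_pderiv g₀ _ j

theorem IsTransverse.eventually_hasDerivAt_testMul_pderiv (hX : IsTransverse X g₀)
    (φ : 𝓓((⊤ : Opens (E m)), ℝ)) (j : Fin m) :
    ∀ᶠ s in 𝓝 0, HasDerivAt (superlevel g₀ (testMul (pderiv j g₀) φ))
      (superlevel g₀ (tderiv j φ) s) s := by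
  filter_upwards [eventually_eventually_nhds.2 (hX.eventually_continuousAt (tderiv j φ))] with s hs
  exact hasDerivAt_superlevel_testMul_pderiv g₀ φ j hs

/-- The class of functions `s ↦ ∫_{g₀ ≥ s} φ dV` is stable under differentiation near `0`. -/
theorem IsTransverse.eventually_hasDerivAt (hX : IsTransverse X g₀)
    (φ : 𝓓((⊤ : Opens (E m)), ℝ)) :
    ∀ᶠ s in 𝓝 0, HasDerivAt (superlevel g₀ φ) (superlevel g₀ (divField X φ) s) s := by
  obtain ⟨c, hc⟩ := hX.superlevel_eventuallyEq φ
  filter_upwards [hc.eventuallyEq_nhds, eventually_all.2 fun j =>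
    hX.eventually_hasDerivAt_testMul_pderiv (testMul (X j) φ) j] with s hs hd
  refine HasDerivAt.congr_of_eventuallyEq ?_ hs
  rw [divField, superlevel_sum]
  exact (HasDerivAt.fun_sum fun j _ => hd j).add_const c

theorem IsTransverse.iteratedDeriv_eventuallyEq (hX : IsTransverse X g₀) (k : ℕ)
    (φ : 𝓓((⊤ : Opens (E m)), ℝ)) :
    iteratedDeriv k (superlevel g₀ φ) =ᶠ[𝓝 0] superlevel g₀ ((divField X)^[k] φ) := by
  induction k generalizing φ with
  | zero => simp
  | succ k ih =>
    rw [iteratedDeriv_succ, Function.iterate_succ_apply']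
    refine (ih φ).deriv.trans ?_
    filter_upwards [hX.eventually_hasDerivAt ((divField X)^[k] φ)] with s hs using hs.deriv

theorem iteratedDeriv_fibreIntegral (k : ℕ) (φ : 𝓓((⊤ : Opens (E m)), ℝ)) (t : ℝ) :
    iteratedDeriv k (fibreIntegral g₀ φ) t = -iteratedDeriv (k + 1) (superlevel g₀ φ) t := by
  rw [iteratedDeriv_succ']
  exact iteratedDeriv_fun_neg k (deriv (superlevel g₀ φ)) t

/-- `δ^{(k-1)}(g₀)` is the `k`-th derivative of `H(g₀)` along a transverse vector field. In
particular the composition of `δ^{(k-1)}` with `g₀` exists as a distribution. -/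
theorem IsTransverse.deltaPred₀_eq (hX : IsTransverse X g₀) (k : ℕ) :
    deltaPred₀ k g₀ = (fieldDeriv X ^ k) (heaviside₀ g₀) := by
  cases k with
  | zero => rfl
  | succ k =>
    have h (φ : 𝓓((⊤ : Opens (E m)), ℝ)) : (fieldDeriv X ^ (k + 1)) (heaviside₀ g₀) φ =
        (-1) ^ k * iteratedDeriv k (fibreIntegral g₀ φ) 0 := by
      rw [fieldDeriv_pow_apply, iteratedDeriv_fibreIntegral, heaviside₀_eq_superlevel,
        (hX.iteratedDeriv_eventuallyEq (k + 1) φ).self_of_nhds]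
      ring
    have hex : ∃ T : 𝓓'((⊤ : Opens (E m)), ℝ),
        ∀ φ, T φ = (-1) ^ k * iteratedDeriv k (fibreIntegral g₀ φ) 0 := ⟨_, h⟩
    ext φ
    rw [h, deltaPred₀, delta₀, dif_pos hex]
    exact hex.choose_spec φ

theorem IsTransverse.deltaPred₀_apply (hX : IsTransverse X g₀) (k : ℕ)
    (φ : 𝓓((⊤ : Opens (E m)), ℝ)) :
    deltaPred₀ k g₀ φ = (-1) ^ k * iteratedDeriv k (superlevel g₀ φ) 0 := by
  rw [hX.deltaPred₀_eq, fieldDeriv_pow_apply, heaviside₀_eq_superlevel,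
    (hX.iteratedDeriv_eventuallyEq k φ).self_of_nhds]

/-- The chain rule `∂_j δ^{(k-1)}(g₀) = (∂_j g₀) δ^{(k)}(g₀)`. -/
theorem IsRegular.distDeriv_deltaPred₀ (h : IsRegular g₀) (j : Fin m) (k : ℕ) :
    distDeriv j (deltaPred₀ k g₀) = smulDist (pderiv j g₀) (deltaPred₀ (k + 1) g₀) := by
  obtain ⟨X, hX⟩ := h.exists_isTransverse
  ext φ
  rw [distDeriv_apply, smulDist_apply, hX.deltaPred₀_apply, hX.deltaPred₀_apply,
    iteratedDeriv_succ', pow_succ]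
  have hd : deriv (superlevel g₀ (testMul (pderiv j g₀) φ)) =ᶠ[𝓝 0]
      superlevel g₀ (tderiv j φ) := by
    filter_upwards [hX.eventually_hasDerivAt_testMul_pderiv φ j] with s hs using hs.deriv
  rw [hd.iteratedDeriv_eq]
  ring

/-- `H(-g₀) = 1 - H(g₀)`, because the zero set of `g₀` is negligible. -/
theorem IsRegular.heaviside₀_neg (h : IsRegular g₀) :
    heaviside₀ (-g₀) = lebesgueDist ⊤ - heaviside₀ g₀ := by
  obtain ⟨X, hX⟩ := h.exists_isTransverse
  ext φ
  change heaviside₀ (-g₀) φ = lebesgueDist ⊤ φ - heaviside₀ g₀ φ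
  have hm : MeasurableSet {x | 0 < ext0 g₀.1 x} :=
    (isOpen_lt continuous_const (Smooth.contDiff g₀).continuous).measurableSet
  have h1 : superlevel g₀ φ 0 = ∫ x in {x | 0 < ext0 g₀.1 x}, φ x := by
    have ht : Tendsto (fun n : ℕ => superlevel g₀ φ (1 / ((n : ℝ) + 1))) atTop
        (𝓝 (superlevel g₀ φ 0)) :=
      (hX.eventually_continuousAt φ).self_of_nhds.tendsto.comp
        tendsto_one_div_add_atTop_nhds_zero_nat
    refine tendsto_nhds_unique ht ?_
    rw [← integral_indicator hm]
    simp only [superlevel_eq_indicator]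
    refine tendsto_integral_of_dominated_convergence (fun x => ‖φ x‖)
      (fun n => φ.aestronglyMeasurable.indicator (measurableSet_superlevel g₀ _))
      (TestFunction_integrable φ).norm
      (fun n => Eventually.of_forall fun x => norm_indicator_le_norm_self _ _)
      (Eventually.of_forall fun x => tendsto_const_nhds.congr' ?_)
    by_cases hx : 0 < ext0 g₀.1 x
    · obtain ⟨N, hN⟩ := exists_nat_one_div_lt hx
      filter_upwards [eventually_ge_atTop N] with n hn
      have : 1 / ((n : ℝ) + 1) ≤ ext0 g₀.1 x :=
        (one_div_le_one_div_of_le (by positivity) (by gcongr)).trans hN.le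
      rw [Set.indicator_of_mem (show x ∈ {x | 0 < ext0 g₀.1 x} from hx),
        Set.indicator_of_mem (show x ∈ {x | 1 / ((n : ℝ) + 1) ≤ ext0 g₀.1 x} from this)]
    · refine Eventually.of_forall fun n => ?_
      have : ¬ 1 / ((n : ℝ) + 1) ≤ ext0 g₀.1 x := fun h => hx (lt_of_lt_of_le (by positivity) h)
      rw [Set.indicator_of_notMem (show x ∉ {x | 0 < ext0 g₀.1 x} from hx)]
      exact (Set.indicator_of_notMem
        (show x ∉ {x | 1 / ((n : ℝ) + 1) ≤ ext0 g₀.1 x} from this) _).symm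
  have h2 : {x : E m | 0 ≤ ext0 (-g₀).1 x} = {x | 0 < ext0 g₀.1 x}ᶜ := by
    ext x
    change 0 ≤ ext0 (-g₀).1 x ↔ ¬ 0 < ext0 g₀.1 x
    rw [ext0_neg, neg_nonneg, not_lt]
  rw [heaviside₀_apply, h2, heaviside₀_eq_superlevel, h1, lebesgueDist_apply,
    ← integral_add_compl hm (TestFunction_integrable φ)]
  ring

/-- `δ^{(k)}(-g₀) = (-1)^k δ^{(k)}(g₀)`. -/
theorem IsRegular.deltaPred₀_neg (h : IsRegular g₀) (k : ℕ) :
    deltaPred₀ (k + 1) (-g₀) = (-1 : ℝ) ^ k • deltaPred₀ (k + 1) g₀ := by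
  obtain ⟨X, hX⟩ := h.exists_isTransverse
  rw [hX.neg.deltaPred₀_eq, hX.deltaPred₀_eq, h.heaviside₀_neg, fieldDeriv_neg,
    show -fieldDeriv X = (-1 : ℝ) • fieldDeriv X by rw [neg_one_smul], smul_pow,
    LinearMap.smul_apply, map_sub, pow_succ (fieldDeriv X), Module.End.mul_apply,
    fieldDeriv_lebesgueDist, map_zero, zero_sub, Module.End.mul_apply, pow_succ, mul_neg_one,
    neg_smul, smul_neg, neg_neg]

/-- `δ^{(k)}(g₀)` is supported on the zero set of `g₀`. -/
theorem IsRegular.isVanishingOn_deltaPred₀ (h : IsRegular g₀) (k : ℕ) :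
    Distribution.IsVanishingOn (deltaPred₀ (k + 1) g₀) {x : E m | ext0 g₀.1 x ≠ 0} := by
  intro φ hφ
  obtain ⟨X, hX⟩ := h.exists_isTransverse
  have hc : superlevel g₀ φ =ᶠ[𝓝 0] fun _ => superlevel g₀ φ 0 :=
    superlevel_eventually_const g₀ φ hφ
  rw [hX.deltaPred₀_apply, hc.iteratedDeriv_eq, iteratedDeriv_const, if_neg (by simp), mul_zero]

theorem isVanishingOn_heaviside₀_neg :
    Distribution.IsVanishingOn (heaviside₀ (-g₀)) {x : E m | 0 < ext0 g₀.1 x} := by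
  intro φ hφ
  rw [heaviside₀_apply]
  refine setIntegral_eq_zero_of_forall_eq_zero fun x hx => ?_
  by_contra hne
  have h1 : 0 < ext0 g₀.1 x := hφ (subset_tsupport φ hne)
  have h2 : 0 ≤ ext0 (-g₀).1 x := hx
  rw [ext0_neg] at h2
  linarith

theorem isVanishingOn_heaviside₀_neg_sub :
    Distribution.IsVanishingOn (heaviside₀ (-g₀) - lebesgueDist ⊤ : 𝓓'((⊤ : Opens (E m)), ℝ))
      {x : E m | ext0 g₀.1 x < 0} := by
  intro φ hφ
  change heaviside₀ (-g₀) φ - lebesgueDist ⊤ φ = 0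
  rw [heaviside₀_apply, lebesgueDist_apply, sub_eq_zero]
  refine setIntegral_eq_integral_of_forall_compl_eq_zero fun x hx => ?_
  by_contra hne
  have h1 : ext0 g₀.1 x < 0 := hφ (subset_tsupport φ hne)
  refine hx ?_
  change 0 ≤ ext0 (-g₀).1 x
  rw [ext0_neg]
  linarith

end Delta

/-! ### Powers under a derivation -/

section Abstract

theorem map_one_of_leibniz {S : Type*} [Ring S] [Algebra ℝ S] (L : S →ₗ[ℝ] S)
    (h : L (1 * 1) = L 1 * 1 + 1 * L 1) : L 1 = 0 := by
  rw [mul_one, mul_one, one_mul] at h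
  exact left_eq_add.1 h

theorem map_pow_of_leibniz {S : Type*} [Ring S] [Algebra ℝ S] (L : S →ₗ[ℝ] S) {u : S}
    (hc : ∀ F, F * u = u * F) (hL : ∀ F, L (u * F) = L u * F + u * L F)
    (k : ℕ) :
    L (u ^ (k + 1)) = ((k : ℝ) + 1) • (L u * u ^ k) := by
  induction k with
  | zero => rw [zero_add, pow_one, pow_zero, mul_one, Nat.cast_zero, zero_add, one_smul]
  | succ k ih =>
    rw [pow_succ' u (k + 1), hL, ih, mul_smul_comm, ← mul_assoc, ← hc (L u), mul_assoc,
      ← pow_succ']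
    push_cast
    module

/-- If the sets `d k` behave like the homogeneous parts of a grading of `B`, then the powers of an
element of `S ⊗ d 1 ⊗ 1` lie in the corresponding degrees. -/
theorem pow_mem_span_tmul {S B C : Type*} [CommRing S] [Algebra ℝ S] [Ring B] [Algebra ℝ B]
    [Ring C] [Algebra ℝ C] {d : ℕ → Set B}
    (hd : ∀ {k a b}, a ∈ d k → b ∈ d 1 → a * b ∈ d (k + 1)) {x : S ⊗[ℝ] (B ⊗[ℝ] C)}
    (hx : x ∈ Submodule.span ℝ {y | ∃ f : S, ∃ a ∈ d 1, y = f ⊗ₜ (a ⊗ₜ (1 : C))}) (k : ℕ) :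
    x ^ (k + 1) ∈ Submodule.span ℝ {y | ∃ f : S, ∃ a ∈ d (k + 1), y = f ⊗ₜ (a ⊗ₜ (1 : C))} := by
  induction k with
  | zero => rwa [zero_add, pow_one]
  | succ k ih =>
    rw [pow_succ]
    have h := Submodule.mul_mem_mul ih hx
    rw [Submodule.span_mul_span] at h
    refine Submodule.span_le.2 ?_ h
    rintro _ ⟨_, ⟨f, a, ha, rfl⟩, _, ⟨f', a', ha', rfl⟩, rfl⟩
    refine Submodule.subset_span ⟨f * f', a * a', hd ha ha', ?_⟩
    change (f ⊗ₜ[ℝ] (a ⊗ₜ[ℝ] (1 : C))) * (f' ⊗ₜ[ℝ] (a' ⊗ₜ[ℝ] (1 : C))) = _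
    rw [Algebra.TensorProduct.tmul_mul_tmul, Algebra.TensorProduct.tmul_mul_tmul, one_mul]

/-- The chain rule for `D` applied to the finite Taylor expansion of `H(-g)`: the derivatives of
the nilpotent powers and those of the coefficients telescope to the Taylor expansion of
`δ(g)`. -/
theorem map_taylor_sum {S N : Type*} [AddCommGroup S] [Module ℝ S] [AddCommGroup N] [Module ℝ N]
    (μ : S →ₗ[ℝ] N →ₗ[ℝ] N) (L : S →ₗ[ℝ] S) (D : N →ₗ[ℝ] N) (p : ℕ → S) (h c : S) (T R : ℕ → N)
    (n : ℕ) (hL0 : L (p 0) = 0)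
    (hL : ∀ j x, μ (L (p (j + 1))) x = ((j : ℝ) + 1) • μ h (μ (p j) x))
    (hD : ∀ j x, D (μ (p j) x) = μ (L (p j)) x + μ (p j) (D x))
    (hc : ∀ j x, μ (p j) (μ c x) = μ c (μ (p j) x))
    (hT : ∀ j, T (j + 1) = (-1 : ℝ) ^ j • R j)
    (hDT : ∀ j, D (T j) = (-1 : ℝ) ^ (j + 1) • μ c (R j))
    (hn : ∀ x, μ h (μ (p n) x) = 0) :
    D (∑ j ∈ Finset.range (n + 1), ((j.factorial : ℝ)⁻¹ * (-1) ^ j) • μ (p j) (T j)) =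
      -μ (h + c) (∑ j ∈ Finset.range (n + 1), (j.factorial : ℝ)⁻¹ • μ (p j) (R j)) := by
  have h1 (j : ℕ) : (j.factorial : ℝ)⁻¹ * (-1) ^ j * (-1) ^ (j + 1) = -(j.factorial : ℝ)⁻¹ := by
    rw [mul_assoc, ← pow_add, Odd.neg_one_pow ⟨j, by ring⟩, mul_neg_one]
  have h2 (j : ℕ) : ((j + 1).factorial : ℝ)⁻¹ * (-1) ^ (j + 1) * ((j + 1) * (-1) ^ j) =
      -(j.factorial : ℝ)⁻¹ := by
    have h2 : ((j : ℝ) + 1) ≠ 0 := by positivity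
    have h3 : (-1 : ℝ) ^ (j + 1) * (-1) ^ j = -1 := by
      rw [← pow_add, Odd.neg_one_pow ⟨j, by ring⟩]
    rw [Nat.factorial_succ, Nat.cast_mul, Nat.cast_succ, mul_inv]
    calc _ = ((j : ℝ) + 1)⁻¹ * (j + 1) * (j.factorial : ℝ)⁻¹ * ((-1 : ℝ) ^ (j + 1) * (-1) ^ j) := by
          ring
      _ = _ := by rw [h3, inv_mul_cancel₀ h2]; ring
  have h3 (j : ℕ) : D (((j.factorial : ℝ)⁻¹ * (-1) ^ j) • μ (p j) (T j)) =
      ((j.factorial : ℝ)⁻¹ * (-1) ^ j) • μ (L (p j)) (T j) -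
        (j.factorial : ℝ)⁻¹ • μ c (μ (p j) (R j)) := by
    rw [map_smul, hD, hDT, map_smul, smul_add, smul_smul, h1, hc, neg_smul, sub_eq_add_neg]
  have h4 (j : ℕ) : (((j + 1).factorial : ℝ)⁻¹ * (-1) ^ (j + 1)) • μ (L (p (j + 1))) (T (j + 1)) =
      -((j.factorial : ℝ)⁻¹ • μ h (μ (p j) (R j))) := by
    rw [hL, hT, map_smul, map_smul, smul_smul, smul_smul, mul_assoc, h2, neg_smul]
  rw [map_sum, Finset.sum_congr rfl fun j _ => h3 j, Finset.sum_sub_distrib, map_add,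
    LinearMap.add_apply, Finset.sum_range_succ', hL0, map_zero, LinearMap.zero_apply, smul_zero,
    add_zero, Finset.sum_congr rfl fun j _ => h4 j, map_sum, map_sum]
  simp only [map_smul]
  rw [Finset.sum_range_succ (fun j => (j.factorial : ℝ)⁻¹ • μ h (μ (p j) (R j))), hn, smul_zero,
    add_zero, Finset.sum_neg_distrib, neg_add, sub_eq_add_neg]

end Abstract

/-! ### The Dirac operator on superfunctions and superdistributions -/

-- Shortcuts for the algebra structure of superfunctions, which is slow to synthesize.
local instance SFun.instMul {m n : ℕ} {Ω : Opens (E m)} : Mul (SFun Ω n) :=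
  Algebra.TensorProduct.instMul

local instance SFun.instRing {m n : ℕ} {Ω : Opens (E m)} : Ring (SFun Ω n) :=
  Algebra.TensorProduct.instRing

local instance SFun.instAlgebra {m n : ℕ} {Ω : Opens (E m)} : Algebra ℝ (SFun Ω n) :=
  Algebra.TensorProduct.instAlgebra

section SuperCalculus

variable {m n : ℕ} {Ω : Opens (E m)}

/-- The left Dirac operator on superfunctions. -/
def sDiracL : SFun Ω n →ₗ[ℝ] SFun Ω n := diracL pderiv

/-- The right Dirac operator on superfunctions. -/
def sDiracR : SFun Ω n →ₗ[ℝ] SFun Ω n := diracR pderiv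

theorem SFun_mul_eq (F G : SFun Ω n) :
    F * G = bmul (A m n) (LinearMap.mul ℝ (Smooth Ω)) F G := mul_eq_bmul F G

theorem mul_mem_evScalar {u v : SFun Ω n} (hu : u ∈ evScalar m n (Smooth Ω))
    (hv : v ∈ evScalar m n (Smooth Ω)) : u * v ∈ evScalar m n (Smooth Ω) := by
  rw [SFun_mul_eq]
  exact bmul_mem_evScalar hu hv

theorem pow_mem_evScalar {u : SFun Ω n} (hu : u ∈ evScalar m n (Smooth Ω)) (k : ℕ) :
    u ^ k ∈ evScalar m n (Smooth Ω) := by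
  induction k with
  | zero => rw [pow_zero]; exact tmul_one_mem_evScalar 1
  | succ k ih => rw [pow_succ]; exact mul_mem_evScalar ih hu

theorem SFun_mul_comm (F : SFun Ω n) {u : SFun Ω n} (hu : u ∈ evScalar m n (Smooth Ω)) :
    F * u = u * F := by
  rw [SFun_mul_eq, SFun_mul_eq, bmul_comm_of_evScalar _ F hu]
  have h : (LinearMap.mul ℝ (Smooth Ω)).flip = LinearMap.mul ℝ (Smooth Ω) :=
    LinearMap.ext₂ fun a b => mul_comm b a
  rw [h]

theorem funMulDist_mul (F G : SFun Ω n) (γ : SDist Ω n) :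
    funMulDist (F * G) γ = funMulDist F (funMulDist G γ) := by
  rw [SFun_mul_eq]
  exact bmul_assoc (fun f g T => smulDist_mul f g T) F G γ

theorem distMulFun_mul (γ : SDist Ω n) (F G : SFun Ω n) :
    distMulFun γ (F * G) = distMulFun (distMulFun γ F) G := by
  rw [SFun_mul_eq]
  exact (bmul_assoc (fun T f g => by
    simp only [LinearMap.flip_apply, LinearMap.mul_apply']
    rw [mul_comm, smulDist_mul]) γ F G).symm

theorem funMulDist_distMulFun (F : SFun Ω n) (γ : SDist Ω n) (G : SFun Ω n) :
    distMulFun (funMulDist F γ) G = funMulDist F (distMulFun γ G) :=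
  bmul_assoc (fun f T g => by simp only [LinearMap.flip_apply]; exact smulDist_comm g f T) F γ G

theorem funMulDist_comm (F : SFun Ω n) {γ : SDist Ω n}
    (hγ : γ ∈ evScalar m n 𝓓'(Ω, ℝ)) : funMulDist F γ = distMulFun γ F :=
  bmul_comm_of_evScalar smulDist F hγ

theorem diracL_mul {u : SFun Ω n} (hu : u ∈ evScalar m n (Smooth Ω)) (F : SFun Ω n) :
    sDiracL (u * F) = sDiracL u * F + u * sDiracL F := by
  simp only [SFun_mul_eq]
  exact diracL_bmul (fun j f g => pderiv_mul j f g) hu F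

theorem diracL_funMulDist {u : SFun Ω n} (hu : u ∈ evScalar m n (Smooth Ω)) (γ : SDist Ω n) :
    diracL distDeriv (funMulDist u γ) =
      funMulDist (sDiracL u) γ + funMulDist u (diracL distDeriv γ) :=
  diracL_bmul (fun j f T => distDeriv_smulDist j f T) hu γ

theorem diracR_funMulDist (F : SFun Ω n) {γ : SDist Ω n} (hγ : γ ∈ evScalar m n 𝓓'(Ω, ℝ)) :
    diracR distDeriv (funMulDist F γ) =
      funMulDist (sDiracR F) γ + funMulDist F (diracR distDeriv γ) :=
  diracR_bmul (fun j f T => distDeriv_smulDist j f T) F hγ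

theorem diracL_one : sDiracL (1 : SFun Ω n) = 0 :=
  map_one_of_leibniz (S := SFun Ω n) sDiracL (diracL_mul (tmul_one_mem_evScalar (1 : Smooth Ω)) 1)

theorem diracL_pow_succ {u : SFun Ω n} (hu : u ∈ evScalar m n (Smooth Ω)) (k : ℕ) :
    sDiracL (u ^ (k + 1)) = ((k : ℝ) + 1) • (sDiracL u * u ^ k) :=
  map_pow_of_leibniz (S := SFun Ω n) sDiracL (fun F => SFun_mul_comm F hu) (diracL_mul hu) k

theorem diracL_tmul_one {V : Type*} [AddCommGroup V] [Module ℝ V] (d : Fin m → V →ₗ[ℝ] V) (v : V) :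
    diracL d (v ⊗ₜ (1 : A m n)) = -∑ j, d j v ⊗ₜ ((1 : Gr n) ⊗ₜ e j) := by
  have h (k : Fin (2 * n)) : grL k (1 : Gr n) = 0 :=
    CliffordAlgebra.contractLeft_one (Q := (0 : QuadraticForm ℝ (Fin (2 * n) → ℝ))) _
  rw [Algebra.TensorProduct.one_def]
  simp only [diracL, LinearMap.sub_apply, LinearMap.smul_apply, LinearMap.sum_apply, fermL,
    TensorProduct.map_tmul, h, TensorProduct.zero_tmul, TensorProduct.tmul_zero, sub_zero,
    Finset.sum_const_zero, smul_zero, zero_sub, LinearMap.id_apply, LinearMap.mulLeft_apply,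
    mul_one]

theorem sDiracL_tmul_one (f : Smooth Ω) :
    sDiracL (f ⊗ₜ (1 : A m n)) = -∑ j, pderiv j f ⊗ₜ ((1 : Gr n) ⊗ₜ e j) :=
  diracL_tmul_one pderiv f

theorem diracL_dist_tmul_one {f : Smooth Ω} {T S : 𝓓'(Ω, ℝ)}
    (h : ∀ j, distDeriv j T = smulDist (pderiv j f) S) :
    diracL distDeriv (T ⊗ₜ (1 : A m n)) =
      funMulDist (sDiracL (f ⊗ₜ 1)) (S ⊗ₜ 1) := by
  rw [diracL_tmul_one, sDiracL_tmul_one, map_neg, LinearMap.neg_apply, map_sum,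
    LinearMap.sum_apply]
  congr 1
  refine Finset.sum_congr rfl fun j _ => ?_
  rw [funMulDist, TensorProduct.map₂_apply_tmul, TensorProduct.map_tmul, LinearMap.mul_apply',
    mul_one, h]

end SuperCalculus

/-! ### Even superfunctions and the distributions `δ^{(k)}(g)` -/

section Even

variable {m n : ℕ}

/-- The inclusion `C^∞(ℝ^m) ⊗ 𝔊_{2n}^{(ev)} → C^∞(ℝ^m) ⊗ 𝔊_{2n} ⊗ 𝒞_{m,2n}`. -/
def incl (g : EvFun m n) : SFun (⊤ : Opens (E m)) n := EvFun.toSFun g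

theorem incl_add (g h : EvFun m n) : incl (g + h) = incl g + incl h := map_add EvFun.toSFun g h

theorem incl_zero : incl (0 : EvFun m n) = 0 := by
  have h := incl_add (0 : EvFun m n) 0
  rw [add_zero] at h
  exact left_eq_add.1 h

theorem incl_neg (g : EvFun m n) : incl (-g) = -incl g := map_neg EvFun.toSFun g

theorem incl_pow (g : EvFun m n) (k : ℕ) : incl (g ^ k) = incl g ^ k :=
  RingHom.map_pow (EvFun.toSFun (m := m) (n := n)).toRingHom g k

theorem incl_tmul (f : Smooth (⊤ : Opens (E m))) (a : GrEv n) :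
    incl (f ⊗ₜ a : EvFun m n) = f ⊗ₜ ((a : Gr n) ⊗ₜ (1 : Cl m n)) := rfl

theorem incl_mem_evScalar (g : EvFun m n) :
    incl g ∈ evScalar m n (Smooth (⊤ : Opens (E m))) := by
  induction g using TensorProduct.induction_on with
  | zero => rw [incl_zero]; exact zero_mem _
  | add x y hx hy => rw [incl_add]; exact add_mem hx hy
  | tmul f a => exact tmul_mem_evScalar f a.2

theorem body_tmul (f : Smooth (⊤ : Opens (E m))) (a : GrEv n) :
    body (f ⊗ₜ a : EvFun m n) = ExteriorAlgebra.algebraMapInv (a : Gr n) • f := by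
  rfl

theorem incl_eq (g : EvFun m n) :
    incl g = incl (nilPart g) + body g ⊗ₜ (1 : A m n) := by
  have h : incl (body g ⊗ₜ 1 : EvFun m n) = body g ⊗ₜ (1 : A m n) := rfl
  rw [← h, ← incl_add, nilPart, sub_add_cancel]

theorem body_neg (g : EvFun m n) : body (-g) = -body g := map_neg body g

theorem nilPart_neg (g : EvFun m n) : nilPart (-g) = -nilPart g := by
  rw [nilPart, nilPart, body_neg, TensorProduct.neg_tmul]
  abel

theorem nilPart_incl_mem (g : EvFun m n) : incl (nilPart g) ∈
    Submodule.span ℝ {x : SFun (⊤ : Opens (E m)) n | ∃ f, ∃ a ∈ evenDeg n 1,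
      x = f ⊗ₜ (a ⊗ₜ (1 : Cl m n))} := by
  have hlin (g : EvFun m n) : incl (nilPart g) =
      incl g - body g ⊗ₜ (1 : A m n) := by rw [incl_eq g, add_sub_cancel_right]
  rw [hlin]
  induction g using TensorProduct.induction_on with
  | zero =>
    rw [incl_zero, map_zero, TensorProduct.zero_tmul, sub_zero]
    exact zero_mem _
  | add x y hx hy =>
    rw [incl_add, map_add, TensorProduct.add_tmul, add_sub_add_comm]
    exact add_mem hx hy
  | tmul f a =>
    have h : incl (f ⊗ₜ a : EvFun m n) - body (f ⊗ₜ a : EvFun m n) ⊗ₜ (1 : A m n) =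
        f ⊗ₜ (((a : Gr n) - algebraMap ℝ _ (ExteriorAlgebra.algebraMapInv (a : Gr n))) ⊗ₜ
          (1 : Cl m n)) := by
      rw [incl_tmul, body_tmul, TensorProduct.sub_tmul, TensorProduct.tmul_sub,
        Algebra.algebraMap_eq_smul_one, ← TensorProduct.smul_tmul', ← TensorProduct.smul_tmul',
        TensorProduct.tmul_smul]
      rfl
    have h' (y : Gr n) (hy : y ∈ Submodule.span ℝ (evenDeg n 1)) : f ⊗ₜ (y ⊗ₜ (1 : Cl m n)) ∈
        Submodule.span ℝ {x : SFun (⊤ : Opens (E m)) n | ∃ f, ∃ a ∈ evenDeg n 1,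
          x = f ⊗ₜ (a ⊗ₜ (1 : Cl m n))} := by
      induction hy using Submodule.span_induction with
      | mem x hx => exact Submodule.subset_span ⟨f, x, hx, rfl⟩
      | zero => rw [TensorProduct.zero_tmul, TensorProduct.tmul_zero]; exact zero_mem _
      | add x y _ _ hx hy =>
        rw [TensorProduct.add_tmul, TensorProduct.tmul_add]; exact add_mem hx hy
      | smul c x _ hx =>
        rw [← TensorProduct.smul_tmul', TensorProduct.tmul_smul]
        exact Submodule.smul_mem _ c hx
    rw [h]
    exact h' _ (sub_algebraMapInv_mem a.2)

/-- The nilpotent part of an even superfunction has degree at least `2` in the `2n` fermionic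
variables, hence its `(n+1)`-st power vanishes. -/
theorem nilPart_pow_eq_zero (g : EvFun m n) : incl (nilPart g) ^ (n + 1) = 0 := by
  have h0 : Submodule.span ℝ {x : SFun (⊤ : Opens (E m)) n | ∃ f, ∃ a ∈ evenDeg n (n + 1),
      x = f ⊗ₜ (a ⊗ₜ (1 : Cl m n))} = ⊥ := by
    rw [Submodule.span_eq_bot]
    rintro _ ⟨f, a, ha, rfl⟩
    rw [evenDeg_eq_zero ha, TensorProduct.zero_tmul, TensorProduct.tmul_zero]
  have h1 := pow_mem_span_tmul (fun ha hb => evenDeg_mul ha hb) (nilPart_incl_mem g) n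
  rw [h0] at h1
  exact (Submodule.mem_bot ℝ).1 h1

theorem superDeltaPred_eq (k : ℕ) (g : EvFun m n) :
    superDeltaPred k g = ∑ j ∈ Finset.range (n + 1), ((j.factorial : ℝ)⁻¹) •
      funMulDist (incl (nilPart g) ^ j) (deltaPred₀ (k + j) (body g) ⊗ₜ 1) := by
  refine Finset.sum_congr rfl fun j _ => ?_
  change (j.factorial : ℝ)⁻¹ • funMulDist (incl (nilPart g ^ j)) _ = _
  rw [incl_pow]

theorem superDeltaPred_mem_evScalar (k : ℕ) (g : EvFun m n) :
    superDeltaPred k g ∈ evScalar m n 𝓓'((⊤ : Opens (E m)), ℝ) := by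
  rw [superDeltaPred_eq]
  refine Submodule.sum_mem _ fun j _ => Submodule.smul_mem _ _ ?_
  exact bmul_mem_evScalar (pow_mem_evScalar (incl_mem_evScalar _) j) (tmul_one_mem_evScalar _)

theorem superHeaviside_neg_eq (g : EvFun m n) :
    superHeaviside (-g) = ∑ j ∈ Finset.range (n + 1), ((j.factorial : ℝ)⁻¹ * (-1) ^ j) •
      funMulDist (incl (nilPart g) ^ j) (deltaPred₀ j (-body g) ⊗ₜ 1) := by
  rw [superHeaviside, superDeltaPred_eq]
  refine Finset.sum_congr rfl fun j _ => ?_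
  have h : incl (nilPart (-g)) ^ j =
      (-1 : ℝ) ^ j • (incl (nilPart g) : SFun (⊤ : Opens (E m)) n) ^ j := by
    rw [← smul_pow, neg_one_smul, nilPart_neg, incl_neg]
  rw [h, body_neg, zero_add, map_smul, LinearMap.smul_apply, smul_smul]

theorem superDelta_eq (g : EvFun m n) :
    superDelta g = ∑ j ∈ Finset.range (n + 1), (j.factorial : ℝ)⁻¹ •
      funMulDist (incl (nilPart g) ^ j) (deltaPred₀ (j + 1) (body g) ⊗ₜ 1) := by
  rw [superDelta, superDeltaPred_eq]
  refine Finset.sum_congr rfl fun j _ => ?_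
  rw [add_comm 1 j]

/-- Differentiating `𝐠ⁿ⁺¹ = 0` gives `∂_x[𝐠] 𝐠ⁿ = 0`. -/
theorem diracL_mul_nilPart_pow (g : EvFun m n) :
    sDiracL (incl (nilPart g)) * incl (nilPart g) ^ n =
      (0 : SFun (⊤ : Opens (E m)) n) := by
  have h1 := diracL_pow_succ (incl_mem_evScalar (nilPart g)) n
  rw [nilPart_pow_eq_zero, map_zero] at h1
  exact (smul_eq_zero.1 h1.symm).resolve_left (by positivity)

theorem diracL_deltaPred₀_neg {g₀ : Smooth (⊤ : Opens (E m))} (hg : IsRegular g₀) (j : ℕ) :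
    diracL distDeriv (deltaPred₀ j (-g₀) ⊗ₜ (1 : A m n)) =
      (-1 : ℝ) ^ (j + 1) •
        funMulDist (sDiracL (g₀ ⊗ₜ 1)) (deltaPred₀ (j + 1) g₀ ⊗ₜ 1) := by
  rw [diracL_dist_tmul_one fun i => hg.neg.distDeriv_deltaPred₀ i j, hg.deltaPred₀_neg,
    TensorProduct.neg_tmul, map_neg, map_neg, LinearMap.neg_apply, ← TensorProduct.smul_tmul',
    map_smul, pow_succ, mul_neg_one, neg_smul]

theorem deltaPred₀_neg_tmul_one {g₀ : Smooth (⊤ : Opens (E m))} (hg : IsRegular g₀) (j : ℕ) :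
    deltaPred₀ (j + 1) (-g₀) ⊗ₜ[ℝ] (1 : A m n) =
      (-1 : ℝ) ^ j • (deltaPred₀ (j + 1) g₀ ⊗ₜ[ℝ] (1 : A m n)) :=
  (congrArg (· ⊗ₜ[ℝ] (1 : A m n)) (hg.deltaPred₀_neg j)).trans
    (TensorProduct.smul_tmul' _ _ _).symm

/-- `∂_x[u^{j+1}] γ = (j + 1) ∂_x[u] u^j γ` for an even superfunction `u`. -/
theorem funMulDist_diracL_pow_succ {Ω : Opens (E m)} {u : SFun Ω n}
    (hu : u ∈ evScalar m n (Smooth Ω)) (j : ℕ) (γ : SDist Ω n) :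
    funMulDist (sDiracL (u ^ (j + 1))) γ =
      ((j : ℝ) + 1) • funMulDist (sDiracL u) (funMulDist (u ^ j) γ) := by
  rw [diracL_pow_succ hu, map_smul, LinearMap.smul_apply, funMulDist_mul]

theorem funMulDist_left_comm {Ω : Opens (E m)} {u : SFun Ω n}
    (hu : u ∈ evScalar m n (Smooth Ω)) (c : SFun Ω n) (γ : SDist Ω n) :
    funMulDist u (funMulDist c γ) = funMulDist c (funMulDist u γ) := by
  rw [← funMulDist_mul, ← SFun_mul_comm c hu, funMulDist_mul]

theorem funMulDist_diracL_nilPart_pow (g : EvFun m n) (γ : SDist (⊤ : Opens (E m)) n) :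
    funMulDist (sDiracL (incl (nilPart g)))
      (funMulDist (incl (nilPart g) ^ n) γ) = 0 := by
  rw [← funMulDist_mul, diracL_mul_nilPart_pow, map_zero, LinearMap.zero_apply]

/-- The identity `∂_x[H(-g)] = -∂_x[g] δ(g)`. -/
theorem diracL_superHeaviside_neg (g : EvFun m n) (hg : IsRegular (body g)) :
    diracL distDeriv (superHeaviside (-g)) =
      -funMulDist (sDiracL (incl g)) (superDelta g) := by
  have hu := incl_mem_evScalar (nilPart g)
  have h := map_taylor_sum (S := SFun (⊤ : Opens (E m)) n) (N := SDist (⊤ : Opens (E m)) n)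
    funMulDist sDiracL (diracL distDeriv)
    (fun j => incl (nilPart g) ^ j) (sDiracL (incl (nilPart g)))
    (sDiracL (body g ⊗ₜ 1)) (fun j => deltaPred₀ j (-body g) ⊗ₜ 1)
    (fun j => deltaPred₀ (j + 1) (body g) ⊗ₜ 1) n diracL_one
    (fun j x => funMulDist_diracL_pow_succ hu j x)
    (fun j x => diracL_funMulDist (pow_mem_evScalar hu j) x)
    (fun j x => funMulDist_left_comm (pow_mem_evScalar hu j) _ x)
    (fun j => deltaPred₀_neg_tmul_one hg j) (fun j => diracL_deltaPred₀_neg hg j)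
    (fun x => funMulDist_diracL_nilPart_pow g x)
  have hL : sDiracL (incl g) = sDiracL (incl (nilPart g)) +
      sDiracL (body g ⊗ₜ[ℝ] (1 : A m n)) := by rw [← map_add, ← incl_eq]
  rw [hL, superHeaviside_neg_eq, superDelta_eq]
  exact h

end Even

/-! ### Coefficients of tensors -/

section Coefficients

variable {B V W : Type*} [AddCommGroup B] [Module ℝ B] [AddCommGroup V] [Module ℝ V]
  [AddCommGroup W] [Module ℝ W]

/-- The coefficient in `V` of an element of `V ⊗ B` along a linear functional on `B`. -/
def coef (f : B →ₗ[ℝ] ℝ) : V ⊗[ℝ] B →ₗ[ℝ] V :=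
  (TensorProduct.rid ℝ V).toLinearMap ∘ₗ TensorProduct.map LinearMap.id f

theorem coef_tmul (f : B →ₗ[ℝ] ℝ) (v : V) (b : B) : coef f (v ⊗ₜ b) = f b • v :=
  TensorProduct.rid_tmul _ _

theorem coef_map (f : B →ₗ[ℝ] ℝ) (r : V →ₗ[ℝ] W) (x : V ⊗[ℝ] B) :
    coef f (TensorProduct.map r LinearMap.id x) = r (coef f x) := by
  induction x using TensorProduct.induction_on with
  | zero => simp only [map_zero]
  | add x y hx hy => simp only [map_add, hx, hy]
  | tmul v b => rw [TensorProduct.map_tmul, coef_tmul, coef_tmul, map_smul, LinearMap.id_apply]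

/-- Every tensor is the finite sum of its coefficients along a basis. -/
theorem exists_eq_sum_coef (x : V ⊗[ℝ] B) : ∃ (s : Finset (Module.Basis.ofVectorSpaceIndex ℝ B)),
    x = ∑ i ∈ s, coef ((Module.Basis.ofVectorSpace ℝ B).coord i) x ⊗ₜ
      Module.Basis.ofVectorSpace ℝ B i := by
  classical
  obtain ⟨c, rfl⟩ := TensorProduct.eq_repr_basis_right (Module.Basis.ofVectorSpace ℝ B) x
  refine ⟨c.support, ?_⟩
  rw [Finsupp.sum]
  refine Finset.sum_congr rfl fun i hi => ?_
  congr 1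
  rw [map_sum, Finset.sum_eq_single i]
  · rw [coef_tmul, Module.Basis.coord_apply, Module.Basis.repr_self, Finsupp.single_eq_same,
      one_smul]
  · intro j _ hj
    rw [coef_tmul, Module.Basis.coord_apply, Module.Basis.repr_self,
      Finsupp.single_eq_of_ne (Ne.symm hj), zero_smul]
  · exact fun h => absurd hi h

/-- Linear functionals on `B` separate the points of `V ⊗ B`. -/
theorem eq_of_coef {x y : V ⊗[ℝ] B} (h : ∀ f : B →ₗ[ℝ] ℝ, coef f x = coef f y) : x = y := by
  rw [← sub_eq_zero]
  obtain ⟨s, hs⟩ := exists_eq_sum_coef (x - y)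
  rw [hs]
  refine Finset.sum_eq_zero fun i _ => ?_
  rw [map_sub, h, sub_self, TensorProduct.zero_tmul]

theorem map_id_injective {r : V →ₗ[ℝ] W} (hr : Function.Injective r) :
    Function.Injective (TensorProduct.map r (LinearMap.id : B →ₗ[ℝ] B)) := fun x y h =>
  eq_of_coef fun f => hr (by rw [← coef_map, h, coef_map])

end Coefficients

/-! ### Locality of distributions with values in a vector space -/

section TensorDist

variable {m : ℕ} {Ω : Opens (E m)} {B C : Type*} [AddCommGroup B] [Module ℝ B]
  [AddCommGroup C] [Module ℝ C]

theorem tensorDist_eq_of_locally {γ γ' : 𝓓'(Ω, ℝ) ⊗[ℝ] B}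
    (h : ∀ x ∈ Ω, ∃ (U : Opens (E m)) (hU : U ≤ Ω), x ∈ U ∧
      TensorProduct.map (distRestrict hU) LinearMap.id γ =
        TensorProduct.map (distRestrict hU) LinearMap.id γ') : γ = γ' := by
  refine eq_of_coef fun f => dist_eq_of_locally fun x hx => ?_
  obtain ⟨U, hU, hxU, h⟩ := h x hx
  exact ⟨U, hU, hxU, by rw [← coef_map, h, coef_map]⟩

theorem exists_tensorSmooth_of_locally {γ : 𝓓'(Ω, ℝ) ⊗[ℝ] B}
    (h : ∀ x ∈ Ω, ∃ (U : Opens (E m)) (hU : U ≤ Ω) (f : Smooth U ⊗[ℝ] B), x ∈ U ∧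
      TensorProduct.map (distRestrict hU) LinearMap.id γ =
        TensorProduct.map ofSmooth LinearMap.id f) :
    ∃ f : Smooth Ω ⊗[ℝ] B, TensorProduct.map ofSmooth LinearMap.id f = γ := by
  have h' (f : B →ₗ[ℝ] ℝ) : ∃ F : Smooth Ω, ofSmooth F = coef f γ :=
    exists_ofSmooth_of_locally fun x hx => by
      obtain ⟨U, hU, F, hxU, h⟩ := h x hx
      exact ⟨U, hU, coef f F, hxU, by rw [← coef_map, h, coef_map]⟩
  choose F hF using h'
  obtain ⟨s, hs⟩ := exists_eq_sum_coef γ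
  refine ⟨∑ i ∈ s, F ((Module.Basis.ofVectorSpace ℝ B).coord i) ⊗ₜ
    Module.Basis.ofVectorSpace ℝ B i, ?_⟩
  rw [map_sum]
  refine Eq.trans (Finset.sum_congr rfl fun i _ => ?_) hs.symm
  rw [TensorProduct.map_tmul, hF, LinearMap.id_apply]

/-- Evaluation of a scalar distribution on a test function. -/
def distEval (φ : 𝓓(Ω, ℝ)) : 𝓓'(Ω, ℝ) →ₗ[ℝ] ℝ where
  toFun T := T φ
  map_add' _ _ := rfl
  map_smul' _ _ := rfl

/-- Coefficientwise evaluation on a real test function. -/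
def tensorEval (φ : 𝓓(Ω, ℝ)) : 𝓓'(Ω, ℝ) ⊗[ℝ] B →ₗ[ℝ] B :=
  (TensorProduct.lid ℝ B).toLinearMap ∘ₗ TensorProduct.map (distEval φ) LinearMap.id

theorem tensorEval_tmul (φ : 𝓓(Ω, ℝ)) (T : 𝓓'(Ω, ℝ)) (b : B) :
    tensorEval φ (T ⊗ₜ b) = T φ • b := rfl

theorem apply_tensorEval (f : B →ₗ[ℝ] ℝ) (φ : 𝓓(Ω, ℝ)) (γ : 𝓓'(Ω, ℝ) ⊗[ℝ] B) :
    f (tensorEval φ γ) = coef f γ φ := by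
  have h : f ∘ₗ tensorEval φ = distEval φ ∘ₗ coef f := TensorProduct.ext (by
    ext T b
    change f (tensorEval φ (T ⊗ₜ b)) = distEval φ (coef f (T ⊗ₜ b))
    rw [tensorEval_tmul, coef_tmul, map_smul, map_smul, smul_eq_mul, smul_eq_mul, mul_comm]
    rfl)
  exact LinearMap.congr_fun h γ

theorem map_tensorEval (f : B →ₗ[ℝ] C) (φ : 𝓓(Ω, ℝ)) (γ : 𝓓'(Ω, ℝ) ⊗[ℝ] B) :
    f (tensorEval φ γ) = tensorEval φ (TensorProduct.map LinearMap.id f γ) := by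
  have h : f ∘ₗ tensorEval φ = tensorEval φ ∘ₗ TensorProduct.map LinearMap.id f :=
    TensorProduct.ext (by
      ext T b
      change f (tensorEval φ (T ⊗ₜ b)) = tensorEval φ (TensorProduct.map LinearMap.id f (T ⊗ₜ b))
      rw [TensorProduct.map_tmul, tensorEval_tmul, tensorEval_tmul, map_smul, LinearMap.id_apply])
  exact LinearMap.congr_fun h γ

theorem tensorEval_distDeriv (j : Fin m) (φ : 𝓓(Ω, ℝ)) (γ : 𝓓'(Ω, ℝ) ⊗[ℝ] B) :
    tensorEval φ (TensorProduct.map (distDeriv j) LinearMap.id γ) =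
      -tensorEval (tderiv j φ) γ := by
  have h : tensorEval φ ∘ₗ TensorProduct.map (distDeriv j) LinearMap.id =
      -(tensorEval (tderiv j φ) : 𝓓'(Ω, ℝ) ⊗[ℝ] B →ₗ[ℝ] B) :=
    TensorProduct.ext (by
      ext T b
      change tensorEval φ (TensorProduct.map (distDeriv j) LinearMap.id (T ⊗ₜ b)) =
        -tensorEval (tderiv j φ) (T ⊗ₜ b)
      rw [TensorProduct.map_tmul, tensorEval_tmul, tensorEval_tmul, distDeriv_apply,
        LinearMap.id_apply, neg_smul])
  exact LinearMap.congr_fun h γ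

/-- A distribution vanishing on `W` does not see test functions supported in `W`. -/
theorem tensorEval_eq_zero_of_restrict {W : Opens (E m)} (hW : W ≤ Ω) {γ : 𝓓'(Ω, ℝ) ⊗[ℝ] B}
    (h : TensorProduct.map (distRestrict hW) LinearMap.id γ = 0) (φ : 𝓓(Ω, ℝ))
    (hφ : tsupport φ ⊆ W) : tensorEval φ γ = 0 := by
  refine (Module.forall_dual_apply_eq_zero_iff ℝ _).1 fun f => ?_
  rw [apply_tensorEval]
  exact isVanishingOn_of_distRestrict_eq_zero hW (by rw [← coef_map, h, map_zero]) φ hφ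

/-- The value of a distribution depends only on the test function near the support. -/
theorem tensorEval_congr (γ : 𝓓'(Ω, ℝ) ⊗[ℝ] B) {φ ψ : 𝓓(Ω, ℝ)}
    (h : ∀ᶠ x in 𝓝ˢ (Distribution.dsupport fun φ : 𝓓(Ω, ℝ) => tensorEval φ γ), φ x = ψ x) :
    tensorEval φ γ = tensorEval ψ γ := by
  rw [← sub_eq_zero]
  refine (Module.forall_dual_apply_eq_zero_iff ℝ _).1 fun f => ?_
  rw [map_sub, apply_tensorEval, apply_tensorEval, ← map_sub]
  refine apply_eq_zero_of_locally
    ((coef f γ : 𝓓'(Ω, ℝ)) : 𝓓(Ω, ℝ) →L[ℝ] ℝ).toLinearMap (φ - ψ) fun x hx => ?_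
  have hx' : x ∉ Distribution.dsupport fun φ : 𝓓(Ω, ℝ) => tensorEval φ γ := fun hx' => by
    refine notMem_tsupport_iff_eventuallyEq.2 ?_ hx
    filter_upwards [h.filter_mono (nhds_le_nhdsSet hx')] with y hy
    rw [sub_apply, hy, sub_self]
    rfl
  obtain ⟨s, hs, hso, hxs⟩ := (Distribution.notMem_dsupport_iff x).1 hx'
  refine ⟨s, hso, hxs, fun u hu => ?_⟩
  have h0 : tensorEval u γ = 0 := hs u hu
  change coef f γ u = 0
  rw [← apply_tensorEval, h0, map_zero]

theorem dsupport_tensorEval_subset {K : Set (E m)} (hK : IsClosed K) {W : Opens (E m)}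
    (hW : W ≤ Ω) (hWK : ∀ x ∈ Ω, x ∉ K → x ∈ W) {γ : 𝓓'(Ω, ℝ) ⊗[ℝ] B}
    (h : TensorProduct.map (distRestrict hW) LinearMap.id γ = 0) :
    Distribution.dsupport (fun φ : 𝓓(Ω, ℝ) => tensorEval φ γ) ⊆ K := by
  intro x hx
  by_contra hxK
  refine (Distribution.notMem_dsupport_iff x).2 ⟨Kᶜ, fun φ hφ => ?_, hK.isOpen_compl, hxK⟩ hx
  exact tensorEval_eq_zero_of_restrict hW h φ fun y hy => hWK y (φ.tsupport_subset hy) (hφ hy)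

theorem exists_testFunction_eq_one {K : Set (E m)} (hK : IsCompact K) (hKΩ : K ⊆ Ω) :
    ∃ χ : 𝓓(Ω, ℝ), ∀ᶠ x in 𝓝ˢ K, χ x = 1 := by
  obtain ⟨L, hL, hKL, hLΩ⟩ := exists_compact_between hK Ω.isOpen hKΩ
  obtain ⟨χ, h0, h1, -⟩ := exists_contMDiffMap_zero_one_nhds_of_isClosed
    (modelWithCornersSelf ℝ (E m)) (n := ⊤) (s := (interior L)ᶜ) (t := K)
    isOpen_interior.isClosed_compl hK.isClosed
    (Set.disjoint_left.2 fun x hx hk => hx (hKL hk))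
  have hs : tsupport χ ⊆ L := by
    refine (closure_mono fun x hx => ?_).trans hL.isClosed.closure_subset
    by_contra hxL
    have hx' : x ∈ (interior L)ᶜ := fun h => hxL (interior_subset h)
    exact hx (h0.filter_mono (nhds_le_nhdsSet hx')).self_of_nhds
  exact ⟨⟨χ, χ.contMDiff.contDiff, hL.of_isClosed_subset (isClosed_tsupport _) hs,
    hs.trans hLΩ⟩, h1⟩

end TensorDist

/-! ### Restriction and integration of superdistributions -/

section Restrict

variable {m n : ℕ} {Ω Ω₁ Ω₂ : Opens (E m)}

theorem restrict_funMulDist (h : Ω ≤ Ω₁) (F : SFun Ω₁ n) (γ : SDist Ω₁ n) :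
    SDist.restrict h (funMulDist F γ) = funMulDist (SFun.restrict h F) (SDist.restrict h γ) :=
  map_bmul (distRestrict_smulDist h) F γ

theorem restrict_distMulFun (h : Ω ≤ Ω₁) (γ : SDist Ω₁ n) (F : SFun Ω₁ n) :
    SDist.restrict h (distMulFun γ F) = distMulFun (SDist.restrict h γ) (SFun.restrict h F) :=
  map_bmul (fun T f => distRestrict_smulDist h f T) γ F

theorem restrict_diracR (h : Ω ≤ Ω₁) (γ : SDist Ω₁ n) :
    SDist.restrict h (diracR distDeriv γ) = diracR distDeriv (SDist.restrict h γ) :=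
  map_diracR (distRestrict_distDeriv h) γ

theorem restrict_restrict (h : Ω ≤ Ω₁) (h' : Ω₁ ≤ Ω₂) (γ : SDist Ω₂ n) :
    SDist.restrict h (SDist.restrict h' γ) = SDist.restrict (h.trans h') γ :=
  eq_of_coef fun f => by
    rw [SDist.restrict, SDist.restrict, SDist.restrict, coef_map, coef_map, coef_map,
      distRestrict_distRestrict]

theorem restrict_mem_evScalar (h : Ω ≤ Ω₁) {γ : SDist Ω₁ n}
    (hγ : γ ∈ evScalar m n 𝓓'(Ω₁, ℝ)) : SDist.restrict h γ ∈ evScalar m n 𝓓'(Ω, ℝ) :=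
  map_mem_evScalar _ hγ

theorem restrict_toDist (h : Ω ≤ Ω₁) (F : SFun Ω₁ n) :
    SDist.restrict h F.toDist = (SFun.restrict h F).toDist :=
  eq_of_coef fun f => by
    rw [SDist.restrict, SFun.restrict, SFun.toDist, SFun.toDist, coef_map, coef_map, coef_map,
      coef_map, distRestrict_ofSmooth]
    rfl

theorem toDist_injective : Function.Injective (SFun.toDist (Ω := Ω) (n := n)) :=
  map_id_injective ofSmooth_injective

theorem funMulDist_toDist (F G : SFun Ω n) : funMulDist F G.toDist = (F * G : SFun Ω n).toDist := by
  have h := map_bmul (μ := LinearMap.mul ℝ (Smooth Ω)) (μ' := smulDist) (r := ofSmooth)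
    (r₁ := LinearMap.id) (r₂ := ofSmooth) (fun f g => (smulDist_ofSmooth f g).symm) F G
  rw [TensorProduct.map_id, LinearMap.id_apply] at h
  rw [SFun_mul_eq]
  exact h.symm

theorem distMulFun_toDist (F G : SFun Ω n) : distMulFun F.toDist G = (F * G : SFun Ω n).toDist := by
  have h := map_bmul (μ := LinearMap.mul ℝ (Smooth Ω)) (μ' := smulDist.flip) (r := ofSmooth)
    (r₁ := ofSmooth) (r₂ := LinearMap.id) (fun f g =>
      (congrArg ofSmooth (mul_comm f g)).trans (smulDist_ofSmooth g f).symm) F G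
  rw [TensorProduct.map_id, LinearMap.id_apply] at h
  rw [SFun_mul_eq]
  exact h.symm

theorem diracR_toDist (F : SFun Ω n) :
    diracR distDeriv F.toDist = SFun.toDist (sDiracR F) :=
  (map_diracR (fun j f => (distDeriv_ofSmooth j f).symm) F).symm

theorem one_funMulDist (γ : SDist Ω n) : funMulDist (1 : SFun Ω n) γ = γ :=
  one_bmul smulDist_one γ

theorem eval_eq_tensorEval (γ : SDist Ω n) (φ : 𝓓(Ω, ℝ)) : γ.eval φ = tensorEval φ γ := by
  induction γ using TensorProduct.induction_on with
  | zero => rw [map_zero]; exact map_zero _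
  | add x y hx hy => rw [map_add, ← hx, ← hy]; exact map_add _ _ _
  | tmul T a => exact (TensorProduct.lift.tmul _ _).trans (tensorEval_tmul φ T a).symm

theorem supp_eq (γ : SDist Ω n) :
    γ.supp = Distribution.dsupport fun φ : 𝓓(Ω, ℝ) => tensorEval φ γ :=
  congrArg Distribution.dsupport (funext fun φ => eval_eq_tensorEval γ φ)

/-- The integral may be computed with any cutoff equal to `1` near a set containing the support. -/
theorem superIntegral_eq {γ : SDist Ω n} {K : Set (E m)} (hK : γ.supp ⊆ K) {χ : 𝓓(Ω, ℝ)}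
    (hχ : ∀ᶠ x in 𝓝ˢ K, χ x = 1) : superIntegral γ = berezin m n (tensorEval χ γ) := by
  have h1 : ∀ᶠ x in 𝓝ˢ γ.supp, χ x = 1 := hχ.filter_mono (nhdsSet_mono hK)
  have h : ∃ χ : 𝓓(Ω, ℝ), ∀ᶠ x in 𝓝ˢ γ.supp, χ x = 1 := ⟨χ, h1⟩
  rw [superIntegral, dif_pos h, eval_eq_tensorEval]
  congr 1
  refine tensorEval_congr γ ?_
  rw [← supp_eq]
  filter_upwards [h.choose_spec, h1] with x hx hx'
  rw [hx, hx']

/-- The integral of `(P ∂_x) G + P (∂_x G)` vanishes: fermionic derivatives are killed by the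
Berezin integral, and bosonic ones by a cutoff that is constant near the support of `P`. -/
theorem berezin_tensorEval_diracR_add {W : Opens (E m)} (hW : W ≤ Ω) {P : SDist Ω n}
    (hP : SDist.restrict hW P = 0) (G : SFun Ω n) {χ : 𝓓(Ω, ℝ)}
    (hχ : ∀ j, tsupport (tderiv j χ) ⊆ W) :
    berezin m n (tensorEval χ (distMulFun (diracR distDeriv P) G +
      distMulFun P (sDiracL G))) = 0 := by
  have h := berezin_diracR_bmul_add (μ := smulDist.flip) (dU := distDeriv) (dV := pderiv)
    (dW := distDeriv) (fun j T f => (distDeriv_smulDist j f T).trans (add_comm _ _)) P G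
  rw [map_tensorEval]
  refine (congrArg (tensorEval χ) h).trans ?_
  rw [map_neg, map_sum, neg_eq_zero]
  refine Finset.sum_eq_zero fun j _ => ?_
  rw [← map_tensorEval, tensorEval_distDeriv, tensorEval_eq_zero_of_restrict hW ?_ _ (hχ j), neg_zero,
    map_zero]
  have h0 : TensorProduct.map (distRestrict hW) LinearMap.id (TensorProduct.map LinearMap.id
      (TensorProduct.map LinearMap.id (LinearMap.mulRight ℝ (e j))) P) =
      TensorProduct.map LinearMap.id
        (TensorProduct.map LinearMap.id (LinearMap.mulRight ℝ (e j)))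
        (SDist.restrict hW P) := by
    rw [SDist.restrict, ← LinearMap.comp_apply, ← LinearMap.comp_apply, ← TensorProduct.map_comp,
      ← TensorProduct.map_comp, LinearMap.comp_id, LinearMap.id_comp, LinearMap.comp_id,
      LinearMap.id_comp]
  rw [map_bmul (μ' := smulDist.flip) (r₁ := distRestrict hW)
    (r₂ := (Smooth.restrict hW).toLinearMap) (fun T f => distRestrict_smulDist hW f T), h0, hP,
    map_zero, map_zero, LinearMap.zero_apply]

/-- Two superdistributions that differ by `(P ∂_x) G + P (∂_x G)`, where everything is supported
in the compact set `K ⊆ Ω`, have the same integral. -/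
theorem superIntegralEq_of_eq_add {K : Set (E m)} (hK : IsCompact K) (hKΩ : K ⊆ Ω)
    {W : Opens (E m)} (hW : W ≤ Ω) (hWK : ∀ x ∈ Ω, x ∉ K → x ∈ W) {γ γ' P : SDist Ω n}
    (hγ : SDist.restrict hW γ = 0) (hγ' : SDist.restrict hW γ' = 0)
    (hP : SDist.restrict hW P = 0) (G : SFun Ω n)
    (h : γ = γ' + (distMulFun (diracR distDeriv P) G + distMulFun P (sDiracL G))) :
    SuperIntegralEq γ γ' := by
  obtain ⟨χ, hχ⟩ := exists_testFunction_eq_one hK hKΩ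
  have hsupp {γ : SDist Ω n} (hγ : SDist.restrict hW γ = 0) : γ.supp ⊆ K := by
    rw [supp_eq]
    exact dsupport_tensorEval_subset hK.isClosed hW hWK hγ
  have hc {γ : SDist Ω n} (hγ : SDist.restrict hW γ = 0) : γ.HasCompactSupp :=
    ⟨hK.of_isClosed_subset Distribution.isClosed_dsupport (hsupp hγ), (hsupp hγ).trans hKΩ⟩
  have hd (j : Fin m) : tsupport (tderiv j χ) ⊆ W := fun x hx => by
    refine hWK x ((tderiv j χ).tsupport_subset hx) fun hxK => ?_
    refine notMem_tsupport_iff_eventuallyEq.2 ?_ hx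
    have h1 : χ =ᶠ[𝓝 x] fun _ => (1 : ℝ) := hχ.filter_mono (nhds_le_nhdsSet hxK)
    filter_upwards [h1.eventuallyEq_nhds] with y hy
    rw [tderiv_apply, hy.fderiv_eq]
    simp
  refine ⟨hc hγ, hc hγ', ?_⟩
  rw [superIntegral_eq (hsupp hγ) hχ, superIntegral_eq (hsupp hγ') hχ, h, map_add, map_add,
    berezin_tensorEval_diracR_add hW hP G hd, add_zero]

end Restrict

/-! ### Supports of `H(-g)` and `δ(g)` -/

section Supports

variable {m n : ℕ} {U : Opens (E m)}

theorem toDist_zero : (0 : SFun U n).toDist = 0 := map_zero _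

theorem zero_funMulDist (γ : SDist U n) : funMulDist (0 : SFun U n) γ = 0 := by
  rw [map_zero, LinearMap.zero_apply]

theorem restrict_tmul_one_eq_zero {Ω : Opens (E m)} (hU : U ≤ Ω) {T : 𝓓'(Ω, ℝ)} {s : Set (E m)}
    (h : Distribution.IsVanishingOn T s) (hs : (U : Set (E m)) ⊆ s) :
    SDist.restrict hU (T ⊗ₜ (1 : A m n)) = 0 := by
  rw [SDist.restrict, TensorProduct.map_tmul, distRestrict_eq_zero hU (h.mono hs),
    TensorProduct.zero_tmul]

theorem restrict_superDelta_eq_zero {g : EvFun m n} (hg : IsRegular (body g)) (hU : U ≤ ⊤)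
    (h : ∀ x ∈ U, ext0 (body g).1 x ≠ 0) : SDist.restrict hU (superDelta g) = 0 := by
  rw [superDelta_eq, map_sum]
  refine Finset.sum_eq_zero fun j _ => ?_
  rw [map_smul, restrict_funMulDist, restrict_tmul_one_eq_zero hU (hg.isVanishingOn_deltaPred₀ j) h,
    map_zero, smul_zero]

theorem restrict_deltaPred₀_neg_succ {g₀ : Smooth (⊤ : Opens (E m))} (hg : IsRegular g₀)
    (hU : U ≤ ⊤) (h : ∀ x ∈ U, ext0 g₀.1 x ≠ 0) (j : ℕ) :
    SDist.restrict hU (deltaPred₀ (j + 1) (-g₀) ⊗ₜ (1 : A m n)) = 0 :=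
  restrict_tmul_one_eq_zero hU (hg.neg.isVanishingOn_deltaPred₀ j) fun x hx => by
    rw [Set.mem_ofPred_eq, ext0_neg, neg_ne_zero]
    exact h x hx

theorem restrict_superHeaviside_neg {g : EvFun m n} (hg : IsRegular (body g)) (hU : U ≤ ⊤)
    (h : ∀ x ∈ U, ext0 (body g).1 x ≠ 0) :
    SDist.restrict hU (superHeaviside (-g)) =
      SDist.restrict hU (heaviside₀ (-body g) ⊗ₜ (1 : A m n)) := by
  rw [superHeaviside_neg_eq, map_sum, Finset.sum_range_succ', Finset.sum_eq_zero, zero_add,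
    map_smul, pow_zero, pow_zero, Nat.factorial_zero, Nat.cast_one, inv_one, mul_one, one_smul,
    one_funMulDist]
  · rfl
  · intro j _
    rw [map_smul, restrict_funMulDist, restrict_deltaPred₀_neg_succ hg hU h, map_zero, smul_zero]

theorem restrict_superHeaviside_neg_of_pos {g : EvFun m n} (hg : IsRegular (body g)) (hU : U ≤ ⊤)
    (h : ∀ x ∈ U, 0 < ext0 (body g).1 x) : SDist.restrict hU (superHeaviside (-g)) = 0 := by
  rw [restrict_superHeaviside_neg hg hU fun x hx => (h x hx).ne']
  exact restrict_tmul_one_eq_zero hU isVanishingOn_heaviside₀_neg h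

theorem restrict_superHeaviside_neg_of_neg {g : EvFun m n} (hg : IsRegular (body g)) (hU : U ≤ ⊤)
    (h : ∀ x ∈ U, ext0 (body g).1 x < 0) :
    SDist.restrict hU (superHeaviside (-g)) = (1 : SFun U n).toDist := by
  have h1 : distRestrict hU (heaviside₀ (-body g)) = ofSmooth (1 : Smooth U) := by
    rw [ofSmooth_eq, smulDist_one, ← distRestrict_lebesgueDist hU, ← sub_eq_zero, ← map_sub]
    exact distRestrict_eq_zero hU (isVanishingOn_heaviside₀_neg_sub.mono h)
  rw [restrict_superHeaviside_neg hg hU fun x hx => (h x hx).ne, SDist.restrict,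
    TensorProduct.map_tmul, h1]
  rfl

/-- Away from the zero set of `g₀`, the distribution `δ(g)` vanishes and `H(-g)` is a constant. -/
theorem exists_restrict_superHeaviside {g : EvFun m n} (hg : IsRegular (body g)) {x : E m}
    (hx : ext0 (body g).1 x ≠ 0) :
    ∃ (U : Opens (E m)) (hU : U ≤ ⊤) (c : SFun U n), x ∈ U ∧
      SDist.restrict hU (superHeaviside (-g)) = c.toDist ∧
      SDist.restrict hU (superDelta g) = 0 ∧
      ∀ γ : SDist U n, diracR distDeriv (funMulDist c γ) = funMulDist c (diracR distDeriv γ) := by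
  have hc : Continuous (ext0 (body g).1) := (Smooth.contDiff (body g)).continuous
  rcases lt_or_gt_of_ne hx with hx | hx
  · obtain ⟨U, hxU, hU⟩ : ∃ U : Opens (E m), x ∈ U ∧ ∀ y ∈ U, ext0 (body g).1 y < 0 :=
      ⟨⟨{x | ext0 (body g).1 x < 0}, isOpen_lt hc continuous_const⟩, hx, fun y hy => hy⟩
    refine ⟨U, le_top, (1 : SFun U n), hxU, restrict_superHeaviside_neg_of_neg hg _ hU,
      restrict_superDelta_eq_zero hg _ fun y hy => (hU y hy).ne, fun γ => ?_⟩
    rw [one_funMulDist, one_funMulDist]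
  · obtain ⟨U, hxU, hU⟩ : ∃ U : Opens (E m), x ∈ U ∧ ∀ y ∈ U, 0 < ext0 (body g).1 y :=
      ⟨⟨{x | 0 < ext0 (body g).1 x}, isOpen_lt continuous_const hc⟩, hx, fun y hy => hy⟩
    refine ⟨U, le_top, (0 : SFun U n), hxU,
      (restrict_superHeaviside_neg_of_pos hg _ hU).trans toDist_zero.symm,
      restrict_superDelta_eq_zero hg _ fun y hy => (hU y hy).ne', fun γ => ?_⟩
    rw [zero_funMulDist, zero_funMulDist, map_zero]

end Supports

/-! ### Products of superdistributions with disjoint singular supports -/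

section Products

variable {m n : ℕ} {Ω : Opens (E m)}

theorem notMem_singSupp_iff {γ : SDist Ω n} {x : E m} : x ∉ γ.singSupp ↔
    ∃ (U : Opens (E m)) (hU : U ≤ Ω) (f : SFun U n), x ∈ U ∧ γ.restrict hU = f.toDist :=
  not_not

theorem isClosed_singSupp (γ : SDist Ω n) : IsClosed γ.singSupp := by
  rw [← isOpen_compl_iff, isOpen_iff_mem_nhds]
  intro x hx
  obtain ⟨U, hU, f, hxU, hf⟩ := notMem_singSupp_iff.1 hx
  filter_upwards [U.isOpen.mem_nhds hxU] with y hy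
  exact notMem_singSupp_iff.2 ⟨U, hU, f, hy, hf⟩

theorem singSupp_diracR_subset (γ : SDist Ω n) : SDist.singSupp (diracR distDeriv γ) ⊆ γ.singSupp := by
  intro x hx
  by_contra hx'
  obtain ⟨U, hU, f, hxU, hf⟩ := notMem_singSupp_iff.1 hx'
  refine notMem_singSupp_iff.2 ⟨U, hU, sDiracR f, hxU, ?_⟩ hx
  rw [restrict_diracR, hf, diracR_toDist]

/-- `χ γ` is smooth if `χ` vanishes near the singular support of `γ`. -/
theorem exists_toDist_eq_funMulDist {χ : Smooth Ω} {γ : SDist Ω n}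
    (h : ∀ᶠ x in 𝓝ˢ γ.singSupp, ext0 χ.1 x = 0) :
    ∃ f : SFun Ω n, f.toDist = funMulDist (χ ⊗ₜ 1) γ := by
  refine exists_tensorSmooth_of_locally fun x hx => ?_
  by_cases hxs : x ∈ γ.singSupp
  · obtain ⟨s, hs, hso, hxs⟩ := eventually_nhds_iff.1 (h.filter_mono (nhds_le_nhdsSet hxs))
    refine ⟨⟨s, hso⟩ ⊓ Ω, inf_le_right, 0, ⟨hxs, hx⟩, ?_⟩
    have h0 : Smooth.restrict (inf_le_right : ⟨s, hso⟩ ⊓ Ω ≤ Ω) χ = 0 :=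
      Smooth.ext_of_ext0 fun y hy => by
        rw [ext0_restrict _ _ hy, hs y hy.1, ext0_of_mem _ hy]
        rfl
    refine (restrict_funMulDist inf_le_right _ γ).trans ?_
    rw [SFun.restrict, TensorProduct.map_tmul, AlgHom.toLinearMap_apply, h0,
      TensorProduct.zero_tmul, map_zero, LinearMap.zero_apply, map_zero]
  · obtain ⟨U, hU, f, hxU, hf⟩ := notMem_singSupp_iff.1 hxs
    refine ⟨U, hU, SFun.restrict hU (χ ⊗ₜ 1) * f, hxU, ?_⟩
    refine (restrict_funMulDist hU _ γ).trans ?_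
    rw [hf, funMulDist_toDist]
    rfl

theorem mulDefined_of_disjoint {α γ : SDist (⊤ : Opens (E m)) n}
    (h : Disjoint α.singSupp γ.singSupp) : MulDefined α γ := by
  obtain ⟨χ, h0, h1, -⟩ := exists_contMDiffMap_zero_one_nhds_of_isClosed
    (modelWithCornersSelf ℝ (E m)) (n := ⊤) (isClosed_singSupp γ) (isClosed_singSupp α) h.symm
  let D : Smooth (⊤ : Opens (E m)) := Smooth.ofContDiff ⊤ χ χ.contMDiff.contDiff
  have hD (x : E m) : ext0 D.1 x = χ x := ext0_ofContDiff _ trivial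
  have hD0 : ∀ᶠ x in 𝓝ˢ γ.singSupp, ext0 D.1 x = 0 := h0.mono fun x hx => (hD x).trans hx
  have hD1 : ∀ᶠ x in 𝓝ˢ α.singSupp, ext0 D.1 x = 1 := h1.mono fun x hx => (hD x).trans hx
  have hD1' : ∀ᶠ x in 𝓝ˢ α.singSupp, ext0 (1 - D).1 x = 0 := hD1.mono fun x hx => by
    rw [ext0_sub, hx, ext0_one (Ω := ⊤) trivial, sub_self]
  obtain ⟨p, hp⟩ := exists_toDist_eq_funMulDist hD0
  obtain ⟨q, hq⟩ := exists_toDist_eq_funMulDist hD1'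
  exact ⟨(D, p, q), hD0, hD1, hp, hq⟩

/-- Scalar functions commute with superdistributions. -/
theorem funMulDist_tmul_one (χ : Smooth Ω) (γ : SDist Ω n) :
    funMulDist (χ ⊗ₜ 1) γ = distMulFun γ (χ ⊗ₜ 1) :=
  (bmul_comm_of_evScalar smulDist.flip γ (tmul_one_mem_evScalar χ)).symm

theorem cutoff_add_cutoff (χ : Smooth Ω) (γ : SDist Ω n) :
    funMulDist (χ ⊗ₜ 1) γ + funMulDist ((1 - χ) ⊗ₜ 1) γ = γ := by
  rw [← LinearMap.add_apply, ← map_add, ← TensorProduct.add_tmul, add_sub_cancel]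
  exact one_funMulDist γ

theorem distMulDist_eq {α γ : SDist (⊤ : Opens (E m)) n} (h : MulDefined α γ) :
    ∃ D, IsMulData α γ D ∧
      distMulDist α γ = distMulFun α D.2.1 + funMulDist D.2.2 γ :=
  ⟨h.choose, h.choose_spec, by rw [distMulDist, dif_pos h]⟩

/-- Where the right factor is smooth, the product of superdistributions is the product with a
superfunction. -/
theorem restrict_distMulDist_right {U : Opens (E m)} (hU : U ≤ ⊤)
    {α γ : SDist (⊤ : Opens (E m)) n} (h : MulDefined α γ) {c : SFun U n}
    (hc : SDist.restrict hU γ = c.toDist) :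
    SDist.restrict hU (distMulDist α γ) = distMulFun (SDist.restrict hU α) c := by
  obtain ⟨⟨χ, p, q⟩, ⟨-, -, hp, hq⟩, hD⟩ := distMulDist_eq h
  have hp' : SFun.restrict hU p = Smooth.restrict hU χ ⊗ₜ 1 * c := toDist_injective (by
    rw [← restrict_toDist, hp, restrict_funMulDist, hc, funMulDist_toDist]
    rfl)
  have hq' : (SFun.restrict hU q).toDist =
      funMulDist ((1 - Smooth.restrict hU χ) ⊗ₜ 1) (SDist.restrict hU α) := by
    rw [← restrict_toDist, hq, restrict_funMulDist]
    rfl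
  have hqc : funMulDist (SFun.restrict hU q) c.toDist =
      distMulFun (SFun.restrict hU q).toDist c := by
    rw [funMulDist_toDist, distMulFun_toDist]
  rw [hD, map_add, restrict_distMulFun, restrict_funMulDist, hc, hp', distMulFun_mul, hqc, hq',
    ← funMulDist_tmul_one, ← LinearMap.add_apply, ← map_add, cutoff_add_cutoff]

/-- Where the left factor is smooth, the product of superdistributions is the product with a
superfunction. -/
theorem restrict_distMulDist_left {U : Opens (E m)} (hU : U ≤ ⊤)
    {α γ : SDist (⊤ : Opens (E m)) n} (h : MulDefined α γ) {a : SFun U n}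
    (ha : SDist.restrict hU α = a.toDist) :
    SDist.restrict hU (distMulDist α γ) = funMulDist a (SDist.restrict hU γ) := by
  obtain ⟨⟨χ, p, q⟩, ⟨-, -, hp, hq⟩, hD⟩ := distMulDist_eq h
  have hp' : (SFun.restrict hU p).toDist =
      funMulDist (Smooth.restrict hU χ ⊗ₜ 1) (SDist.restrict hU γ) := by
    rw [← restrict_toDist, hp, restrict_funMulDist]
    rfl
  have hq' : SFun.restrict hU q = a * (1 - Smooth.restrict hU χ) ⊗ₜ 1 := toDist_injective (by
    rw [← restrict_toDist, hq, restrict_funMulDist, ha, ← distMulFun_toDist, ← funMulDist_tmul_one]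
    rfl)
  have hpa : distMulFun a.toDist (SFun.restrict hU p) =
      funMulDist a (SFun.restrict hU p).toDist := by
    rw [funMulDist_toDist, distMulFun_toDist]
  rw [hD, map_add, restrict_distMulFun, restrict_funMulDist, ha, hq', funMulDist_mul, hpa, hp',
    ← map_add, cutoff_add_cutoff]

end Products

/-! ### The Stokes formulas -/

section Stokes

variable {m n : ℕ}

theorem superDelta_mem_evScalar (g : EvFun m n) :
    superDelta g ∈ evScalar m n 𝓓'((⊤ : Opens (E m)), ℝ) := superDeltaPred_mem_evScalar 1 g

theorem superHeaviside_mem_evScalar (g : EvFun m n) :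
    superHeaviside g ∈ evScalar m n 𝓓'((⊤ : Opens (E m)), ℝ) := superDeltaPred_mem_evScalar 0 g

theorem diracR_superHeaviside_neg {g : EvFun m n} (hg : IsRegular (body g)) :
    diracR distDeriv (superHeaviside (-g)) =
      -distMulFun (superDelta g) (sDiracL (incl g)) := by
  rw [diracR_eq_diracL_of_evScalar distDeriv (superHeaviside_mem_evScalar (-g)),
    diracL_superHeaviside_neg g hg, funMulDist_comm _ (superDelta_mem_evScalar g)]

/-- The right Leibniz rule for `F α`, where `α` is a restriction of an even scalar distribution
with `α ∂_x = -δ D`. -/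
theorem diracR_funMulDist_restrict {Ω : Opens (E m)} (hΩ : Ω ≤ ⊤)
    {α δ : SDist (⊤ : Opens (E m)) n} {D : SFun (⊤ : Opens (E m)) n}
    (hα : α ∈ evScalar m n 𝓓'((⊤ : Opens (E m)), ℝ)) (h : diracR distDeriv α = -distMulFun δ D)
    (F : SFun Ω n) :
    diracR distDeriv (funMulDist F (SDist.restrict hΩ α)) =
      distMulFun (SDist.restrict hΩ α) (sDiracR F) -
        distMulFun (funMulDist F (SDist.restrict hΩ δ)) (SFun.restrict hΩ D) := by
  have hα' := restrict_mem_evScalar hΩ hα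
  rw [diracR_funMulDist F hα', ← restrict_diracR, h, map_neg, restrict_distMulFun, map_neg,
    funMulDist_comm _ hα', funMulDist_distMulFun, sub_eq_add_neg]

/-- If `P ∂_x = Q - R D`, then `Q G + P (∂_x G)` and `R D G` differ by `(P ∂_x) G + P (∂_x G)`,
whose integral vanishes. -/
theorem distMulFun_add_eq_of_diracR {Ω : Opens (E m)} {P Q R : SDist Ω n} {D : SFun Ω n}
    (h : diracR distDeriv P = Q - distMulFun R D) (G : SFun Ω n) :
    distMulFun Q G + distMulFun P (sDiracL G) =
      distMulFun (distMulFun R D) G +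
        (distMulFun (diracR distDeriv P) G + distMulFun P (sDiracL G)) := by
  rw [h, map_sub, LinearMap.sub_apply, ← add_assoc, add_sub_cancel]

/-- The case `P = F α`, `Q = α (F ∂_x)` of `distMulFun_add_eq_of_diracR`. -/
theorem distMulFun_add_eq {Ω : Opens (E m)} {α R : SDist Ω n} {D F : SFun Ω n}
    (hα : α ∈ evScalar m n 𝓓'(Ω, ℝ))
    (h : diracR distDeriv (funMulDist F α) = distMulFun α (sDiracR F) - distMulFun R D)
    (G : SFun Ω n) :
    distMulFun α (sDiracR F * G + F * sDiracL G) =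
      distMulFun (distMulFun R D) G +
        (distMulFun (diracR distDeriv (funMulDist F α)) G +
          distMulFun (funMulDist F α) (sDiracL G)) := by
  rw [← distMulFun_add_eq_of_diracR h, map_add, distMulFun_mul, distMulFun_mul,
    funMulDist_comm F hα]

/-- The set where `g₀ > 0` in `Ω`: all superdistributions in the Stokes formulas vanish there. -/
theorem exists_positive_part (g₀ : Smooth (⊤ : Opens (E m))) (Ω : Opens (E m)) :
    ∃ (W : Opens (E m)) (_ : W ≤ Ω), (∀ x ∈ W, 0 < ext0 g₀.1 x) ∧
      ∀ x ∈ Ω, x ∉ {x : E m | ext0 g₀.1 x ≤ 0} → x ∈ W := by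
  have hc : Continuous (ext0 g₀.1) := (Smooth.contDiff g₀).continuous
  refine ⟨⟨{x | 0 < ext0 g₀.1 x}, isOpen_lt continuous_const hc⟩ ⊓ Ω, inf_le_right,
    fun x hx => hx.1, fun x hx hxK => ⟨?_, hx⟩⟩
  rw [Set.mem_ofPred_eq, not_le] at hxK
  exact hxK

/-- The Stokes formula for superfunctions `F` and `G`. -/
theorem superIntegralEq_superHeaviside {g : EvFun m n}
    (hcpt : IsCompact {x : E m | ext0 (body g).1 x ≤ 0}) (hg : IsRegular (body g))
    {Ω : Opens (E m)} (hΩ : {x : E m | ext0 (body g).1 x ≤ 0} ⊆ Ω) (h : Ω ≤ ⊤) (F G : SFun Ω n) :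
    SuperIntegralEq
      (distMulFun (SDist.restrict h (superHeaviside (-g)))
        (sDiracR F * G + F * sDiracL G))
      (distMulFun
        (distMulFun (funMulDist F (SDist.restrict h (superDelta g)))
          (SFun.restrict h (sDiracL (incl g)))) G) := by
  obtain ⟨W, hW, hWpos, hWK⟩ := exists_positive_part (body g) Ω
  have hH : SDist.restrict hW (SDist.restrict h (superHeaviside (-g))) = 0 := by
    rw [restrict_restrict]
    exact restrict_superHeaviside_neg_of_pos hg _ hWpos
  have hd : SDist.restrict hW (SDist.restrict h (superDelta g)) = 0 := by
    rw [restrict_restrict]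
    exact restrict_superDelta_eq_zero hg _ fun x hx => (hWpos x hx).ne'
  refine superIntegralEq_of_eq_add (P := funMulDist F (SDist.restrict h (superHeaviside (-g))))
    hcpt hΩ hW hWK ?_ ?_ ?_ G ?_
  · rw [restrict_distMulFun, hH, map_zero, LinearMap.zero_apply]
  · rw [restrict_distMulFun, restrict_distMulFun, restrict_funMulDist, hd, map_zero, map_zero,
      LinearMap.zero_apply, map_zero, LinearMap.zero_apply]
  · rw [restrict_funMulDist, hH, map_zero]
  · exact distMulFun_add_eq (restrict_mem_evScalar h (superHeaviside_mem_evScalar (-g)))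
      (diracR_funMulDist_restrict h (superHeaviside_mem_evScalar (-g))
        (diracR_superHeaviside_neg hg) F) G

theorem singSupp_superHeaviside_neg_subset {g : EvFun m n} (hg : IsRegular (body g)) :
    (superHeaviside (-g)).singSupp ⊆ {x : E m | ext0 (body g).1 x = 0} := by
  intro x hx
  by_contra hne
  obtain ⟨U, hU, c, hxU, hH, -, -⟩ := exists_restrict_superHeaviside hg hne
  exact notMem_singSupp_iff.2 ⟨U, hU, c, hxU, hH⟩ hx

theorem singSupp_superDelta_subset {g : EvFun m n} (hg : IsRegular (body g)) :
    (superDelta g).singSupp ⊆ {x : E m | ext0 (body g).1 x = 0} := by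
  intro x hx
  by_contra hne
  obtain ⟨U, hU, c, hxU, -, hd, -⟩ := exists_restrict_superHeaviside hg hne
  exact notMem_singSupp_iff.2 ⟨U, hU, 0, hxU, hd.trans toDist_zero.symm⟩ hx

/-- The Leibniz rule `(α β) ∂_x = α (β ∂_x) - β δ D` for the product of superdistributions, if
`α` is an even scalar distribution with `α ∂_x = -δ D`. It is checked locally: away from the
singular support of `β` the factor `β` is smooth, and near it `α` is assumed to be multiplication
by a superfunction `c` that commutes with `∂_x`, and `δ` to vanish. -/
theorem diracR_distMulDist {α β δ : SDist (⊤ : Opens (E m)) n} {D : SFun (⊤ : Opens (E m)) n}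
    (hα : α ∈ evScalar m n 𝓓'((⊤ : Opens (E m)), ℝ)) (h : diracR distDeriv α = -distMulFun δ D)
    (hloc : ∀ x, x ∈ β.singSupp → ∃ (U : Opens (E m)) (hU : U ≤ ⊤) (c : SFun U n), x ∈ U ∧
      SDist.restrict hU α = c.toDist ∧ SDist.restrict hU δ = 0 ∧
      ∀ γ : SDist U n, diracR distDeriv (funMulDist c γ) = funMulDist c (diracR distDeriv γ))
    (h1 : MulDefined α (diracR distDeriv β)) (h2 : MulDefined α β) (h3 : MulDefined β δ) :
    diracR distDeriv (distMulDist α β) =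
      distMulDist α (diracR distDeriv β) - distMulFun (distMulDist β δ) D := by
  refine tensorDist_eq_of_locally fun x _ => ?_
  by_cases hx : x ∈ β.singSupp
  · obtain ⟨U, hU, c, hxU, hH, hd, hc⟩ := hloc x hx
    refine ⟨U, hU, hxU, ?_⟩
    change SDist.restrict hU _ = SDist.restrict hU _
    rw [map_sub, restrict_diracR, restrict_distMulDist_left hU h2 hH,
      restrict_distMulDist_left hU h1 hH, restrict_distMulFun,
      restrict_distMulDist_right hU h3 (hd.trans toDist_zero.symm), hc, restrict_diracR, map_zero,
      map_zero, LinearMap.zero_apply, sub_zero]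
  · obtain ⟨U, hU, b, hxU, hb⟩ := notMem_singSupp_iff.1 hx
    refine ⟨U, hU, hxU, ?_⟩
    have hb' : SDist.restrict hU (diracR distDeriv β) = SFun.toDist (sDiracR b) := by
      rw [restrict_diracR, hb, diracR_toDist]
    have e1 : SDist.restrict hU (diracR distDeriv (distMulDist α β)) =
        diracR distDeriv (funMulDist b (SDist.restrict hU α)) := by
      rw [restrict_diracR, restrict_distMulDist_right hU h2 hb,
        funMulDist_comm b (restrict_mem_evScalar hU hα)]
    have e2 : SDist.restrict hU (distMulDist α (diracR distDeriv β)) =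
        distMulFun (SDist.restrict hU α) (sDiracR b) :=
      restrict_distMulDist_right hU h1 hb'
    have e3 : SDist.restrict hU (distMulFun (distMulDist β δ) D) =
        distMulFun (funMulDist b (SDist.restrict hU δ)) (SFun.restrict hU D) := by
      rw [restrict_distMulFun, restrict_distMulDist_left hU h3 hb]
    exact e1.trans ((diracR_funMulDist_restrict hU hα h b).trans
      ((map_sub (SDist.restrict hU) _ _).trans (congrArg₂ (· - ·) e2 e3)).symm)

theorem diracR_distMulDist_superHeaviside {g : EvFun m n} (hg : IsRegular (body g))
    {β : SDist (⊤ : Opens (E m)) n}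
    (hβ : Disjoint β.singSupp {x : E m | ext0 (body g).1 x = 0})
    (h1 : MulDefined (superHeaviside (-g)) (diracR distDeriv β))
    (h2 : MulDefined (superHeaviside (-g)) β) (h3 : MulDefined β (superDelta g)) :
    diracR distDeriv (distMulDist (superHeaviside (-g)) β) =
      distMulDist (superHeaviside (-g)) (diracR distDeriv β) -
        distMulFun (distMulDist β (superDelta g)) (sDiracL (incl g)) :=
  diracR_distMulDist (superHeaviside_mem_evScalar (-g)) (diracR_superHeaviside_neg hg)
    (fun _ hx => exists_restrict_superHeaviside hg (Set.disjoint_left.1 hβ hx)) h1 h2 h3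

/-- The Stokes formula for a superdistribution `β` and a superfunction `G`. -/
theorem superIntegralEq_distMulDist {g : EvFun m n}
    (hcpt : IsCompact {x : E m | ext0 (body g).1 x ≤ 0}) (hg : IsRegular (body g))
    {β : SDist (⊤ : Opens (E m)) n}
    (hβ : Disjoint β.singSupp {x : E m | ext0 (body g).1 x = 0})
    (h1 : MulDefined (superHeaviside (-g)) (diracR distDeriv β))
    (h2 : MulDefined (superHeaviside (-g)) β) (h3 : MulDefined β (superDelta g))
    {Ω : Opens (E m)} (hΩ : {x : E m | ext0 (body g).1 x ≤ 0} ⊆ Ω) (h : Ω ≤ ⊤) (G : SFun Ω n) :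
    SuperIntegralEq
      (distMulFun (SDist.restrict h
          (distMulDist (superHeaviside (-g)) (diracR distDeriv β))) G +
        distMulFun (SDist.restrict h
          (distMulDist (superHeaviside (-g)) β)) (sDiracL G))
      (distMulFun
        (distMulFun (SDist.restrict h (distMulDist β (superDelta g)))
          (SFun.restrict h (sDiracL (incl g)))) G) := by
  obtain ⟨W, hW, hWpos, hWK⟩ := exists_positive_part (body g) Ω
  have hH : SDist.restrict (hW.trans h) (superHeaviside (-g)) = SFun.toDist 0 :=
    (restrict_superHeaviside_neg_of_pos hg _ hWpos).trans toDist_zero.symm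
  have hd : SDist.restrict (hW.trans h) (superDelta g) = SFun.toDist 0 :=
    (restrict_superDelta_eq_zero hg _ fun x hx => (hWpos x hx).ne').trans toDist_zero.symm
  have hQ : SDist.restrict hW (SDist.restrict h
      (distMulDist (superHeaviside (-g)) (diracR distDeriv β))) = 0 := by
    rw [restrict_restrict, restrict_distMulDist_left _ h1 hH, zero_funMulDist]
  have hP : SDist.restrict hW (SDist.restrict h
      (distMulDist (superHeaviside (-g)) β)) = 0 := by
    rw [restrict_restrict, restrict_distMulDist_left _ h2 hH, zero_funMulDist]
  have hR : SDist.restrict hW (SDist.restrict h (distMulDist β (superDelta g))) = 0 := by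
    rw [restrict_restrict, restrict_distMulDist_right _ h3 hd, map_zero]
  refine superIntegralEq_of_eq_add (P := SDist.restrict h (distMulDist (superHeaviside (-g)) β))
    hcpt hΩ hW hWK ?_ ?_ hP G ?_
  · rw [map_add, restrict_distMulFun, restrict_distMulFun, hQ, hP, map_zero, LinearMap.zero_apply,
      LinearMap.zero_apply, add_zero]
  · rw [restrict_distMulFun, restrict_distMulFun, hR, map_zero, LinearMap.zero_apply, map_zero,
      LinearMap.zero_apply]
  · refine distMulFun_add_eq_of_diracR ?_ G
    rw [← restrict_diracR, diracR_distMulDist_superHeaviside hg hβ h1 h2 h3, map_sub,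
      restrict_distMulFun]

end Stokes

end SuperStokes

end

open SuperStokes in
theorem mainTheorem2 {m n : ℕ} (hm : m ≠ 0) (g : EvFun m n)
    (hcpt : IsCompact {x : E m | ext0 (body g).1 x ≤ 0})
    (hreg : ∀ x : E m, ext0 (body g).1 x = 0 → ∃ j : Fin m, ext0 (pderiv j (body g)).1 x ≠ 0) :
    -- the identity `∂_x[H(-g)] = -∂_x[g] δ(g)`
    diracL distDeriv (superHeaviside (-g)) =
        -funMulDist (diracL pderiv (EvFun.toSFun g)) (superDelta g) ∧
    -- the Stokes formula for superfunctions `F`, `G` on `Ω ⊇ {g₀ ≤ 0}`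
    (∀ (Ω : TopologicalSpace.Opens (E m)), {x : E m | ext0 (body g).1 x ≤ 0} ⊆ Ω →
      ∀ F G : SFun Ω n,
        SuperIntegralEq
          (distMulFun (SDist.restrict le_top (superHeaviside (-g)))
            (diracR pderiv F * G + F * diracL pderiv G))
          (distMulFun
            (distMulFun (funMulDist F (SDist.restrict le_top (superDelta g)))
              (SFun.restrict le_top (diracL pderiv (EvFun.toSFun g)))) G)) ∧
    -- the Stokes formula for a compactly supported superdistribution `β` and a superfunction `G`
    (∀ β : SDist (⊤ : TopologicalSpace.Opens (E m)) n, β.HasCompactSupp →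
      Disjoint β.singSupp {x : E m | ext0 (body g).1 x = 0} →
      -- the products `H(-g) (β ∂_x)`, `H(-g) β`, `β δ(g)` are defined
      MulDefined (superHeaviside (-g)) (diracR distDeriv β) ∧
      MulDefined (superHeaviside (-g)) β ∧
      MulDefined β (superDelta g) ∧
      ∀ (Ω : TopologicalSpace.Opens (E m)), {x : E m | ext0 (body g).1 x ≤ 0} ⊆ Ω →
        ∀ G : SFun Ω n,
          SuperIntegralEq
            (distMulFun (SDist.restrict le_top
                (distMulDist (superHeaviside (-g)) (diracR distDeriv β))) G +
              distMulFun (SDist.restrict le_top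
                (distMulDist (superHeaviside (-g)) β)) (diracL pderiv G))
            (distMulFun
              (distMulFun (SDist.restrict le_top (distMulDist β (superDelta g)))
                (SFun.restrict le_top (diracL pderiv (EvFun.toSFun g)))) G)) := by
  have hg : SuperStokes.IsRegular (body g) := hreg
  refine ⟨diracL_superHeaviside_neg g hg,
    fun Ω hΩ F G => superIntegralEq_superHeaviside hcpt hg hΩ le_top F G, fun β _ hβ => ?_⟩
  have hH := hβ.symm.mono_left (singSupp_superHeaviside_neg_subset hg)
  have h1 : MulDefined (superHeaviside (-g)) (diracR distDeriv β) :=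
    mulDefined_of_disjoint (hH.mono_right (singSupp_diracR_subset β))
  have h2 : MulDefined (superHeaviside (-g)) β := mulDefined_of_disjoint hH
  have h3 : MulDefined β (superDelta g) :=
    mulDefined_of_disjoint (hβ.mono_right (singSupp_superDelta_subset hg))
  exact ⟨h1, h2, h3, fun Ω hΩ G => superIntegralEq_distMulDist hcpt hg hβ h1 h2 h3 hΩ le_top G⟩
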